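/- Let $n\ge 2$, let $\Omega\subset\mathbb R^n$ be a bounded open set, $\delta(x)=d(x,\partial\Omega)$, $n'=n/(n-1)$, and let $W_2=\{\varphi\in C^2(\overline\Omega):\varphi=0\text{ on }\partial\Omega\}$. Let $L^{p,q}(\Omega)$ denote the Lorentz spaces, with norm $\|u\|_{p,q}=\left(\int_0^{|\Omega|}\left[t^{1/p}|u|_{**}(t)\right]^q\frac{dt}{t}\right)^{1/q}$ for $q<\infty$ and $\|u\|_{p,\infty}=\sup_{0<t\le|\Omega|}t^{1/p}|u|_{**}(t)$, where $|u|_{**}(t)=\frac1t\int_0^t|u|_*(\sigma)\,d\sigma$ and $|u|_*$ is the decreasing rearrangement of $|u|$. Let $u\in W^{1,1}_{loc}(\Omega)\cap L^{n',\infty}(\Omega)$ with $u/\delta\in L^1(\Omega)$. Let $\vec U\in L^{n,1}(\Omega)^n$ satisfy $\operatorname{div}\vec U=0$ in $\mathcal D'(\Omega)$ and $\vec U\cdot\vec\nu=0$ on $\partial\Omega$, these being understood in the weak sense that $$\int_\Omega\varphi\,\nabla\psi\cdot\vec U\,dx=-\int_\Omega\psi\,\nabla\varphi\cdot\vec U\,dx\qquad\text{for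 all }\varphi,\psi\in W_2 .$$ Assume that $f:=Lu=-\Delta u+\operatorname{div}(\vec U u)$, taken in $\mathcal D'(\Omega)$, belongs to $L^1(\Omega;\delta)$; that is, $f$ is a measurable function with $\int_\Omega|f|\,\delta\,dx<\infty$ and $$\int_\Omega u\,(-\Delta\eta-\vec U\cdot\nabla\eta)\,dx=\int_\Omega f\,\eta\,dx\qquad\text{for all }\eta\in C_c^\infty(\Omega).$$ Then, for every $\phi\in W_2$ with $\phi\ge 0$, writing $L^*\phi=-\Delta\phi-\vec U\cdot\nabla\phi$, all the integrands below are integrable over $\Omega$ and $$\int_\Omega u_+\,L^*\phi\,dx\le\int_\Omega\phi\,\operatorname{sign}_+(u)\,Lu\,dx,\qquad \int_\Omega|u|\,L^*\phi\,dx\le\int_\Omega\phi\,\operatorname{sign}(u)\,Lu\,dx,$$ where $u_+=\max(u,0)$, $\operatorname{sign}_+(\sigma)=1$ if $\sigma>0$ and $0$ otherwise, and $\operatorname{sign}(\sigma)=1,0,-1$ according as $\sigma>0$, $\sigma=0$, $\sigma<0$. -/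

import Mathlib

open MeasureTheory Set
open scoped ENNReal ContDiff

noncomputable section

namespace VWKato

/-! ### Rearrangements and Lorentz spaces -/

section Lorentz

variable {α : Type*} [MeasurableSpace α]

/-- The decreasing rearrangement `|u|_*` of `|u|` with respect to `μ`:
`|u|_*(s) = inf {t ≥ 0 : μ {|u| > t} ≤ s}`, with values in `[0, ∞]`. -/
def decRearr (u : α → ℝ) (μ : Measure α) (s : ℝ) : ℝ≥0∞ :=
  sInf {t : ℝ≥0∞ | μ {x | t < ‖u x‖ₑ} ≤ ENNReal.ofReal s}

/-- The averaged rearrangement `|u|_**(t) = (1 / t) ∫₀ᵗ |u|_*(σ) dσ`. -/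
def avgRearr (u : α → ℝ) (μ : Measure α) (t : ℝ) : ℝ≥0∞ :=
  (∫⁻ s in Ioo 0 t, decRearr u μ s) / ENNReal.ofReal t

/-- The Lorentz norm `‖u‖_{p,q}` built on `|u|_**`:
`(∫_{0 < t < μ(α)} [t^{1/p} |u|_**(t)]^q dt / t)^{1/q}` for `q < ∞`, and
`sup_{0 < t ≤ μ(α)} t^{1/p} |u|_**(t)` for `q = ∞`. -/
def lorentzNorm (u : α → ℝ) (p q : ℝ≥0∞) (μ : Measure α) : ℝ≥0∞ :=
  if q = ⊤ then
    ⨆ (t : ℝ) (_ : 0 < t ∧ ENNReal.ofReal t ≤ μ univ),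
      ENNReal.ofReal (t ^ (1 / p.toReal)) * avgRearr u μ t
  else
    (∫⁻ t in {t : ℝ | 0 < t ∧ ENNReal.ofReal t < μ univ},
      (ENNReal.ofReal (t ^ (1 / p.toReal)) * avgRearr u μ t) ^ q.toReal /
        ENNReal.ofReal t) ^ (1 / q.toReal)

/-- Membership in the Lorentz space `L^{p,q}(μ)`. -/
def MemLorentz (u : α → ℝ) (p q : ℝ≥0∞) (μ : Measure α) : Prop :=
  AEStronglyMeasurable u μ ∧ lorentzNorm u p q μ < ⊤

end Lorentz

/-! ### Function spaces on an open subset of `ℝⁿ` -/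

section Spaces

variable {n : ℕ}

/-- The distance to the boundary, `δ(x) = d(x, ∂Ω)`. -/
def bdist (Ω : Set (EuclideanSpace ℝ (Fin n))) (x : EuclideanSpace ℝ (Fin n)) : ℝ :=
  Metric.infDist x (frontier Ω)

/-- `η ∈ C_c^∞(Ω)`. -/
structure IsTestFunction (Ω : Set (EuclideanSpace ℝ (Fin n)))
    (η : EuclideanSpace ℝ (Fin n) → ℝ) : Prop where
  smooth : ContDiff ℝ ∞ η
  compact : HasCompactSupport η
  supp : tsupport η ⊆ Ω

/-- `G` is the weak gradient of `u` on `Ω`: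
`∫_Ω u ∂ᵢη = - ∫_Ω Gᵢ η` for all `i` and all `η ∈ C_c^∞(Ω)`. -/
def HasWeakGradient (Ω : Set (EuclideanSpace ℝ (Fin n)))
    (u : EuclideanSpace ℝ (Fin n) → ℝ)
    (G : EuclideanSpace ℝ (Fin n) → EuclideanSpace ℝ (Fin n)) : Prop :=
  ∀ η : EuclideanSpace ℝ (Fin n) → ℝ, IsTestFunction Ω η → ∀ i : Fin n,
    ∫ x in Ω, u x * fderiv ℝ η x (EuclideanSpace.single i 1) = - ∫ x in Ω, G x i * η x

/-- `u ∈ W^{1,1}_loc(Ω)`. -/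
def MemW11Loc (Ω : Set (EuclideanSpace ℝ (Fin n)))
    (u : EuclideanSpace ℝ (Fin n) → ℝ) : Prop :=
  LocallyIntegrableOn u Ω ∧
    ∃ G : EuclideanSpace ℝ (Fin n) → EuclideanSpace ℝ (Fin n),
      LocallyIntegrableOn G Ω ∧ HasWeakGradient Ω u G

/-- `φ ∈ W₂`: `φ ∈ C²(closure Ω)` (that is, `φ` is `C²` in `Ω`, and `φ` together with its
derivatives of order one and two extends continuously to the closure of `Ω`), and `φ = 0`
on `∂Ω`. -/
structure MemW2 (Ω : Set (EuclideanSpace ℝ (Fin n)))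
    (φ : EuclideanSpace ℝ (Fin n) → ℝ) : Prop where
  contDiffOn : ContDiffOn ℝ 2 φ Ω
  continuousOn : ContinuousOn φ (closure Ω)
  extend_fderiv : ∃ D : EuclideanSpace ℝ (Fin n) → (EuclideanSpace ℝ (Fin n) →L[ℝ] ℝ),
    ContinuousOn D (closure Ω) ∧ EqOn D (fderiv ℝ φ) Ω
  extend_fderiv_two : ∃ H : EuclideanSpace ℝ (Fin n) →
      (EuclideanSpace ℝ (Fin n) →L[ℝ] EuclideanSpace ℝ (Fin n) →L[ℝ] ℝ),
    ContinuousOn H (closure Ω) ∧ EqOn H (fderiv ℝ (fderiv ℝ φ)) Ω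
  boundary : ∀ x ∈ frontier Ω, φ x = 0

/-- `div U = 0` in `𝓓'(Ω)`. -/
def DivFree (Ω : Set (EuclideanSpace ℝ (Fin n)))
    (U : EuclideanSpace ℝ (Fin n) → EuclideanSpace ℝ (Fin n)) : Prop :=
  ∀ η : EuclideanSpace ℝ (Fin n) → ℝ, IsTestFunction Ω η →
    ∫ x in Ω, fderiv ℝ η x (U x) = 0

/-- The weak form of `div U = 0` in `Ω`, `U · ν = 0` on `∂Ω`:
`∫_Ω φ ∇ψ · U = - ∫_Ω ψ ∇φ · U` for all `φ, ψ ∈ W₂`. -/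
def WeakTangential (Ω : Set (EuclideanSpace ℝ (Fin n)))
    (U : EuclideanSpace ℝ (Fin n) → EuclideanSpace ℝ (Fin n)) : Prop :=
  ∀ φ ψ : EuclideanSpace ℝ (Fin n) → ℝ, MemW2 Ω φ → MemW2 Ω ψ →
    ∫ x in Ω, φ x * fderiv ℝ ψ x (U x) = - ∫ x in Ω, ψ x * fderiv ℝ φ x (U x)

/-- The formal adjoint `L^*φ = -Δφ - U · ∇φ`. -/
def Lstar (U : EuclideanSpace ℝ (Fin n) → EuclideanSpace ℝ (Fin n))
    (φ : EuclideanSpace ℝ (Fin n) → ℝ) (x : EuclideanSpace ℝ (Fin n)) : ℝ :=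
  - Laplacian.laplacian φ x - fderiv ℝ φ x (U x)

/-- `L u = -Δu + div (U u) = f` in `𝓓'(Ω)`:
`∫_Ω u (-Δη - U · ∇η) = ∫_Ω f η` for all `η ∈ C_c^∞(Ω)`. -/
def DistribL (Ω : Set (EuclideanSpace ℝ (Fin n)))
    (U : EuclideanSpace ℝ (Fin n) → EuclideanSpace ℝ (Fin n))
    (u f : EuclideanSpace ℝ (Fin n) → ℝ) : Prop :=
  ∀ η : EuclideanSpace ℝ (Fin n) → ℝ, IsTestFunction Ω η →
    ∫ x in Ω, u x * Lstar U η x = ∫ x in Ω, f x * η x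

end Spaces

/-- `sign₊(σ) = 1` if `σ > 0`, and `0` otherwise. -/
def signPos (σ : ℝ) : ℝ := if 0 < σ then 1 else 0

end VWKato

end

/-! Formally, multiply `Lu = f` by `p(u)φ`, where `p` is a smooth nondecreasing approximation of
`sign₊` and `j' = p`, `j(0) = 0`. Diffusion leaves the term `-∫ p'(u)|∇u|²φ ≤ 0`, and `div U = 0`
turns the drift term into `-∫ j(u) U·∇φ`, so `∫ j(u) L*φ ≤ ∫ p(u) f φ`. Letting `p → sign₊` gives
the claim. For `u` merely in `W^{1,1}_loc`, with `uU` merely integrable, the multiplication is not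
legitimate: mollifying the equation creates the commutator `u_k U - (uU)_k`, which can be absorbed
by `|∇u_k|²` only if it is small in `L²`.

Bounded solutions. Since `L^{n,1} ⊂ L²` for `n ≥ 2` on a set of finite measure, the commutator of a
bounded function tends to zero in `L²` (`tendsto_lintegral_commutator`), and the formal computation
becomes rigorous (`energy_inequality`, `kato_of_bounded`).

Reduction to bounded solutions. Convolution with `c⁻¹ z/|z|ⁿ` is an operator `pot` that inverts the
gradient. The kernel is in weak `L^{n'}` and the drift in `L^{n,1}`, so the potential of the drift
cut down to a small ball is uniformly at most `1/2` (`exists_ball_rieszPot_le`). Hence `w ↦ pot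
(wV)` halves sup norms and, by Tonelli, `pot` maps `L¹` into `L¹(|V|dx)` with norm at most `1/2`. A
localised solution satisfies `v = pot (H + vV)` with `H = Dv - vV`. Replacing `H` by its
mollifications gives bounded solutions `w_k` with mollified data, and `w_k → v`, `w_k V → vV` in
`L¹` locally (`exists_bounded_approx`, `kato_local_smooth`). The inequality passes to the limit,
then `p → sign₊`.

From balls to `φ`. A partition of unity and mollification give the inequality for compactly
supported `C²` test functions. For `φ ∈ W₂` the test function is `h_k(φ)`, with `h_k` convex, close
to the identity and zero near `0`. Then `L*(h_k(φ)) = h_k'(φ)L*φ - h_k''(φ)|∇φ|²`. Nonnegativity of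
`φ` and its bounded second derivatives give `|∇φ|² ≤ Aφ/δ` (`sq_norm_fderiv_le`), and `s h_k''(s) ≤
B` (`exists_cutTwo_mul_le`), so the error is dominated by `AB|u|/δ`: this is the role of `u/δ ∈ L¹`.
On `{φ = 0}` the function `φ` has an interior minimum, so `L*φ ≤ 0` there. The statement for `|u|`
is the sum of those for `u` and `-u`. -/

set_option linter.unusedSectionVars false

noncomputable section

namespace VWKato

open Filter Topology

/-! ### Partial derivatives and integration by parts -/

section Calculus

variable {n : ℕ}

/-- The `i`-th partial derivative. -/
def pd (i : Fin n) (f : EuclideanSpace ℝ (Fin n) → ℝ) (x : EuclideanSpace ℝ (Fin n)) : ℝ :=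
  fderiv ℝ f x (EuclideanSpace.single i 1)

theorem clm_eq_sum (T : EuclideanSpace ℝ (Fin n) →L[ℝ] ℝ) (h : EuclideanSpace ℝ (Fin n)) :
    T h = ∑ i, h i * T (EuclideanSpace.single i 1) := by
  conv_lhs => rw [← (EuclideanSpace.basisFun (Fin n) ℝ).sum_repr h]
  simp

theorem fderiv_eq_sum_pd (f : EuclideanSpace ℝ (Fin n) → ℝ) (x h : EuclideanSpace ℝ (Fin n)) :
    fderiv ℝ f x h = ∑ i, h i * pd i f x :=
  clm_eq_sum _ _

theorem gradient_apply (f : EuclideanSpace ℝ (Fin n) → ℝ) (x : EuclideanSpace ℝ (Fin n))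
    (i : Fin n) : gradient f x i = pd i f x := by
  have h : inner ℝ (gradient f x) (EuclideanSpace.single i (1 : ℝ)) = pd i f x := by
    simp [gradient, pd]
  rw [← h, EuclideanSpace.inner_single_right]
  simp only [one_mul, conj_trivial]

theorem inner_gradient (f : EuclideanSpace ℝ (Fin n) → ℝ) (x h : EuclideanSpace ℝ (Fin n)) :
    inner ℝ (gradient f x) h = fderiv ℝ f x h := by
  simp [gradient]

theorem laplacian_eq_sum (f : EuclideanSpace ℝ (Fin n) → ℝ) (x : EuclideanSpace ℝ (Fin n)) :
    Laplacian.laplacian f x = ∑ i : Fin n,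
      fderiv ℝ (fderiv ℝ f) x (EuclideanSpace.single i 1) (EuclideanSpace.single i 1) := by
  have h := congrFun (InnerProductSpace.laplacian_eq_iteratedFDeriv_orthonormalBasis f
    (EuclideanSpace.basisFun (Fin n) ℝ)) x
  refine h.trans (Finset.sum_congr rfl fun i _ => ?_)
  rw [iteratedFDeriv_two_apply]
  simp

theorem pd_pd {f : EuclideanSpace ℝ (Fin n) → ℝ} {x : EuclideanSpace ℝ (Fin n)}
    (hf : DifferentiableAt ℝ (fderiv ℝ f) x) (i j : Fin n) :
    pd i (pd j f) x =
      fderiv ℝ (fderiv ℝ f) x (EuclideanSpace.single i 1) (EuclideanSpace.single j 1) := by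
  unfold pd
  rw [fderiv_clm_apply hf (by fun_prop)]
  simp

theorem differentiableAt_fderiv {f : EuclideanSpace ℝ (Fin n) → ℝ} {x : EuclideanSpace ℝ (Fin n)}
    (hf : ContDiffAt ℝ 2 f x) : DifferentiableAt ℝ (fderiv ℝ f) x :=
  (hf.fderiv_right (m := 1) (by norm_num)).differentiableAt (by norm_num)

theorem laplacian_eq_sum_pd {f : EuclideanSpace ℝ (Fin n) → ℝ} {x : EuclideanSpace ℝ (Fin n)}
    (hf : ContDiffAt ℝ 2 f x) : Laplacian.laplacian f x = ∑ i, pd i (pd i f) x := by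
  rw [laplacian_eq_sum]
  exact Finset.sum_congr rfl fun i _ => (pd_pd (differentiableAt_fderiv hf) i i).symm

theorem pd_comm {f : EuclideanSpace ℝ (Fin n) → ℝ} (hf : ContDiff ℝ 2 f) (i j : Fin n) :
    pd i (pd j f) = pd j (pd i f) := by
  funext x
  rw [pd_pd (differentiableAt_fderiv hf.contDiffAt), pd_pd (differentiableAt_fderiv hf.contDiffAt)]
  exact (hf.contDiffAt.isSymmSndFDerivAt (by simp)) _ _

theorem contDiff_pd {f : EuclideanSpace ℝ (Fin n) → ℝ} {k m : WithTop ℕ∞} (hf : ContDiff ℝ k f)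
    (hm : m + 1 ≤ k) (i : Fin n) : ContDiff ℝ m (pd i f) :=
  (hf.fderiv_right hm).clm_apply contDiff_const

theorem tsupport_pd_subset (f : EuclideanSpace ℝ (Fin n) → ℝ) (i : Fin n) :
    tsupport (pd i f) ⊆ tsupport f :=
  tsupport_fderiv_apply_subset ℝ _

theorem hasCompactSupport_pd {f : EuclideanSpace ℝ (Fin n) → ℝ} (hf : HasCompactSupport f)
    (i : Fin n) : HasCompactSupport (pd i f) :=
  hf.fderiv_apply ℝ _

theorem continuous_laplacian {f : EuclideanSpace ℝ (Fin n) → ℝ} (hf : ContDiff ℝ 2 f) :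
    Continuous (Laplacian.laplacian f) := by
  have : Laplacian.laplacian f = fun x => ∑ i, pd i (pd i f) x :=
    funext fun x => laplacian_eq_sum_pd hf.contDiffAt
  rw [this]
  exact continuous_finsetSum _ fun i _ =>
    (contDiff_pd (m := 0) (contDiff_pd (m := 1) hf (by norm_num) i) (by norm_num) i).continuous

theorem laplacian_eq_zero_of_notMem_tsupport {f : EuclideanSpace ℝ (Fin n) → ℝ}
    {x : EuclideanSpace ℝ (Fin n)} (hx : x ∉ tsupport f) : Laplacian.laplacian f x = 0 := by
  have h : f =ᶠ[𝓝 x] fun _ => (0 : ℝ) := notMem_tsupport_iff_eventuallyEq.1 hx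
  rw [laplacian_eq_sum]
  have h2 : fderiv ℝ f =ᶠ[𝓝 x] fun _ => 0 := by
    filter_upwards [h.fderiv (𝕜 := ℝ)] with y hy
    simpa using hy
  rw [h2.fderiv_eq]
  simp

theorem fderiv_eq_zero_of_notMem_tsupport {f : EuclideanSpace ℝ (Fin n) → ℝ}
    {x : EuclideanSpace ℝ (Fin n)} (hx : x ∉ tsupport f) : fderiv ℝ f x = 0 := by
  have h : f =ᶠ[𝓝 x] fun _ => (0 : ℝ) := notMem_tsupport_iff_eventuallyEq.1 hx
  rw [h.fderiv_eq]
  simp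

theorem hasCompactSupport_laplacian {f : EuclideanSpace ℝ (Fin n) → ℝ} (hf : HasCompactSupport f) :
    HasCompactSupport (Laplacian.laplacian f) :=
  hf.mono' fun _ hx => by
    by_contra h
    exact hx (laplacian_eq_zero_of_notMem_tsupport h)

theorem integral_mul_pd {f g : EuclideanSpace ℝ (Fin n) → ℝ} (hf : ContDiff ℝ 1 f)
    (hg : ContDiff ℝ 1 g) (hgc : HasCompactSupport g) (i : Fin n) :
    ∫ x, f x * pd i g x = - ∫ x, pd i f x * g x := by
  have hf' := (contDiff_pd (m := 0) hf (by norm_num) i).continuous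
  have hg' := (contDiff_pd (m := 0) hg (by norm_num) i).continuous
  refine integral_mul_fderiv_eq_neg_fderiv_mul_of_integrable ?_ ?_ ?_
    (fun x _ => hf.differentiable (by norm_num) x) (fun x _ => hg.differentiable (by norm_num) x)
  · exact (hf'.mul hg.continuous).integrable_of_hasCompactSupport hgc.mul_left
  · exact (hf.continuous.mul hg').integrable_of_hasCompactSupport
      (hasCompactSupport_pd hgc i).mul_left
  · exact (hf.continuous.mul hg.continuous).integrable_of_hasCompactSupport hgc.mul_left

theorem IsTestFunction.contDiff_two {Ω : Set (EuclideanSpace ℝ (Fin n))}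
    {η : EuclideanSpace ℝ (Fin n) → ℝ} (h : IsTestFunction Ω η) : ContDiff ℝ 2 η :=
  contDiff_infty.1 h.smooth 2

theorem IsTestFunction.contDiff_one {Ω : Set (EuclideanSpace ℝ (Fin n))}
    {η : EuclideanSpace ℝ (Fin n) → ℝ} (h : IsTestFunction Ω η) : ContDiff ℝ 1 η :=
  contDiff_infty.1 h.smooth 1

theorem IsTestFunction.mono {Ω Ω' : Set (EuclideanSpace ℝ (Fin n))}
    {η : EuclideanSpace ℝ (Fin n) → ℝ} (h : IsTestFunction Ω η) (hΩ : Ω ⊆ Ω') :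
    IsTestFunction Ω' η :=
  ⟨h.smooth, h.compact, h.supp.trans hΩ⟩

theorem IsTestFunction.pd {Ω : Set (EuclideanSpace ℝ (Fin n))}
    {η : EuclideanSpace ℝ (Fin n) → ℝ} (h : IsTestFunction Ω η) (i : Fin n) :
    IsTestFunction Ω (VWKato.pd i η) :=
  ⟨contDiff_pd h.smooth (by simp) i, hasCompactSupport_pd h.compact i,
    (tsupport_pd_subset η i).trans h.supp⟩

end Calculus

/-! ### Mollification -/

section Mollifier

variable {n : ℕ} {F : Type*} [NormedAddCommGroup F] [NormedSpace ℝ F] [CompleteSpace F]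

/-- A sequence of bump functions shrinking to the origin. -/
def bump (n k : ℕ) : ContDiffBump (0 : EuclideanSpace ℝ (Fin n)) where
  -- The ratio of the two radii stays equal to `2`; a bounded ratio is what a.e. convergence at
  -- Lebesgue points requires.
  rIn := 1 / (2 * ((k : ℝ) + 1))
  rOut := 1 / ((k : ℝ) + 1)
  rIn_pos := by positivity
  rIn_lt_rOut := by
    apply one_div_lt_one_div_of_lt
    · positivity
    · have : (0 : ℝ) < k + 1 := by positivity
      linarith

/-- The standard mollifier. -/
def rho (k : ℕ) : EuclideanSpace ℝ (Fin n) → ℝ := (bump n k).normed volume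

/-- Convolution with the standard mollifier. -/
def moll (k : ℕ) (h : EuclideanSpace ℝ (Fin n) → F) : EuclideanSpace ℝ (Fin n) → F :=
  convolution (rho k) h (ContinuousLinearMap.lsmul ℝ ℝ) volume

theorem rho_nonneg (k : ℕ) (x : EuclideanSpace ℝ (Fin n)) : 0 ≤ rho k x :=
  (bump n k).nonneg_normed x

theorem integral_rho (k : ℕ) : ∫ x : EuclideanSpace ℝ (Fin n), rho k x = 1 :=
  (bump n k).integral_normed

theorem integrable_rho (k : ℕ) : Integrable (rho k : EuclideanSpace ℝ (Fin n) → ℝ) :=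
  (bump n k).integrable_normed

theorem contDiff_rho (k : ℕ) : ContDiff ℝ ∞ (rho k : EuclideanSpace ℝ (Fin n) → ℝ) :=
  (bump n k).contDiff_normed

theorem continuous_rho (k : ℕ) : Continuous (rho k : EuclideanSpace ℝ (Fin n) → ℝ) :=
  (contDiff_rho k).continuous

theorem hasCompactSupport_rho (k : ℕ) :
    HasCompactSupport (rho k : EuclideanSpace ℝ (Fin n) → ℝ) :=
  (bump n k).hasCompactSupport_normed

theorem rho_neg (k : ℕ) (x : EuclideanSpace ℝ (Fin n)) : rho k (-x) = rho k x :=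
  (bump n k).normed_neg x

theorem support_rho (k : ℕ) :
    Function.support (rho k : EuclideanSpace ℝ (Fin n) → ℝ) =
      Metric.ball 0 (1 / ((k : ℝ) + 1)) :=
  (bump n k).support_normed_eq

theorem tendsto_rOut : Tendsto (fun k : ℕ => (bump n k).rOut) atTop (𝓝 0) :=
  tendsto_one_div_add_atTop_nhds_zero_nat

theorem moll_eq (k : ℕ) (h : EuclideanSpace ℝ (Fin n) → F) (x : EuclideanSpace ℝ (Fin n)) :
    moll k h x = ∫ t, rho k t • h (x - t) :=
  convolution_lsmul

theorem moll_eq_swap (k : ℕ) (h : EuclideanSpace ℝ (Fin n) → F) (x : EuclideanSpace ℝ (Fin n)) :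
    moll k h x = ∫ y, rho k (x - y) • h y :=
  convolution_lsmul_swap

theorem integrable_rho_smul {k : ℕ} {h : EuclideanSpace ℝ (Fin n) → F} (hh : LocallyIntegrable h)
    (x : EuclideanSpace ℝ (Fin n)) : Integrable fun t => rho k t • h (x - t) :=
  (hasCompactSupport_rho k).convolutionExists_left (ContinuousLinearMap.lsmul ℝ ℝ)
    (continuous_rho k) hh x

theorem contDiff_moll (k : ℕ) {h : EuclideanSpace ℝ (Fin n) → F} (hh : LocallyIntegrable h) :
    ContDiff ℝ ∞ (moll k h) :=
  (hasCompactSupport_rho k).contDiff_convolution_left _ (contDiff_rho k) hh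

theorem norm_moll_le {k : ℕ} {h : EuclideanSpace ℝ (Fin n) → F} {M : ℝ}
    (hM : ∀ x, ‖h x‖ ≤ M) (x : EuclideanSpace ℝ (Fin n)) : ‖moll k h x‖ ≤ M := by
  rw [moll_eq]
  calc ‖∫ t, rho k t • h (x - t)‖ ≤ ∫ t : EuclideanSpace ℝ (Fin n), rho k t * M := by
        refine norm_integral_le_of_norm_le ((integrable_rho k).mul_const M) (ae_of_all _ fun t => ?_)
        rw [norm_smul, Real.norm_of_nonneg (rho_nonneg k t)]
        exact mul_le_mul_of_nonneg_left (hM _) (rho_nonneg k t)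
    _ = M := by rw [integral_mul_const, integral_rho, one_mul]

theorem moll_nonneg {k : ℕ} {h : EuclideanSpace ℝ (Fin n) → ℝ} (hh : ∀ x, 0 ≤ h x)
    (x : EuclideanSpace ℝ (Fin n)) : 0 ≤ moll k h x := by
  rw [moll_eq]
  exact integral_nonneg fun t => mul_nonneg (rho_nonneg k t) (hh _)

theorem ae_tendsto_moll {h : EuclideanSpace ℝ (Fin n) → F} (hh : LocallyIntegrable h) :
    ∀ᵐ x, Tendsto (fun k => moll k h x) atTop (𝓝 (h x)) := by
  refine ContDiffBump.ae_convolution_tendsto_right_of_locallyIntegrable (K := 2) tendsto_rOut ?_ hh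
  refine Eventually.of_forall fun k => le_of_eq ?_
  simp only [bump]
  field_simp

theorem tendsto_moll {h : EuclideanSpace ℝ (Fin n) → F} (hh : Continuous h)
    (x : EuclideanSpace ℝ (Fin n)) : Tendsto (fun k => moll k h x) atTop (𝓝 (h x)) :=
  ContDiffBump.convolution_tendsto_right_of_continuous tendsto_rOut hh x

theorem tsupport_moll_subset (k : ℕ) {h : EuclideanSpace ℝ (Fin n) → F} :
    tsupport (moll k h) ⊆ Metric.cthickening (1 / ((k : ℝ) + 1)) (tsupport h) := by
  refine closure_minimal ?_ Metric.isClosed_cthickening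
  refine (support_convolution_subset _).trans ?_
  rintro _ ⟨a, ha, b, hb, rfl⟩
  rw [support_rho] at ha
  refine Metric.mem_cthickening_of_dist_le _ b _ _ (subset_tsupport _ hb) ?_
  simpa [dist_eq_norm] using (mem_ball_zero_iff.1 ha).le

theorem hasCompactSupport_moll (k : ℕ) {h : EuclideanSpace ℝ (Fin n) → F}
    (hh : HasCompactSupport h) : HasCompactSupport (moll k h) :=
  (hh.isCompact.cthickening).of_isClosed_subset (isClosed_tsupport _) (tsupport_moll_subset k)

theorem eventually_cthickening_subset {K S : Set (EuclideanSpace ℝ (Fin n))} (hK : IsCompact K)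
    (hS : IsOpen S) (h : K ⊆ S) :
    ∀ᶠ k : ℕ in atTop, Metric.cthickening (1 / ((k : ℝ) + 1)) K ⊆ S := by
  obtain ⟨δ, hδ, hsub⟩ := hK.exists_cthickening_subset_open hS h
  filter_upwards [(tendsto_one_div_add_atTop_nhds_zero_nat (𝕜 := ℝ)).eventually_lt_const hδ]
    with k hk
  exact (Metric.cthickening_mono hk.le _).trans hsub

theorem fderiv_moll {h : EuclideanSpace ℝ (Fin n) → ℝ} (hh : ContDiff ℝ 1 h)
    (hc : HasCompactSupport h) (k : ℕ) : fderiv ℝ (moll k h) = moll k (fderiv ℝ h) := by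
  funext x
  exact (hc.hasFDerivAt_convolution_right _ (integrable_rho k).locallyIntegrable hh x).fderiv

theorem moll_clm {G : Type*} [NormedAddCommGroup G] [NormedSpace ℝ G] [CompleteSpace G] (k : ℕ)
    {h : EuclideanSpace ℝ (Fin n) → F} (hh : LocallyIntegrable h) (T : F →L[ℝ] G)
    (x : EuclideanSpace ℝ (Fin n)) : moll k (fun y => T (h y)) x = T (moll k h x) := by
  rw [moll_eq, moll_eq, ← T.integral_comp_comm (integrable_rho_smul hh x)]
  simp

theorem pd_moll {h : EuclideanSpace ℝ (Fin n) → ℝ} (hh : ContDiff ℝ 1 h)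
    (hc : HasCompactSupport h) (k : ℕ) (i : Fin n) : pd i (moll k h) = moll k (pd i h) := by
  funext x
  have hcont : Continuous (fderiv ℝ h) := hh.continuous_fderiv one_ne_zero
  have := moll_clm k hcont.locallyIntegrable
    (ContinuousLinearMap.apply ℝ ℝ (EuclideanSpace.single i (1 : ℝ))) x
  simp only [ContinuousLinearMap.apply_apply] at this
  unfold pd
  rw [fderiv_moll hh hc k, this]

theorem contDiff_moll_compact (k : ℕ) {h : EuclideanSpace ℝ (Fin n) → F} (hh : Continuous h) :
    ContDiff ℝ ∞ (moll k h) :=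
  contDiff_moll k hh.locallyIntegrable

theorem moll_finset_sum {ι : Type*} (s : Finset ι) (k : ℕ) {h : ι → EuclideanSpace ℝ (Fin n) → F}
    (hh : ∀ i, LocallyIntegrable (h i)) (x : EuclideanSpace ℝ (Fin n)) :
    moll k (fun y => ∑ i ∈ s, h i y) x = ∑ i ∈ s, moll k (h i) x := by
  simp_rw [moll_eq, Finset.smul_sum]
  exact integral_finsetSum _ fun i _ => integrable_rho_smul (hh i) x

theorem laplacian_moll {h : EuclideanSpace ℝ (Fin n) → ℝ} (hh : ContDiff ℝ 2 h)
    (hc : HasCompactSupport h) (k : ℕ) :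
    Laplacian.laplacian (moll k h) = moll k (Laplacian.laplacian h) := by
  funext x
  have h1 := fun i => contDiff_pd (m := 1) hh (by norm_num) i
  have h2 := fun i => (contDiff_pd (m := 0) (h1 i) (by norm_num) i).continuous
  rw [laplacian_eq_sum_pd (contDiff_infty.1 (contDiff_moll_compact k hh.continuous) 2).contDiffAt]
  have : Laplacian.laplacian h = fun y => ∑ i, pd i (pd i h) y :=
    funext fun y => laplacian_eq_sum_pd hh.contDiffAt
  rw [this, moll_finset_sum _ k fun i => (h2 i).locallyIntegrable]
  refine Finset.sum_congr rfl fun i _ => ?_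
  rw [pd_moll (hh.of_le (by norm_num)) hc, pd_moll (h1 i) (hasCompactSupport_pd hc i)]

theorem IsTestFunction.moll {S S' : Set (EuclideanSpace ℝ (Fin n))}
    {η : EuclideanSpace ℝ (Fin n) → ℝ} (h : IsTestFunction S η) {k : ℕ}
    (hk : Metric.cthickening (1 / ((k : ℝ) + 1)) (tsupport η) ⊆ S') :
    IsTestFunction S' (VWKato.moll k η) :=
  ⟨contDiff_moll_compact k h.smooth.continuous, hasCompactSupport_moll k h.compact,
    (tsupport_moll_subset k).trans hk⟩

/-- Fubini and the evenness of `rho`: mollification is symmetric, so a mollified equation is the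
original equation with mollified test functions. -/
theorem integral_moll_mul {f ψ : EuclideanSpace ℝ (Fin n) → ℝ} (hf : Integrable f)
    (hψ : Continuous ψ) (hψc : HasCompactSupport ψ) (k : ℕ) :
    ∫ x, moll k f x * ψ x = ∫ x, f x * moll k ψ x := by
  simp_rw [moll_eq_swap, ← integral_mul_const, ← integral_const_mul, smul_eq_mul]
  rw [integral_integral_swap]
  · refine integral_congr_ae (ae_of_all _ fun y => integral_congr_ae (ae_of_all _ fun x => ?_))
    simp only
    rw [← rho_neg, neg_sub]
    ring
  · obtain ⟨M, hM⟩ := hψc.exists_bound_of_continuous hψ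
    have h1 := Integrable.convolution_integrand (ContinuousLinearMap.mul ℝ ℝ) (μ := volume)
      (ν := volume) hf (integrable_rho (n := n) k)
    refine (h1.mul_bdd (g := fun p => ψ p.1) (c := M) ?_ (ae_of_all _ fun p => hM _)).congr
      (ae_of_all _ fun p => ?_)
    · exact (hψ.comp continuous_fst).aestronglyMeasurable
    · simp only [ContinuousLinearMap.mul_apply', Function.uncurry]
      ring

/-- The derivative falls on `rho`. Written as a derivative in `y` of `rho (x - y)`, whence the sign,
the right side has the shape of a weak derivative tested against a test function. -/
theorem pd_moll_of_locallyIntegrable {h : EuclideanSpace ℝ (Fin n) → ℝ} (hh : LocallyIntegrable h)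
    (k : ℕ) (i : Fin n) (x : EuclideanSpace ℝ (Fin n)) :
    pd i (moll k h) x = - ∫ y, h y * pd i (fun z => rho k (x - z)) y := by
  have h1 := ((hasCompactSupport_rho (n := n) k).hasFDerivAt_convolution_left
    (ContinuousLinearMap.lsmul ℝ ℝ) (contDiff_infty.1 (contDiff_rho k) 1) hh x)
  have h2 : pd i (moll k h) x = ∫ y, h y * pd i (rho k) (x - y) := by
    unfold pd moll
    have hc : HasCompactSupport (fderiv ℝ (rho (n := n) k)) := (hasCompactSupport_rho k).fderiv ℝ
    have hex := (hc.convolutionExists_left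
      ((ContinuousLinearMap.lsmul ℝ ℝ : ℝ →L[ℝ] ℝ →L[ℝ] ℝ).precompL (EuclideanSpace ℝ (Fin n)))
      ((contDiff_infty.1 (contDiff_rho k) 1).continuous_fderiv one_ne_zero) hh) x
    rw [h1.fderiv, convolution_eq_swap, ContinuousLinearMap.integral_apply]
    · refine integral_congr_ae (ae_of_all _ fun y => ?_)
      simp [ContinuousLinearMap.precompL_apply, mul_comm]
    · have := hex.integrable_swap
      exact this
  rw [h2, ← integral_neg]
  refine integral_congr_ae (ae_of_all _ fun y => ?_)
  simp only [pd]
  have h3 : HasFDerivAt (fun z => rho k (x - z))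
      ((fderiv ℝ (rho k) (x - y)).comp (-ContinuousLinearMap.id ℝ _)) y := by
    have := ((contDiff_rho k).differentiable (by simp) (x - y)).hasFDerivAt
    exact this.comp y ((hasFDerivAt_id y).const_sub x)
  rw [h3.fderiv]
  simp

end Mollifier

/-! ### Convergence of mollifications in `L^q` -/

section MollifierLp

variable {n : ℕ} {F : Type*} [NormedAddCommGroup F] [NormedSpace ℝ F] [CompleteSpace F]

/-- Composition with measure preserving continuous maps acts continuously on `L^p` for finite `p`;
translations are a continuous family of such maps. -/
theorem tendsto_eLpNorm_translate {p : ℝ≥0∞} (hp : 1 ≤ p) (hp' : p ≠ ⊤)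
    {h : EuclideanSpace ℝ (Fin n) → F} (hh : MemLp h p) :
    Tendsto (fun t : EuclideanSpace ℝ (Fin n) => eLpNorm (fun x => h (x - t) - h x) p)
      (𝓝 0) (𝓝 0) := by
  have : Fact (1 ≤ p) := ⟨hp⟩
  let g : EuclideanSpace ℝ (Fin n) → C(EuclideanSpace ℝ (Fin n), EuclideanSpace ℝ (Fin n)) :=
    (ContinuousMap.mk (fun q : EuclideanSpace ℝ (Fin n) × EuclideanSpace ℝ (Fin n) => q.2 - q.1)
      (by fun_prop)).curry
  have hgm : ∀ t, MeasurePreserving (g t) volume volume := fun t =>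
    measurePreserving_sub_right volume t
  have hg : Tendsto g (𝓝 0) (𝓝 (g 0)) := (ContinuousMap.continuous _).tendsto 0
  have h1 := (tendsto_const_nhds (x := hh.toLp h)).compMeasurePreservingLp hg hgm (hgm 0) hp'
  have h2 := (tendsto_iff_edist_tendsto_0.1 h1)
  refine h2.congr fun t => ?_
  rw [Lp.toLp_compMeasurePreserving, Lp.toLp_compMeasurePreserving, Lp.edist_toLp_toLp]
  congr 1
  funext x
  simp [g]

/-- Jensen's inequality for the probability measure `rho k dx`. -/
theorem enorm_integral_rho_smul_rpow_le (k : ℕ) {g : EuclideanSpace ℝ (Fin n) → F}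
    (hg : AEStronglyMeasurable g) {q : ℝ} (hq : 1 ≤ q) :
    ‖∫ t, rho k t • g t‖ₑ ^ q ≤ ∫⁻ t, ENNReal.ofReal (rho k t) * ‖g t‖ₑ ^ q := by
  set ν : Measure (EuclideanSpace ℝ (Fin n)) :=
    volume.withDensity fun t => ENNReal.ofReal (rho k t) with hν
  have hm : Measurable fun t : EuclideanSpace ℝ (Fin n) => ENNReal.ofReal (rho k t) :=
    (continuous_rho k).measurable.ennreal_ofReal
  have : IsProbabilityMeasure ν := ⟨by
    rw [hν, withDensity_apply _ MeasurableSet.univ, Measure.restrict_univ,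
      ← ofReal_integral_eq_lintegral_ofReal (integrable_rho k) (ae_of_all _ (rho_nonneg k)),
      integral_rho, ENNReal.ofReal_one]⟩
  have hgν : AEStronglyMeasurable g ν := hg.mono_ac (withDensity_absolutelyContinuous _ _)
  have h1 : ‖∫ t, rho k t • g t‖ₑ ≤ ∫⁻ t, ‖g t‖ₑ ∂ν := by
    refine (enorm_integral_le_lintegral_enorm _).trans (le_of_eq ?_)
    rw [hν, lintegral_withDensity_eq_lintegral_mul₀ hm.aemeasurable hg.enorm]
    refine lintegral_congr fun t => ?_
    rw [enorm_smul, Real.enorm_eq_ofReal (rho_nonneg k t), Pi.mul_apply]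
  have h2 : ∫⁻ t, ‖g t‖ₑ ∂ν ≤ (∫⁻ t, ‖g t‖ₑ ^ q ∂ν) ^ (1 / q) := by
    have := eLpNorm_le_eLpNorm_of_exponent_le (p := 1) (q := ENNReal.ofReal q)
      (by simpa using ENNReal.ofReal_le_ofReal hq) hgν
    rw [eLpNorm_one_eq_lintegral_enorm, eLpNorm_eq_lintegral_rpow_enorm_toReal
      (by simpa using by linarith) ENNReal.ofReal_ne_top, ENNReal.toReal_ofReal (by linarith)] at this
    exact this
  calc ‖∫ t, rho k t • g t‖ₑ ^ q ≤ ((∫⁻ t, ‖g t‖ₑ ^ q ∂ν) ^ (1 / q)) ^ q :=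
        ENNReal.rpow_le_rpow (h1.trans h2) (by linarith)
    _ = ∫⁻ t, ‖g t‖ₑ ^ q ∂ν := by
        rw [← ENNReal.rpow_mul, one_div_mul_cancel (by linarith), ENNReal.rpow_one]
    _ = _ := by
        rw [hν, lintegral_withDensity_eq_lintegral_mul₀ hm.aemeasurable (hg.enorm.pow_const q)]
        rfl

/-- By Jensen and Tonelli the error is at most the `rho k`-average of the translation errors over
shifts of length below `1/(k+1)`, and these are small by continuity of translations. -/
theorem tendsto_lintegral_moll_sub_rpow {q : ℝ} (hq : 1 ≤ q)
    {h : EuclideanSpace ℝ (Fin n) → F} (hh : MemLp h (ENNReal.ofReal q)) :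
    Tendsto (fun k => ∫⁻ x, ‖moll k h x - h x‖ₑ ^ q) atTop (𝓝 0) := by
  have hq0 : 0 < q := by linarith
  have hq1 : (1 : ℝ≥0∞) ≤ ENNReal.ofReal q := by simpa using ENNReal.ofReal_le_ofReal hq
  have hloc : LocallyIntegrable h := hh.locallyIntegrable hq1
  set T : EuclideanSpace ℝ (Fin n) → ℝ≥0∞ := fun t => ∫⁻ x, ‖h (x - t) - h x‖ₑ ^ q with hT
  have hT0 : Tendsto T (𝓝 0) (𝓝 0) := by
    have h1 := (tendsto_eLpNorm_translate hq1 ENNReal.ofReal_ne_top hh).ennrpow_const q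
    rw [ENNReal.zero_rpow_of_pos hq0] at h1
    refine h1.congr fun t => ?_
    rw [eLpNorm_eq_lintegral_rpow_enorm_toReal (by simpa using by linarith)
      ENNReal.ofReal_ne_top, ENNReal.toReal_ofReal (by linarith), ← ENNReal.rpow_mul,
      one_div_mul_cancel (by linarith), ENNReal.rpow_one]
  have hmeas : AEStronglyMeasurable
      (fun p : EuclideanSpace ℝ (Fin n) × EuclideanSpace ℝ (Fin n) => h (p.1 - p.2) - h p.1)
      (volume.prod volume) :=
    (hh.1.comp_quasiMeasurePreserving
      (quasiMeasurePreserving_sub_of_right_invariant volume volume)).sub hh.1.comp_fst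
  have hbound : ∀ k, ∫⁻ x, ‖moll k h x - h x‖ₑ ^ q ≤
      ∫⁻ t, ENNReal.ofReal (rho k t) * T t := by
    intro k
    calc ∫⁻ x, ‖moll k h x - h x‖ₑ ^ q
        ≤ ∫⁻ x, ∫⁻ t, ENNReal.ofReal (rho k t) * ‖h (x - t) - h x‖ₑ ^ q := by
          refine lintegral_mono fun x => ?_
          have hx : moll k h x - h x = ∫ t, rho k t • (h (x - t) - h x) := by
            simp_rw [smul_sub]
            rw [integral_sub (integrable_rho_smul hloc x) ((integrable_rho k).smul_const _),
              integral_smul_const, integral_rho, one_smul, moll_eq]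
          rw [hx]
          refine enorm_integral_rho_smul_rpow_le k ?_ hq
          exact (hh.1.comp_quasiMeasurePreserving
            (quasiMeasurePreserving_sub_left volume x)).sub aestronglyMeasurable_const
      _ = ∫⁻ t, ∫⁻ x, ENNReal.ofReal (rho k t) * ‖h (x - t) - h x‖ₑ ^ q := by
          refine lintegral_lintegral_swap ?_
          exact ((continuous_rho k).measurable.ennreal_ofReal.comp measurable_snd).aemeasurable.mul
            (hmeas.enorm.pow_const q)
      _ = ∫⁻ t, ENNReal.ofReal (rho k t) * T t := by
          refine lintegral_congr fun t => ?_
          rw [lintegral_const_mul' _ _ ENNReal.ofReal_ne_top]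
  rw [ENNReal.tendsto_nhds_zero] at hT0 ⊢
  intro ε hε
  obtain ⟨r, hr, hsub⟩ := Metric.eventually_nhds_iff.1 (hT0 ε hε)
  filter_upwards [(tendsto_one_div_add_atTop_nhds_zero_nat (𝕜 := ℝ)).eventually_lt_const hr]
    with k hk
  refine (hbound k).trans ?_
  calc ∫⁻ t, ENNReal.ofReal (rho k t) * T t
      ≤ ∫⁻ t : EuclideanSpace ℝ (Fin n), ENNReal.ofReal (rho k t) * ε := by
        refine lintegral_mono fun t => ?_
        by_cases ht : rho k t = 0
        · simp [ht]
        · have : t ∈ Metric.ball (0 : EuclideanSpace ℝ (Fin n)) (1 / ((k : ℝ) + 1)) := by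
            rw [← support_rho]; exact ht
          exact mul_le_mul_right (hsub ((Metric.mem_ball.1 this).trans hk)) _
    _ = ε := by
        rw [lintegral_mul_const _ (continuous_rho k).measurable.ennreal_ofReal,
          ← ofReal_integral_eq_lintegral_ofReal (integrable_rho k) (ae_of_all _ (rho_nonneg k)),
          integral_rho, ENNReal.ofReal_one, one_mul]

theorem tendsto_lintegral_moll_sub {h : EuclideanSpace ℝ (Fin n) → F} (hh : Integrable h) :
    Tendsto (fun k => ∫⁻ x, ‖moll k h x - h x‖ₑ) atTop (𝓝 0) := by
  simpa using tendsto_lintegral_moll_sub_rpow le_rfl (h := h) (by simpa [memLp_one_iff_integrable])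

theorem integrable_moll (k : ℕ) {h : EuclideanSpace ℝ (Fin n) → F} (hh : Integrable h) :
    Integrable (moll k h) :=
  (integrable_rho k).integrable_convolution _ hh

theorem moll_apply (k : ℕ) {h : EuclideanSpace ℝ (Fin n) → EuclideanSpace ℝ (Fin n)}
    (hh : LocallyIntegrable h) (i : Fin n) (x : EuclideanSpace ℝ (Fin n)) :
    moll k (fun y => h y i) x = moll k h x i :=
  moll_clm k hh (EuclideanSpace.proj i : EuclideanSpace ℝ (Fin n) →L[ℝ] ℝ) x

theorem integrable_apply {μ : Measure (EuclideanSpace ℝ (Fin n))}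
    {h : EuclideanSpace ℝ (Fin n) → EuclideanSpace ℝ (Fin n)}
    (hh : Integrable h μ) (i : Fin n) : Integrable (fun x => h x i) μ :=
  (EuclideanSpace.proj i : EuclideanSpace ℝ (Fin n) →L[ℝ] ℝ).integrable_comp hh

theorem integrable_mul_of_continuous_of_hasCompactSupport {μ : Measure (EuclideanSpace ℝ (Fin n))}
    {f ψ : EuclideanSpace ℝ (Fin n) → ℝ} (hf : Integrable f μ) (hψ : Continuous ψ)
    (hψc : HasCompactSupport ψ) : Integrable (fun x => f x * ψ x) μ := by
  obtain ⟨M, hM⟩ := hψc.exists_bound_of_continuous hψ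
  exact hf.mul_bdd (c := M) hψ.aestronglyMeasurable (ae_of_all _ hM)

theorem integral_fderiv_moll {H : EuclideanSpace ℝ (Fin n) → EuclideanSpace ℝ (Fin n)}
    (hH : Integrable H) {ψ : EuclideanSpace ℝ (Fin n) → ℝ} (hψ : ContDiff ℝ 1 ψ)
    (hψc : HasCompactSupport ψ) (k : ℕ) :
    ∫ x, fderiv ℝ ψ x (moll k H x) = ∫ x, fderiv ℝ (moll k ψ) x (H x) := by
  simp_rw [fderiv_eq_sum_pd, ← moll_apply k hH.locallyIntegrable]
  have hc := fun i => (contDiff_pd (m := 0) hψ (by norm_num) i).continuous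
  have hs := fun i => hasCompactSupport_pd hψc i
  rw [integral_finsetSum, integral_finsetSum]
  · refine Finset.sum_congr rfl fun i _ => ?_
    rw [integral_moll_mul (integrable_apply hH i) (hc i) (hs i), pd_moll hψ hψc]
  · intro i _
    rw [pd_moll hψ hψc]
    exact integrable_mul_of_continuous_of_hasCompactSupport (integrable_apply hH i)
      (contDiff_moll_compact k (hc i)).continuous (hasCompactSupport_moll k (hs i))
  · intro i _
    exact integrable_mul_of_continuous_of_hasCompactSupport
      (integrable_moll k (integrable_apply hH i)) (hc i) (hs i)

end MollifierLp

/-! ### The gradient of the fundamental solution -/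

section Kernel

variable {n : ℕ}

/-- The kernel `z / ‖z‖ⁿ`. -/
def rieszK (z : EuclideanSpace ℝ (Fin n)) : EuclideanSpace ℝ (Fin n) := (‖z‖ ^ n)⁻¹ • z

theorem norm_rieszK (hn : 2 ≤ n) (z : EuclideanSpace ℝ (Fin n)) :
    ‖rieszK z‖ = (‖z‖ ^ (n - 1))⁻¹ := by
  obtain ⟨m, rfl⟩ : ∃ m, n = m + 1 := ⟨n - 1, by omega⟩
  rw [rieszK, norm_smul, norm_inv, norm_pow, norm_norm, Nat.add_sub_cancel]
  rcases eq_or_ne z 0 with rfl | hz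
  -- At the origin both sides take the default value `0⁻¹ = 0`; the exponent `n - 1` must be
  -- positive for this.
  · rw [norm_zero, zero_pow (by omega : m ≠ 0)]
    simp
  · have : ‖z‖ ≠ 0 := norm_ne_zero_iff.2 hz
    field_simp
    ring

theorem rieszK_neg (z : EuclideanSpace ℝ (Fin n)) : rieszK (-z) = -rieszK z := by
  simp [rieszK]

theorem measurable_rieszK : Measurable (rieszK : EuclideanSpace ℝ (Fin n) → _) := by
  unfold rieszK
  fun_prop

/-- In polar coordinates the Jacobian `r^(n-1)` cancels the kernel exactly. -/
theorem integral_norm_rieszK_ball (hn : 2 ≤ n) {R : ℝ} (hR : 0 < R) :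
    IntegrableOn (rieszK : EuclideanSpace ℝ (Fin n) → _) (Metric.ball 0 R) ∧
    ∫ z in Metric.ball (0 : EuclideanSpace ℝ (Fin n)) R, ‖rieszK z‖ =
      R * (n * volume.real (Metric.ball (0 : EuclideanSpace ℝ (Fin n)) 1)) := by
  have : Nonempty (Fin n) := ⟨⟨0, by omega⟩⟩
  have hcong : EqOn (fun y : ℝ => y ^ (Module.finrank ℝ (EuclideanSpace ℝ (Fin n)) - 1) •
      (fun y : ℝ => (y ^ (n - 1))⁻¹) y) (fun _ => 1) (Ioo 0 R) := by
    intro y hy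
    have : y ^ (n - 1) ≠ 0 := pow_ne_zero _ hy.1.ne'
    simp only [finrank_euclideanSpace, Fintype.card_fin, smul_eq_mul]
    exact mul_inv_cancel₀ this
  constructor
  · have h1 : IntegrableOn (fun x : EuclideanSpace ℝ (Fin n) => (‖x‖ ^ (n - 1))⁻¹)
        (Metric.ball 0 R) := by
      refine (integrableOn_fun_norm_addHaar volume (f := fun y : ℝ => (y ^ (n - 1))⁻¹)).2 ?_
      rw [integrableOn_congr_fun hcong measurableSet_Ioo]
      exact integrableOn_const (by simp)
    refine Integrable.mono' h1 measurable_rieszK.aestronglyMeasurable (ae_of_all _ fun z => ?_)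
    rw [norm_rieszK hn]
  · have h2 := integral_fun_norm_addHaar (volume : Measure (EuclideanSpace ℝ (Fin n)))
      ((Iio R).indicator fun y : ℝ => (y ^ (n - 1))⁻¹)
    have h3 : ∀ z : EuclideanSpace ℝ (Fin n), (Iio R).indicator (fun y : ℝ => (y ^ (n - 1))⁻¹) ‖z‖ =
        (Metric.ball 0 R).indicator (fun z => ‖rieszK z‖) z := by
      intro z
      simp only [indicator, mem_Iio, mem_ball_zero_iff, norm_rieszK hn]
    simp_rw [h3] at h2
    rw [integral_indicator Metric.isOpen_ball.measurableSet] at h2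
    rw [h2]
    have h4 : ∫ y in Ioi (0 : ℝ), y ^ (Module.finrank ℝ (EuclideanSpace ℝ (Fin n)) - 1) •
        (Iio R).indicator (fun y : ℝ => (y ^ (n - 1))⁻¹) y = R := by
      have h5 : ∀ y : ℝ, y ^ (Module.finrank ℝ (EuclideanSpace ℝ (Fin n)) - 1) •
        (Iio R).indicator (fun y : ℝ => (y ^ (n - 1))⁻¹) y = (Iio R).indicator
          (fun y => y ^ (Module.finrank ℝ (EuclideanSpace ℝ (Fin n)) - 1) •
            (fun y : ℝ => (y ^ (n - 1))⁻¹) y) y := by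
        intro y
        by_cases hy : y < R <;> simp [hy]
      simp_rw [h5]
      rw [setIntegral_indicator measurableSet_Iio, Ioi_inter_Iio,
        setIntegral_congr_fun measurableSet_Ioo hcong]
      simp [hR.le]
    rw [h4]
    simp only [finrank_euclideanSpace, Fintype.card_fin, nsmul_eq_mul, smul_eq_mul]
    ring

theorem locallyIntegrable_rieszK (hn : 2 ≤ n) :
    LocallyIntegrable (rieszK : EuclideanSpace ℝ (Fin n) → _) := by
  rw [locallyIntegrable_iff]
  intro k hk
  obtain ⟨R, hR, hsub⟩ := hk.isBounded.subset_ball_lt 0 0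
  exact (integral_norm_rieszK_ball hn hR).1.mono_set hsub

/-- Compare `A` with the ball of radius `R = |A|^{1/n}` about `x`: on the ball the kernel integrates
to `bR`, and off it the kernel is at most `R^{1-n}` on a set of measure at most `R^n`. The estimate,
uniform in `x`, says that the kernel is in weak `L^{n'}`. -/
theorem exists_lintegral_rieszK_le (hn : 2 ≤ n) : ∃ c : ℝ≥0∞, c ≠ ⊤ ∧
    ∀ (x : EuclideanSpace ℝ (Fin n)) (A : Set (EuclideanSpace ℝ (Fin n))), MeasurableSet A →
      ∫⁻ y in A, ‖rieszK (x - y)‖ₑ ≤ c * volume A ^ (1 / (n : ℝ)) := by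
  have : Nonempty (Fin n) := ⟨⟨0, by omega⟩⟩
  have hnpos : (0 : ℝ) < n := by positivity
  set b : ℝ := n * volume.real (Metric.ball (0 : EuclideanSpace ℝ (Fin n)) 1) with hb
  have hb0 : 0 ≤ b := by positivity
  refine ⟨ENNReal.ofReal b + 1, by finiteness, fun x A hA => ?_⟩
  rcases eq_or_ne (volume A) 0 with h0 | h0
  · rw [setLIntegral_measure_zero _ _ h0]
    exact zero_le
  rcases eq_or_ne (volume A) ⊤ with ht | ht
  · rw [ht, ENNReal.top_rpow_of_pos (by positivity), ENNReal.mul_top (by simp)]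
    exact le_top
  set a : ℝ := (volume A).toReal with ha
  have ha0 : 0 < a := ENNReal.toReal_pos h0 ht
  have hAa : volume A = ENNReal.ofReal a := (ENNReal.ofReal_toReal ht).symm
  set R : ℝ := a ^ (1 / (n : ℝ)) with hR
  have hR0 : 0 < R := Real.rpow_pos_of_pos ha0 _
  have hRn : R ^ n = a := by
    rw [hR, ← Real.rpow_natCast, ← Real.rpow_mul ha0.le, one_div_mul_cancel hnpos.ne', Real.rpow_one]
  have h1 : ∫⁻ y in Metric.ball x R, ‖rieszK (x - y)‖ₑ = ENNReal.ofReal (R * b) := by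
    have hpre : (fun y => x - y) ⁻¹' Metric.ball 0 R = Metric.ball x R := by
      ext y
      simp [dist_eq_norm, norm_sub_rev]
    rw [← hpre, (volume.measurePreserving_sub_left x).setLIntegral_comp_preimage
      Metric.isOpen_ball.measurableSet measurable_rieszK.enorm,
      ← ofReal_integral_norm_eq_lintegral_enorm (integral_norm_rieszK_ball hn hR0).1,
      (integral_norm_rieszK_ball hn hR0).2]
  have h2 : ∫⁻ y in A \ Metric.ball x R, ‖rieszK (x - y)‖ₑ ≤ ENNReal.ofReal R := by
    calc ∫⁻ y in A \ Metric.ball x R, ‖rieszK (x - y)‖ₑ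
        ≤ ∫⁻ y in A \ Metric.ball x R, ENNReal.ofReal ((R ^ (n - 1))⁻¹) := by
          refine setLIntegral_mono' (hA.diff Metric.isOpen_ball.measurableSet) fun y hy => ?_
          rw [← ofReal_norm, norm_rieszK hn]
          apply ENNReal.ofReal_le_ofReal
          have : R ≤ ‖x - y‖ := by
            have := hy.2
            rw [Metric.mem_ball, not_lt, dist_comm, dist_eq_norm] at this
            exact this
          gcongr
      _ = ENNReal.ofReal ((R ^ (n - 1))⁻¹) * volume (A \ Metric.ball x R) := by
          rw [setLIntegral_const]
      _ ≤ ENNReal.ofReal ((R ^ (n - 1))⁻¹) * ENNReal.ofReal a := by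
          rw [← hAa]
          gcongr
          exact sdiff_subset
      _ = ENNReal.ofReal R := by
          rw [← ENNReal.ofReal_mul (by positivity)]
          congr 1
          rw [← hRn]
          obtain ⟨m, rfl⟩ : ∃ m, n = m + 1 := ⟨n - 1, by omega⟩
          rw [Nat.add_sub_cancel]
          field_simp
          ring
  calc ∫⁻ y in A, ‖rieszK (x - y)‖ₑ
      ≤ ∫⁻ y in Metric.ball x R ∪ (A \ Metric.ball x R), ‖rieszK (x - y)‖ₑ :=
        lintegral_mono_set (by rw [union_sdiff_self]; exact subset_union_right)
    _ ≤ ENNReal.ofReal (R * b) + ENNReal.ofReal R := by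
        refine (lintegral_union_le _ _ _).trans ?_
        rw [h1]
        gcongr
    _ = (ENNReal.ofReal b + 1) * volume A ^ (1 / (n : ℝ)) := by
        rw [hAa, ENNReal.ofReal_rpow_of_pos ha0, ← hR, mul_comm, add_mul, one_mul,
          ← ENNReal.ofReal_mul hb0, mul_comm]

/-- The smooth kernel `z / (‖z‖² + ε)^{n/2}`. -/
def regK (ε : ℝ) (i : Fin n) (z : EuclideanSpace ℝ (Fin n)) : ℝ :=
  z i * (‖z‖ ^ 2 + ε) ^ (-((n : ℝ) / 2))

theorem contDiff_regK {ε : ℝ} (hε : 0 < ε) (i : Fin n) : ContDiff ℝ 1 (regK ε i) := by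
  unfold regK
  have h1 : ContDiff ℝ 1 fun z : EuclideanSpace ℝ (Fin n) => ‖z‖ ^ 2 + ε :=
    (contDiff_norm_sq ℝ).add contDiff_const
  have h2 : ContDiff ℝ 1 fun z : EuclideanSpace ℝ (Fin n) => z i :=
    (EuclideanSpace.proj i : EuclideanSpace ℝ (Fin n) →L[ℝ] ℝ).contDiff
  exact h2.mul (h1.rpow_const_of_ne fun z => by positivity)

theorem pd_regK {ε : ℝ} (hε : 0 < ε) (i j : Fin n) (z : EuclideanSpace ℝ (Fin n)) :
    pd j (regK ε i) z = (if i = j then 1 else 0) * (‖z‖ ^ 2 + ε) ^ (-((n : ℝ) / 2)) -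
      n * (z i * z j) * (‖z‖ ^ 2 + ε) ^ (-((n : ℝ) / 2) - 1) := by
  have h1 : HasFDerivAt (fun z : EuclideanSpace ℝ (Fin n) => ‖z‖ ^ 2 + ε)
      (2 • innerSL ℝ z) z := (hasStrictFDerivAt_norm_sq z).hasFDerivAt.add_const ε
  have h2 : HasFDerivAt (fun z : EuclideanSpace ℝ (Fin n) => z i)
      (EuclideanSpace.proj i : EuclideanSpace ℝ (Fin n) →L[ℝ] ℝ) z :=
    (EuclideanSpace.proj i : EuclideanSpace ℝ (Fin n) →L[ℝ] ℝ).hasFDerivAt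
  have h3 := h1.rpow_const (p := -((n : ℝ) / 2)) (Or.inl (by positivity))
  have h4 := h2.mul h3
  have h5 : pd j (regK ε i) z = _ := congrArg (fun T => T (EuclideanSpace.single j 1)) h4.fderiv
  rw [h5]
  simp only [add_apply, smul_apply, smul_eq_mul,
    innerSL_apply_apply, EuclideanSpace.inner_single_right, PiLp.proj_apply,
    PiLp.single_apply, conj_trivial, nsmul_eq_mul]
  by_cases h : i = j <;> simp [h] <;> ring

/-- The divergence of the regularised kernel is an approximate identity, up to a constant: rescaling
by `√ε` turns it into a fixed integrable density. -/
theorem sum_pd_regK {ε : ℝ} (hε : 0 < ε) (z : EuclideanSpace ℝ (Fin n)) :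
    ∑ i, pd i (regK ε i) z = n * ε * (‖z‖ ^ 2 + ε) ^ (-((n : ℝ) / 2) - 1) := by
  have hpos : 0 < ‖z‖ ^ 2 + ε := by positivity
  simp_rw [pd_regK hε]
  rw [Finset.sum_sub_distrib]
  simp only [if_true, one_mul, Finset.sum_const, Finset.card_univ, Fintype.card_fin, nsmul_eq_mul]
  rw [← Finset.sum_mul, ← Finset.mul_sum]
  have h1 : ∑ i, z i * z i = ‖z‖ ^ 2 := by
    rw [EuclideanSpace.norm_sq_eq]
    exact Finset.sum_congr rfl fun i _ => by rw [Real.norm_eq_abs, sq_abs, sq]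
  rw [h1]
  have h2 : (‖z‖ ^ 2 + ε) ^ (-((n : ℝ) / 2)) =
      (‖z‖ ^ 2 + ε) ^ (-((n : ℝ) / 2) - 1) * (‖z‖ ^ 2 + ε) := by
    rw [← Real.rpow_add_one hpos.ne']
    ring_nf
  rw [h2]
  ring

theorem norm_regK_le {ε : ℝ} (hε : 0 < ε) (i : Fin n) (z : EuclideanSpace ℝ (Fin n)) :
    ‖regK ε i z‖ ≤ ‖rieszK z‖ := by
  rcases eq_or_ne z 0 with rfl | hz
  · simp [regK]
  have hz' : 0 < ‖z‖ := norm_pos_iff.2 hz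
  rw [regK, rieszK, norm_mul, norm_smul, mul_comm]
  refine mul_le_mul ?_ (PiLp.norm_apply_le z i) (norm_nonneg _) (norm_nonneg _)
  rw [Real.norm_of_nonneg (by positivity), Real.norm_of_nonneg (by positivity),
    Real.rpow_neg (by positivity)]
  have : ‖z‖ ^ n = (‖z‖ ^ 2) ^ ((n : ℝ) / 2) := by
    rw [← Real.rpow_natCast, ← Real.rpow_natCast, ← Real.rpow_mul hz'.le]
    congr 1
    push_cast
    ring
  rw [this]
  gcongr
  linarith

theorem tendsto_regK (i : Fin n) {z : EuclideanSpace ℝ (Fin n)} (hz : z ≠ 0) :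
    Tendsto (fun ε => regK ε i z) (𝓝 0) (𝓝 (rieszK z i)) := by
  have hz' : 0 < ‖z‖ := norm_pos_iff.2 hz
  have h : ContinuousAt (fun ε : ℝ => regK ε i z) 0 := by
    unfold regK
    refine continuousAt_const.mul (ContinuousAt.rpow_const (by fun_prop) (Or.inl ?_))
    positivity
  have h0 : regK 0 i z = rieszK z i := by
    have : ‖z‖ ^ n = (‖z‖ ^ 2) ^ ((n : ℝ) / 2) := by
      rw [← Real.rpow_natCast, ← Real.rpow_natCast, ← Real.rpow_mul hz'.le]
      congr 1
      push_cast
      ring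
    simp only [regK, rieszK, add_zero, PiLp.smul_apply, smul_eq_mul]
    rw [this, Real.rpow_neg (by positivity), mul_comm]
  rw [← h0]
  exact h

end Kernel

/-! ### Symmetry and distributional divergence of the kernel -/

section Kernel

variable {n : ℕ}

theorem integrable_rieszK_apply_mul (hn : 2 ≤ n) (i : Fin n) {g : EuclideanSpace ℝ (Fin n) → ℝ}
    (hg : Continuous g) (hgc : HasCompactSupport g) : Integrable fun z => rieszK z i * g z := by
  have hK : IntegrableOn (fun z : EuclideanSpace ℝ (Fin n) => rieszK z i) (tsupport g) :=
    integrable_apply ((locallyIntegrable_rieszK hn).integrableOn_isCompact hgc.isCompact) i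
  have h1 := integrable_mul_of_continuous_of_hasCompactSupport hK hg hgc
  rw [← IntegrableOn, integrableOn_iff_integrable_of_support_subset] at h1
  · exact h1
  · exact (Function.support_mul_subset_right _ _).trans (subset_tsupport g)

theorem integrable_norm_rieszK_mul (hn : 2 ≤ n) {g : EuclideanSpace ℝ (Fin n) → ℝ}
    (hg : Continuous g) (hgc : HasCompactSupport g) : Integrable fun z => ‖rieszK z‖ * g z := by
  have hK : IntegrableOn (fun z : EuclideanSpace ℝ (Fin n) => ‖rieszK z‖) (tsupport g) :=
    ((locallyIntegrable_rieszK hn).integrableOn_isCompact hgc.isCompact).norm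
  have h1 := integrable_mul_of_continuous_of_hasCompactSupport hK hg hgc
  rw [← IntegrableOn, integrableOn_iff_integrable_of_support_subset] at h1
  · exact h1
  · exact (Function.support_mul_subset_right _ _).trans (subset_tsupport g)

/-- A sequence of positive regularisation parameters tending to zero. -/
def epsK (k : ℕ) : ℝ := (1 / ((k : ℝ) + 1)) ^ 2

theorem epsK_pos (k : ℕ) : 0 < epsK k := by
  unfold epsK
  positivity

theorem tendsto_epsK : Tendsto epsK atTop (𝓝 0) := by
  have := (tendsto_one_div_add_atTop_nhds_zero_nat (𝕜 := ℝ)).pow 2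
  rwa [zero_pow two_ne_zero] at this

theorem tendsto_integral_regK_mul (hn : 2 ≤ n) (i : Fin n) {g : EuclideanSpace ℝ (Fin n) → ℝ}
    (hg : Continuous g) (hgc : HasCompactSupport g) :
    Tendsto (fun k => ∫ z, regK (epsK k) i z * g z) atTop (𝓝 (∫ z, rieszK z i * g z)) := by
  have : Nonempty (Fin n) := ⟨i⟩
  refine tendsto_integral_of_dominated_convergence (fun z => ‖rieszK z‖ * ‖g z‖) ?_ ?_ ?_ ?_
  · exact fun k => ((contDiff_regK (epsK_pos k) i).continuous.mul hg).aestronglyMeasurable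
  · exact integrable_norm_rieszK_mul hn hg.norm hgc.norm
  · refine fun k => ae_of_all _ fun z => ?_
    rw [norm_mul]
    gcongr
    exact norm_regK_le (epsK_pos k) i z
  · have h0 : ∀ᵐ z : EuclideanSpace ℝ (Fin n), z ≠ 0 := by
      simp [ae_iff]
    filter_upwards [h0] with z hz
    exact ((tendsto_regK i hz).comp tendsto_epsK).mul_const _

/-- The kernel is curl-free in the sense of distributions: `∂ⱼ` of the `i`-th component of the
regularised kernel is visibly symmetric in `i, j`, and the symmetry survives `ε → 0`. -/
theorem integral_rieszK_mul_pd_comm (hn : 2 ≤ n) {g : EuclideanSpace ℝ (Fin n) → ℝ}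
    (hg : ContDiff ℝ 1 g) (hgc : HasCompactSupport g) (i j : Fin n) :
    ∫ z, rieszK z i * pd j g z = ∫ z, rieszK z j * pd i g z := by
  have hc := fun i => (contDiff_pd (m := 0) hg (by norm_num) i).continuous
  refine tendsto_nhds_unique
    (tendsto_integral_regK_mul hn i (hc j) (hasCompactSupport_pd hgc j)) ?_
  refine (tendsto_integral_regK_mul hn j (hc i) (hasCompactSupport_pd hgc i)).congr fun k => ?_
  have he := epsK_pos k
  rw [integral_mul_pd (contDiff_regK he j) hg hgc, integral_mul_pd (contDiff_regK he i) hg hgc]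
  congr 1
  refine integral_congr_ae (ae_of_all _ fun z => ?_)
  simp only [pd_regK he, mul_comm (z i), eq_comm (a := i)]

/-- The normalising constant of `rieszK`. -/
def cK (n : ℕ) : ℝ :=
  ∫ y : EuclideanSpace ℝ (Fin n), (n : ℝ) * (1 + ‖y‖ ^ 2) ^ (-((n : ℝ) / 2) - 1)

theorem integrable_japanese :
    Integrable fun y : EuclideanSpace ℝ (Fin n) => (n : ℝ) * (1 + ‖y‖ ^ 2) ^ (-((n : ℝ) / 2) - 1) := by
  have := integrable_rpow_neg_one_add_norm_sq (E := EuclideanSpace ℝ (Fin n)) (μ := volume)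
    (r := (n : ℝ) + 2) (by simp)
  refine (this.const_mul (n : ℝ)).congr (ae_of_all _ fun y => ?_)
  simp only
  congr 2
  ring

theorem cK_pos (hn : 2 ≤ n) : 0 < cK n := by
  have hnpos : (0 : ℝ) < n := by positivity
  have hpos : ∀ y : EuclideanSpace ℝ (Fin n),
      0 < (n : ℝ) * (1 + ‖y‖ ^ 2) ^ (-((n : ℝ) / 2) - 1) := fun y => by positivity
  rw [cK, integral_pos_iff_support_of_nonneg (fun y => (hpos y).le) integrable_japanese]
  have : Function.support (fun y : EuclideanSpace ℝ (Fin n) =>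
      (n : ℝ) * (1 + ‖y‖ ^ 2) ^ (-((n : ℝ) / 2) - 1)) = univ := by
    ext y
    simpa using (hpos y).ne'
  rw [this]
  exact isOpen_univ.measure_pos volume univ_nonempty

/-- This is `div (z/|z|ⁿ) = c δ₀`. Integrate by parts for the regularised kernel, rescale so that
the divergence becomes a fixed density, and let the scale tend to zero in `g`. -/
theorem integral_fderiv_rieszK (hn : 2 ≤ n) {g : EuclideanSpace ℝ (Fin n) → ℝ}
    (hg : ContDiff ℝ 1 g) (hgc : HasCompactSupport g) :
    ∫ z, fderiv ℝ g z (rieszK z) = - (cK n * g 0) := by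
  have hc := fun i => (contDiff_pd (m := 0) hg (by norm_num) i).continuous
  have h1 : Tendsto (fun k => ∑ i, ∫ z, regK (epsK k) i z * pd i g z) atTop
      (𝓝 (∫ z, fderiv ℝ g z (rieszK z))) := by
    simp_rw [fderiv_eq_sum_pd]
    rw [integral_finsetSum _ fun i _ =>
      integrable_rieszK_apply_mul hn i (hc i) (hasCompactSupport_pd hgc i)]
    exact tendsto_finsetSum _ fun i _ =>
      tendsto_integral_regK_mul hn i (hc i) (hasCompactSupport_pd hgc i)
  refine tendsto_nhds_unique h1 ?_
  have h2 : ∀ k : ℕ, ∑ i, ∫ z, regK (epsK k) i z * pd i g z =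
      - ∫ y : EuclideanSpace ℝ (Fin n), ((n : ℝ) * (1 + ‖y‖ ^ 2) ^ (-((n : ℝ) / 2) - 1)) *
        g ((1 / ((k : ℝ) + 1)) • y) := by
    intro k
    have he := epsK_pos k
    set s : ℝ := 1 / ((k : ℝ) + 1) with hs
    have hs0 : 0 < s := by positivity
    have hes : epsK k = s ^ 2 := rfl
    have h3 : ∑ i, ∫ z, regK (epsK k) i z * pd i g z =
        - ∫ z, (n * epsK k * (‖z‖ ^ 2 + epsK k) ^ (-((n : ℝ) / 2) - 1)) * g z := by
      simp_rw [fun i => integral_mul_pd (contDiff_regK he i) hg hgc i, Finset.sum_neg_distrib,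
        ← sum_pd_regK he, Finset.sum_mul]
      rw [integral_finsetSum]
      intro i _
      exact ((contDiff_pd (m := 0) (contDiff_regK he i) (by norm_num) i).continuous.mul
        hg.continuous).integrable_of_hasCompactSupport hgc.mul_left
    rw [h3]
    congr 1
    -- Substitution `z = s y`. As `epsK` is the square of `s`, `|z|² + ε = s²(1 + |y|²)`, and the
    -- powers `sⁿ · s² · s^{-n-2}` cancel.
    have h4 := Measure.integral_comp_smul (volume : Measure (EuclideanSpace ℝ (Fin n)))
      (fun z => (n * epsK k * (‖z‖ ^ 2 + epsK k) ^ (-((n : ℝ) / 2) - 1)) * g z) s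
    rw [finrank_euclideanSpace, Fintype.card_fin, abs_of_pos (by positivity), smul_eq_mul] at h4
    have h5 : ∫ z, (n * epsK k * (‖z‖ ^ 2 + epsK k) ^ (-((n : ℝ) / 2) - 1)) * g z = s ^ n *
        ∫ x : EuclideanSpace ℝ (Fin n),
          (n * epsK k * (‖s • x‖ ^ 2 + epsK k) ^ (-((n : ℝ) / 2) - 1)) * g (s • x) := by
      rw [h4]
      field_simp
    rw [h5, ← integral_const_mul]
    refine integral_congr_ae (ae_of_all _ fun y => ?_)
    simp only
    rw [hes, norm_smul, Real.norm_of_nonneg hs0.le]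
    have h6 : (s * ‖y‖) ^ 2 + s ^ 2 = s ^ 2 * (1 + ‖y‖ ^ 2) := by ring
    rw [h6, Real.mul_rpow (by positivity) (by positivity), ← Real.rpow_natCast s 2,
      ← Real.rpow_mul hs0.le, ← Real.rpow_natCast s n]
    have h7 : s ^ (n : ℝ) * s ^ ((2 : ℕ) : ℝ) * s ^ (((2 : ℕ) : ℝ) * (-((n : ℝ) / 2) - 1)) = 1 := by
      rw [← Real.rpow_add hs0, ← Real.rpow_add hs0]
      have : (n : ℝ) + ((2 : ℕ) : ℝ) + ((2 : ℕ) : ℝ) * (-((n : ℝ) / 2) - 1) = 0 := by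
        push_cast
        ring
      rw [this, Real.rpow_zero]
    linear_combination ((n : ℝ) * (1 + ‖y‖ ^ 2) ^ (-((n : ℝ) / 2) - 1) * g (s • y)) * h7
  simp_rw [h2]
  refine Tendsto.neg ?_
  obtain ⟨M, hM⟩ := hgc.exists_bound_of_continuous hg.continuous
  rw [cK, ← integral_mul_const]
  refine tendsto_integral_of_dominated_convergence
    (fun y => (n : ℝ) * (1 + ‖y‖ ^ 2) ^ (-((n : ℝ) / 2) - 1) * M) ?_ ?_ ?_ ?_
  · intro k
    exact integrable_japanese.aestronglyMeasurable.mul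
      (hg.continuous.comp (continuous_const_smul _)).aestronglyMeasurable
  · exact integrable_japanese.mul_const M
  · refine fun k => ae_of_all _ fun y => ?_
    rw [norm_mul, Real.norm_of_nonneg (by positivity)]
    exact mul_le_mul_of_nonneg_left (hM _) (by positivity)
  · refine ae_of_all _ fun y => ?_
    refine Tendsto.const_mul _ ?_
    have h8 : Tendsto (fun k : ℕ => (1 / ((k : ℝ) + 1)) • y) atTop (𝓝 ((0 : ℝ) • y)) :=
      (tendsto_one_div_add_atTop_nhds_zero_nat (𝕜 := ℝ)).smul_const y
    rw [zero_smul] at h8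
    exact (hg.continuous.tendsto 0).comp h8

/-- `∫ Kᵢ Δψ = -c ∂ᵢψ(0)`. -/
theorem integral_rieszK_mul_laplacian (hn : 2 ≤ n) {ψ : EuclideanSpace ℝ (Fin n) → ℝ}
    (hψ : ContDiff ℝ 2 ψ) (hψc : HasCompactSupport ψ) (i : Fin n) :
    ∫ z, rieszK z i * Laplacian.laplacian ψ z = - (cK n * pd i ψ 0) := by
  have h1 := fun i => contDiff_pd (m := 1) hψ (by norm_num) i
  have h2 := fun i j => (contDiff_pd (m := 0) (h1 i) (by norm_num) j).continuous
  have h3 := fun i => hasCompactSupport_pd hψc i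
  rw [← integral_fderiv_rieszK hn (h1 i) (h3 i)]
  simp_rw [fderiv_eq_sum_pd, fun x => laplacian_eq_sum_pd (hψ.contDiffAt (x := x)), Finset.mul_sum]
  rw [integral_finsetSum _ fun j _ =>
      integrable_rieszK_apply_mul hn i (h2 j j) (hasCompactSupport_pd (h3 j) j),
    integral_finsetSum _ fun j _ =>
      integrable_rieszK_apply_mul hn j (h2 i j) (hasCompactSupport_pd (h3 i) j)]
  -- Exchanging the index of the kernel with one derivative turns the Laplacian into the divergence
  -- pairing for `∂ᵢψ`.
  refine Finset.sum_congr rfl fun j _ => ?_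
  rw [integral_rieszK_mul_pd_comm hn (h1 j) (h3 j) i j, pd_comm hψ i j]

end Kernel

/-! ### The potential of a vector field -/

section Potential

variable {n : ℕ}

/-- The inverse of the gradient, `h ↦ -N * div h` with `N` the fundamental solution of `-Δ`. -/
def pot (h : EuclideanSpace ℝ (Fin n) → EuclideanSpace ℝ (Fin n)) (x : EuclideanSpace ℝ (Fin n)) :
    ℝ :=
  (cK n)⁻¹ * ∫ y, inner ℝ (rieszK (x - y)) (h y)

/-- The Riesz potential of order one of `‖h‖`. -/
def rieszPot {F : Type*} [NormedAddCommGroup F] (h : EuclideanSpace ℝ (Fin n) → F)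
    (x : EuclideanSpace ℝ (Fin n)) : ℝ≥0∞ :=
  ∫⁻ y, ‖rieszK (x - y)‖ₑ * ‖h y‖ₑ

theorem aestronglyMeasurable_inner_rieszK
    {h : EuclideanSpace ℝ (Fin n) → EuclideanSpace ℝ (Fin n)}
    (hh : AEStronglyMeasurable h) (x : EuclideanSpace ℝ (Fin n)) :
    AEStronglyMeasurable fun y => inner ℝ (rieszK (x - y)) (h y) :=
  (measurable_rieszK.comp (measurable_const_sub x)).aestronglyMeasurable.inner hh

theorem aestronglyMeasurable_inner_rieszK_prod
    {h : EuclideanSpace ℝ (Fin n) → EuclideanSpace ℝ (Fin n)} (hh : AEStronglyMeasurable h) :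
    AEStronglyMeasurable (fun p : EuclideanSpace ℝ (Fin n) × EuclideanSpace ℝ (Fin n) =>
      inner ℝ (rieszK (p.1 - p.2)) (h p.2)) (volume.prod volume) :=
  (measurable_rieszK.comp measurable_sub).aestronglyMeasurable.inner hh.comp_snd

theorem aestronglyMeasurable_pot
    {h : EuclideanSpace ℝ (Fin n) → EuclideanSpace ℝ (Fin n)} (hh : AEStronglyMeasurable h) :
    AEStronglyMeasurable (pot h) :=
  (aestronglyMeasurable_inner_rieszK_prod hh).integral_prod_right'.const_mul _

theorem enorm_inner_rieszK_le (h : EuclideanSpace ℝ (Fin n) → EuclideanSpace ℝ (Fin n))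
    (x y : EuclideanSpace ℝ (Fin n)) :
    ‖inner ℝ (rieszK (x - y)) (h y)‖ₑ ≤ ‖rieszK (x - y)‖ₑ * ‖h y‖ₑ := by
  rw [← ofReal_norm, ← ofReal_norm, ← ofReal_norm, ← ENNReal.ofReal_mul (norm_nonneg _)]
  exact ENNReal.ofReal_le_ofReal (norm_inner_le_norm _ _)

theorem enorm_pot_le (h : EuclideanSpace ℝ (Fin n) → EuclideanSpace ℝ (Fin n))
    (x : EuclideanSpace ℝ (Fin n)) : ‖pot h x‖ₑ ≤ ‖(cK n)⁻¹‖ₑ * rieszPot h x := by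
  rw [pot, enorm_mul]
  gcongr
  exact (enorm_integral_le_lintegral_enorm _).trans
    (lintegral_mono fun y => enorm_inner_rieszK_le h x y)

theorem integrable_inner_rieszK {h : EuclideanSpace ℝ (Fin n) → EuclideanSpace ℝ (Fin n)}
    (hh : AEStronglyMeasurable h) {x : EuclideanSpace ℝ (Fin n)} (hx : rieszPot h x ≠ ⊤) :
    Integrable fun y => inner ℝ (rieszK (x - y)) (h y) :=
  ⟨aestronglyMeasurable_inner_rieszK hh x,
    lt_of_le_of_lt (lintegral_mono fun y => enorm_inner_rieszK_le h x y) hx.lt_top⟩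

theorem enorm_rieszK_sub_comm (x y : EuclideanSpace ℝ (Fin n)) :
    ‖rieszK (x - y)‖ₑ = ‖rieszK (y - x)‖ₑ := by
  rw [← neg_sub, rieszK_neg, enorm_neg]

/-- Duality: by Tonelli and the symmetry of `|K|`, the potential moves from `h` to the weight, so a
sup bound on the potential of `w` becomes an `L¹ → L¹(w dx)` bound. -/
theorem lintegral_mul_rieszPot_le {h : EuclideanSpace ℝ (Fin n) → EuclideanSpace ℝ (Fin n)}
    (hh : AEStronglyMeasurable h) {w : EuclideanSpace ℝ (Fin n) → ℝ≥0∞} (hw : AEMeasurable w)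
    {θ : ℝ≥0∞} (hθ : ∀ y, ∫⁻ x, ‖rieszK (y - x)‖ₑ * w x ≤ θ) :
    ∫⁻ x, w x * rieszPot h x ≤ θ * ∫⁻ y, ‖h y‖ₑ := by
  have hK : Measurable fun p : EuclideanSpace ℝ (Fin n) × EuclideanSpace ℝ (Fin n) =>
      ‖rieszK (p.1 - p.2)‖ₑ := (measurable_rieszK.comp measurable_sub).enorm
  calc ∫⁻ x, w x * rieszPot h x
      = ∫⁻ x, ∫⁻ y, w x * (‖rieszK (x - y)‖ₑ * ‖h y‖ₑ) := by
        refine lintegral_congr fun x => ?_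
        rw [rieszPot, lintegral_const_mul'']
        exact (measurable_rieszK.comp (measurable_const_sub x)).enorm.aemeasurable.mul hh.enorm
    _ = ∫⁻ y, ∫⁻ x, w x * (‖rieszK (x - y)‖ₑ * ‖h y‖ₑ) := by
        refine lintegral_lintegral_swap ?_
        exact hw.comp_fst.mul (hK.aemeasurable.mul hh.enorm.comp_snd)
    _ ≤ ∫⁻ y, θ * ‖h y‖ₑ := by
        refine lintegral_mono fun y => ?_
        calc ∫⁻ x, w x * (‖rieszK (x - y)‖ₑ * ‖h y‖ₑ)
            = ∫⁻ x, (‖rieszK (y - x)‖ₑ * w x) * ‖h y‖ₑ := by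
              refine lintegral_congr fun x => ?_
              rw [enorm_rieszK_sub_comm]
              ring
          _ = (∫⁻ x, ‖rieszK (y - x)‖ₑ * w x) * ‖h y‖ₑ :=
              lintegral_mul_const' _ _ enorm_ne_top
          _ ≤ θ * ‖h y‖ₑ := by gcongr; exact hθ y
    _ = θ * ∫⁻ y, ‖h y‖ₑ := lintegral_const_mul'' _ hh.enorm

theorem exists_setLIntegral_rieszPot_le (hn : 2 ≤ n) {A : Set (EuclideanSpace ℝ (Fin n))}
    (hA : MeasurableSet A) (hAfin : volume A ≠ ⊤) : ∃ c : ℝ≥0∞, c ≠ ⊤ ∧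
    ∀ h : EuclideanSpace ℝ (Fin n) → EuclideanSpace ℝ (Fin n), AEStronglyMeasurable h →
      ∫⁻ x in A, rieszPot h x ≤ c * ∫⁻ y, ‖h y‖ₑ := by
  obtain ⟨c, hc, hcA⟩ := exists_lintegral_rieszK_le hn
  refine ⟨c * volume A ^ (1 / (n : ℝ)), ENNReal.mul_ne_top hc
    (ENNReal.rpow_ne_top_of_nonneg (by positivity) hAfin), fun h hh => ?_⟩
  have h1 := lintegral_mul_rieszPot_le hh (w := A.indicator 1)
    ((aemeasurable_indicator_iff hA).2 aemeasurable_const)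
    (θ := c * volume A ^ (1 / (n : ℝ))) (fun y => by
      refine le_trans (le_of_eq ?_) (hcA y A hA)
      rw [← lintegral_indicator hA]
      refine lintegral_congr fun x => ?_
      by_cases hx : x ∈ A <;> simp [hx])
  refine le_trans (le_of_eq ?_) h1
  rw [← lintegral_indicator hA]
  refine lintegral_congr fun x => ?_
  by_cases hx : x ∈ A <;> simp [hx]

theorem ae_rieszPot_ne_top (hn : 2 ≤ n)
    {h : EuclideanSpace ℝ (Fin n) → EuclideanSpace ℝ (Fin n)} (hh : Integrable h) :
    ∀ᵐ x, rieszPot h x ≠ ⊤ := by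
  have hmeas : AEMeasurable (rieszPot h) :=
    ((measurable_rieszK.comp measurable_sub).enorm.aemeasurable.mul
      hh.1.enorm.comp_snd).lintegral_prod_right' (μ := volume) (ν := volume)
  have h1 : ∀ N : ℕ, ∀ᵐ x, x ∈ Metric.ball (0 : EuclideanSpace ℝ (Fin n)) N →
      rieszPot h x ≠ ⊤ := by
    intro N
    obtain ⟨c, hc, hcA⟩ := exists_setLIntegral_rieszPot_le hn
      (A := Metric.ball (0 : EuclideanSpace ℝ (Fin n)) N) Metric.isOpen_ball.measurableSet
      Metric.isBounded_ball.measure_lt_top.ne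
    have h2 : ∫⁻ x in Metric.ball (0 : EuclideanSpace ℝ (Fin n)) N, rieszPot h x ≠ ⊤ :=
      ne_top_of_le_ne_top (ENNReal.mul_ne_top hc hh.2.ne) (hcA h hh.1)
    have h3 := ae_lt_top' hmeas.restrict h2
    rw [ae_restrict_iff' Metric.isOpen_ball.measurableSet] at h3
    filter_upwards [h3] with x hx hxN
    exact (hx hxN).ne
  filter_upwards [ae_all_iff.2 h1] with x hx
  obtain ⟨N, hN⟩ := exists_nat_gt ‖x‖
  exact hx N (mem_ball_zero_iff.2 hN)

theorem pot_sub {h₁ h₂ : EuclideanSpace ℝ (Fin n) → EuclideanSpace ℝ (Fin n)}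
    (hh₁ : AEStronglyMeasurable h₁) (hh₂ : AEStronglyMeasurable h₂)
    {x : EuclideanSpace ℝ (Fin n)} (hx₁ : rieszPot h₁ x ≠ ⊤) (hx₂ : rieszPot h₂ x ≠ ⊤) :
    pot (fun y => h₁ y - h₂ y) x = pot h₁ x - pot h₂ x := by
  simp only [pot, inner_sub_right]
  rw [integral_sub (integrable_inner_rieszK hh₁ hx₁) (integrable_inner_rieszK hh₂ hx₂), mul_sub]

/-- Translate `integral_fderiv_rieszK` to the point `x`; the kernel is odd, which fixes the sign. -/
theorem pot_gradient (hn : 2 ≤ n) {ψ : EuclideanSpace ℝ (Fin n) → ℝ} (hψ : ContDiff ℝ 1 ψ)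
    (hψc : HasCompactSupport ψ) (x : EuclideanSpace ℝ (Fin n)) : pot (gradient ψ) x = ψ x := by
  have hg : ContDiff ℝ 1 fun z => ψ (x + z) := hψ.comp (contDiff_const.add contDiff_id)
  have hgc : HasCompactSupport fun z => ψ (x + z) :=
    hψc.comp_homeomorph (Homeomorph.addLeft x)
  have h1 := integral_fderiv_rieszK hn hg hgc
  have h2 : ∀ z, fderiv ℝ (fun z => ψ (x + z)) z (rieszK z) =
      - inner ℝ (rieszK (x - (x + z))) (gradient ψ (x + z)) := by
    intro z
    rw [real_inner_comm, inner_gradient, fderiv_comp_add_left, sub_add_cancel_left, rieszK_neg,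
      map_neg, neg_neg]
  simp_rw [h2] at h1
  rw [integral_neg, integral_add_left_eq_self
    (fun y => inner ℝ (rieszK (x - y)) (gradient ψ y)) x, neg_inj] at h1
  rw [pot, h1, add_zero, inv_mul_cancel_left₀ (cK_pos hn).ne']

/-- The weak form of `Δ (pot h) = div h`. Fubini moves the kernel onto `Δψ`, where
`integral_rieszK_mul_laplacian` evaluates it; absolute integrability comes from the `L¹` bound of
the Riesz potential on the support of `Δψ`. -/
theorem integral_pot_mul_laplacian (hn : 2 ≤ n)
    {h : EuclideanSpace ℝ (Fin n) → EuclideanSpace ℝ (Fin n)} (hh : Integrable h)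
    {ψ : EuclideanSpace ℝ (Fin n) → ℝ} (hψ : ContDiff ℝ 2 ψ) (hψc : HasCompactSupport ψ) :
    ∫ x, pot h x * Laplacian.laplacian ψ x = - ∫ x, fderiv ℝ ψ x (h x) := by
  have hc := cK_pos hn
  have hL := continuous_laplacian hψ
  have hLc := hasCompactSupport_laplacian hψc
  have hswap : Integrable (Function.uncurry fun x y =>
      inner ℝ (rieszK (x - y)) (h y) * Laplacian.laplacian ψ x) (volume.prod volume) := by
    refine ⟨(aestronglyMeasurable_inner_rieszK_prod hh.1).mul
      hL.aestronglyMeasurable.comp_fst, ?_⟩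
    have hm : AEMeasurable (fun p : EuclideanSpace ℝ (Fin n) × EuclideanSpace ℝ (Fin n) =>
        ‖Laplacian.laplacian ψ p.1‖ₑ * (‖rieszK (p.1 - p.2)‖ₑ * ‖h p.2‖ₑ))
        (volume.prod volume) :=
      hL.aestronglyMeasurable.enorm.comp_fst.mul
        ((measurable_rieszK.comp measurable_sub).enorm.aemeasurable.mul hh.1.enorm.comp_snd)
    obtain ⟨M, hM⟩ := hLc.exists_bound_of_continuous hL
    obtain ⟨c, hcT, hcA⟩ := exists_setLIntegral_rieszPot_le hn
      (A := tsupport (Laplacian.laplacian ψ)) (isClosed_tsupport _).measurableSet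
      hLc.isCompact.measure_lt_top.ne
    calc ∫⁻ p, ‖Function.uncurry (fun x y =>
            inner ℝ (rieszK (x - y)) (h y) * Laplacian.laplacian ψ x) p‖ₑ ∂(volume.prod volume)
        ≤ ∫⁻ p : EuclideanSpace ℝ (Fin n) × EuclideanSpace ℝ (Fin n),
            ‖Laplacian.laplacian ψ p.1‖ₑ * (‖rieszK (p.1 - p.2)‖ₑ * ‖h p.2‖ₑ)
            ∂(volume.prod volume) := by
          refine lintegral_mono fun p => ?_
          simp only [Function.uncurry, enorm_mul]
          rw [mul_comm]
          gcongr
          exact enorm_inner_rieszK_le h p.1 p.2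
      _ = ∫⁻ x, ‖Laplacian.laplacian ψ x‖ₑ * rieszPot h x := by
          rw [lintegral_prod _ hm]
          refine lintegral_congr fun x => ?_
          exact lintegral_const_mul' ‖Laplacian.laplacian ψ x‖ₑ _ enorm_ne_top
      _ ≤ ∫⁻ x, (tsupport (Laplacian.laplacian ψ)).indicator
            (fun x => ENNReal.ofReal M * rieszPot h x) x := by
          refine lintegral_mono fun x => ?_
          by_cases hx : x ∈ tsupport (Laplacian.laplacian ψ)
          · simp only [hx, indicator_of_mem]
            gcongr
            rw [← ofReal_norm]
            exact ENNReal.ofReal_le_ofReal (hM x)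
          · simp [image_eq_zero_of_notMem_tsupport hx]
      _ = ENNReal.ofReal M * ∫⁻ x in tsupport (Laplacian.laplacian ψ), rieszPot h x := by
          rw [lintegral_indicator (isClosed_tsupport _).measurableSet,
            lintegral_const_mul' _ _ ENNReal.ofReal_ne_top]
      _ < ⊤ := ENNReal.mul_lt_top ENNReal.ofReal_lt_top
          ((hcA h hh.1).trans_lt (ENNReal.mul_lt_top hcT.lt_top hh.2))
  calc ∫ x, pot h x * Laplacian.laplacian ψ x
      = (cK n)⁻¹ * ∫ x, ∫ y, inner ℝ (rieszK (x - y)) (h y) * Laplacian.laplacian ψ x := by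
        simp_rw [pot, mul_assoc, integral_mul_const, integral_const_mul]
    _ = (cK n)⁻¹ * ∫ y, ∫ x, inner ℝ (rieszK (x - y)) (h y) * Laplacian.laplacian ψ x := by
        rw [integral_integral_swap hswap]
    _ = (cK n)⁻¹ * ∫ y, - (cK n * fderiv ℝ ψ y (h y)) := by
        congr 1
        refine integral_congr_ae (ae_of_all _ fun y => ?_)
        simp only
        have hg : ContDiff ℝ 2 fun z => ψ (z + y) := hψ.comp (contDiff_id.add contDiff_const)
        have hgc : HasCompactSupport fun z => ψ (z + y) :=
          hψc.comp_homeomorph (Homeomorph.addRight y)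
        have hlap : ∀ z, Laplacian.laplacian (fun z => ψ (z + y)) z =
            Laplacian.laplacian ψ (z + y) := by
          intro z
          rw [laplacian_eq_sum, laplacian_eq_sum]
          have : fderiv ℝ (fun z => ψ (z + y)) = fun z => fderiv ℝ ψ (z + y) :=
            funext fun z => fderiv_comp_add_right y
          rw [this]
          simp_rw [fderiv_comp_add_right]
        rw [← integral_add_right_eq_self _ y]
        simp only [add_sub_cancel_right]
        have h4 : ∀ z : EuclideanSpace ℝ (Fin n),
            inner ℝ (rieszK z) (h y) * Laplacian.laplacian ψ (z + y) =
            ∑ i, h y i * (rieszK z i * Laplacian.laplacian (fun z => ψ (z + y)) z) := by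
          intro z
          rw [hlap, PiLp.inner_apply, Finset.sum_mul]
          refine Finset.sum_congr rfl fun i _ => ?_
          simp
          ring
        simp_rw [h4]
        rw [integral_finsetSum _ fun i _ => (integrable_rieszK_apply_mul hn i
          (continuous_laplacian hg) (hasCompactSupport_laplacian hgc)).const_mul _]
        simp_rw [integral_const_mul, integral_rieszK_mul_laplacian hn hg hgc]
        rw [fderiv_eq_sum_pd, Finset.mul_sum, ← Finset.sum_neg_distrib]
        refine Finset.sum_congr rfl fun i _ => ?_
        have : pd i (fun z => ψ (z + y)) 0 = pd i ψ y := by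
          simp only [pd, fderiv_comp_add_right, zero_add]
        rw [this]
        ring
    _ = - ∫ x, fderiv ℝ ψ x (h x) := by
        rw [integral_neg, integral_const_mul]
        field_simp

end Potential

/-! ### The integral equation with a small drift -/

section FixedPoint

variable {n : ℕ} {V : EuclideanSpace ℝ (Fin n) → EuclideanSpace ℝ (Fin n)}

theorem rieszPot_smul_le {w : EuclideanSpace ℝ (Fin n) → ℝ} {M : ℝ} (hw : ∀ x, |w x| ≤ M)
    (x : EuclideanSpace ℝ (Fin n)) :
    rieszPot (fun y => w y • V y) x ≤ ENNReal.ofReal M * rieszPot V x := by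
  unfold rieszPot
  rw [← lintegral_const_mul' _ _ ENNReal.ofReal_ne_top]
  refine lintegral_mono fun y => ?_
  rw [enorm_smul]
  have : ‖w y‖ₑ ≤ ENNReal.ofReal M := by
    rw [← ofReal_norm]
    exact ENNReal.ofReal_le_ofReal (hw y)
  calc ‖rieszK (x - y)‖ₑ * (‖w y‖ₑ * ‖V y‖ₑ) = ‖w y‖ₑ * (‖rieszK (x - y)‖ₑ * ‖V y‖ₑ) := by ring
    _ ≤ _ := by gcongr

theorem rieszPot_ne_top_of_le (hn : 2 ≤ n)
    (hθ : ∀ x, ‖(cK n)⁻¹‖ₑ * rieszPot V x ≤ ENNReal.ofReal (1 / 2))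
    (x : EuclideanSpace ℝ (Fin n)) : rieszPot V x ≠ ⊤ := by
  intro h
  have := hθ x
  rw [h, ENNReal.mul_top (by simpa using (cK_pos hn).ne')] at this
  exact absurd this (by simp)

/-- Smallness of the drift makes `w ↦ pot (wV)` a contraction of ratio `1/2` in the sup norm,
pointwise everywhere rather than almost everywhere. -/
theorem abs_pot_smul_le (hθ : ∀ x, ‖(cK n)⁻¹‖ₑ * rieszPot V x ≤ ENNReal.ofReal (1 / 2))
    {w : EuclideanSpace ℝ (Fin n) → ℝ} {M : ℝ} (hw : ∀ x, |w x| ≤ M)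
    (x : EuclideanSpace ℝ (Fin n)) : |pot (fun y => w y • V y) x| ≤ M / 2 := by
  have hM : 0 ≤ M := (abs_nonneg _).trans (hw x)
  rw [← ENNReal.ofReal_le_ofReal_iff (by positivity), ← Real.norm_eq_abs, ofReal_norm]
  calc ‖pot (fun y => w y • V y) x‖ₑ
      ≤ ‖(cK n)⁻¹‖ₑ * (ENNReal.ofReal M * rieszPot V x) :=
        (enorm_pot_le _ x).trans (by gcongr; exact rieszPot_smul_le hw x)
    _ = ENNReal.ofReal M * (‖(cK n)⁻¹‖ₑ * rieszPot V x) := by ring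
    _ ≤ ENNReal.ofReal M * ENNReal.ofReal (1 / 2) := by gcongr; exact hθ x
    _ = ENNReal.ofReal (M / 2) := by
        rw [← ENNReal.ofReal_mul hM]
        ring_nf

/-- The Picard iterates for `w = G + pot (w V)`. -/
def picard (V : EuclideanSpace ℝ (Fin n) → EuclideanSpace ℝ (Fin n))
    (G : EuclideanSpace ℝ (Fin n) → ℝ) : ℕ → EuclideanSpace ℝ (Fin n) → ℝ
  | 0 => 0
  | m + 1 => fun x => G x + pot (fun y => picard V G m y • V y) x

/-- The Picard iterates converge geometrically at every point. Dominated convergence against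
`|K||V|`, which is integrable because the potential of `V` is finite, passes to the limit inside the
potential. -/
theorem exists_bounded_fixedPoint (hn : 2 ≤ n) (hV : AEStronglyMeasurable V)
    (hθ : ∀ x, ‖(cK n)⁻¹‖ₑ * rieszPot V x ≤ ENNReal.ofReal (1 / 2))
    {G : EuclideanSpace ℝ (Fin n) → ℝ} (hG : AEStronglyMeasurable G) {M : ℝ}
    (hM : ∀ x, |G x| ≤ M) :
    ∃ w : EuclideanSpace ℝ (Fin n) → ℝ, AEStronglyMeasurable w ∧ (∀ x, |w x| ≤ 2 * M) ∧
      ∀ x, w x = G x + pot (fun y => w y • V y) x := by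
  have hM0 : 0 ≤ M := (abs_nonneg _).trans (hM 0)
  set W := picard V G with hW
  have hmeas : ∀ m, AEStronglyMeasurable (W m) := by
    intro m
    induction m with
    | zero => exact aestronglyMeasurable_zero
    | succ m ih => exact hG.add (aestronglyMeasurable_pot (ih.smul hV))
  -- The bound `2M` is the fixed point of `m ↦ M + m/2`.
  have hbd : ∀ m x, |W m x| ≤ 2 * M := by
    intro m
    induction m with
    | zero => intro x; simpa [hW, picard] using hM0
    | succ m ih =>
      intro x
      calc |W (m + 1) x| ≤ |G x| + |pot (fun y => W m y • V y) x| := abs_add_le _ _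
        _ ≤ M + 2 * M / 2 := add_le_add (hM x) (abs_pot_smul_le hθ ih x)
        _ = 2 * M := by ring
  have hfin : ∀ m x, rieszPot (fun y => W m y • V y) x ≠ ⊤ := fun m x =>
    ne_top_of_le_ne_top (ENNReal.mul_ne_top ENNReal.ofReal_ne_top (rieszPot_ne_top_of_le hn hθ x))
      (rieszPot_smul_le (hbd m) x)
  have hdiff : ∀ m x, |W m x - W (m + 1) x| ≤ M / 2 ^ m := by
    intro m
    induction m with
    | zero =>
      intro x
      have h0 : pot (fun y => W 0 y • V y) x = 0 := by simp [pot, hW, picard]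
      have : W 0 x - W (0 + 1) x = - G x := by
        change 0 - (G x + pot (fun y => W 0 y • V y) x) = _
        rw [h0]
        ring
      rw [this, abs_neg]
      simpa using hM x
    | succ m ih =>
      intro x
      have h1 : W (m + 1) x - W (m + 1 + 1) x =
          pot (fun y => (W m y - W (m + 1) y) • V y) x := by
        simp_rw [sub_smul]
        rw [pot_sub (h₁ := fun y => W m y • V y) (h₂ := fun y => W (m + 1) y • V y) ((hmeas m).smul hV) ((hmeas (m + 1)).smul hV) (hfin m x) (hfin (m + 1) x)]
        change (G x + _) - (G x + _) = _
        ring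
      rw [h1]
      refine (abs_pot_smul_le hθ ih x).trans (le_of_eq ?_)
      rw [pow_succ]
      ring
  have hcauchy : ∀ x, CauchySeq fun m => W m x := fun x =>
    cauchySeq_of_le_geometric_two (C := 2 * M) fun m => by
      rw [Real.dist_eq]
      refine (hdiff m x).trans (le_of_eq ?_)
      ring
  choose w hw using fun x => cauchySeq_tendsto_of_complete (hcauchy x)
  have hwbd : ∀ x, |w x| ≤ 2 * M := fun x =>
    le_of_tendsto (hw x).abs (Eventually.of_forall fun m => hbd m x)
  refine ⟨w, aestronglyMeasurable_of_tendsto_ae atTop hmeas (ae_of_all _ hw), hwbd, fun x => ?_⟩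
  refine tendsto_nhds_unique ((tendsto_add_atTop_iff_nat 1).2 (hw x)) ?_
  change Tendsto (fun m => G x + pot (fun y => W m y • V y) x) atTop _
  refine Tendsto.const_add _ (Tendsto.const_mul _ ?_)
  refine tendsto_integral_of_dominated_convergence
    (fun y => ‖rieszK (x - y)‖ * ‖V y‖ * (2 * M)) ?_ ?_ ?_ ?_
  · exact fun m => aestronglyMeasurable_inner_rieszK ((hmeas m).smul hV) x
  · refine Integrable.mul_const ⟨?_, ?_⟩ _
    · exact (measurable_rieszK.comp (measurable_const_sub x)).norm.aestronglyMeasurable.mul hV.norm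
    · refine lt_of_le_of_lt (lintegral_mono fun y => ?_) (rieszPot_ne_top_of_le hn hθ x).lt_top
      rw [enorm_mul, enorm_norm, enorm_norm]
  · refine fun m => ae_of_all _ fun y => ?_
    refine (norm_inner_le_norm _ _).trans ?_
    rw [norm_smul]
    calc ‖rieszK (x - y)‖ * (‖W m y‖ * ‖V y‖) = ‖rieszK (x - y)‖ * ‖V y‖ * ‖W m y‖ := by ring
      _ ≤ _ := by gcongr; exact hbd m y
  · refine ae_of_all _ fun y => ?_
    exact Tendsto.inner tendsto_const_nhds ((hw y).smul_const _)

end FixedPoint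

/-! ### Hölder-type inequalities in Lorentz spaces -/

section LorentzEstimates

variable {α : Type*} [MeasurableSpace α] {μ : Measure α}

/-- The distribution function of `|u|`. -/
def distrib (u : α → ℝ) (μ : Measure α) (s : ℝ) : ℝ≥0∞ := μ {x | s < ‖u x‖}

theorem antitone_distrib (u : α → ℝ) (μ : Measure α) : Antitone (distrib u μ) :=
  fun _ _ hst => measure_mono fun _ hx => lt_of_le_of_lt hst hx

/-- Each threshold `t'` admissible in the infimum confines these levels to `(0, t')`. Only this half
of the duality between distribution function and rearrangement is needed. -/
theorem volume_distrib_gt_le_decRearr (u : α → ℝ) (μ : Measure α) (t : ℝ) :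
    volume {s : ℝ | 0 < s ∧ ENNReal.ofReal t < distrib u μ s} ≤ decRearr u μ t := by
  refine le_sInf fun t' ht' => ?_
  rcases eq_or_ne t' ⊤ with rfl | htop
  · exact le_top
  calc volume {s : ℝ | 0 < s ∧ ENNReal.ofReal t < distrib u μ s}
      ≤ volume (Ioo 0 t'.toReal) := by
        refine measure_mono fun s hs => ⟨hs.1, ?_⟩
        by_contra hcon
        rw [not_lt] at hcon
        have h1 : t' ≤ ENNReal.ofReal s := by
          rw [← ENNReal.ofReal_toReal htop]
          exact ENNReal.ofReal_le_ofReal hcon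
        refine absurd hs.2 (not_lt.2 (le_trans (measure_mono fun x hx => ?_) ht'))
        refine lt_of_le_of_lt h1 ?_
        rw [← ofReal_norm]
        exact (ENNReal.ofReal_lt_ofReal_iff_of_nonneg hs.1.le).2 hx
    _ = t' := by rw [Real.volume_Ioo, sub_zero, ENNReal.ofReal_toReal htop]

theorem antitone_decRearr (u : α → ℝ) (μ : Measure α) : Antitone (decRearr u μ) :=
  fun _ _ hst => sInf_le_sInf fun _ ht => le_trans ht (ENNReal.ofReal_le_ofReal hst)

theorem decRearr_le_avgRearr (u : α → ℝ) (μ : Measure α) {t : ℝ} (ht : 0 < t) :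
    decRearr u μ t ≤ avgRearr u μ t := by
  rw [avgRearr, ENNReal.le_div_iff_mul_le (by simp [ht]) (by simp)]
  calc decRearr u μ t * ENNReal.ofReal t = ∫⁻ _ in Ioo 0 t, decRearr u μ t := by
        rw [setLIntegral_const, Real.volume_Ioo, sub_zero]
    _ ≤ ∫⁻ s in Ioo 0 t, decRearr u μ s :=
        setLIntegral_mono' measurableSet_Ioo fun s hs => antitone_decRearr u μ hs.2.le

theorem measurableSet_distrib_gt (u : α → ℝ) (μ : Measure α) :
    MeasurableSet {p : ℝ × ℝ | ENNReal.ofReal p.2 < distrib u μ p.1} :=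
  measurableSet_lt (ENNReal.measurable_ofReal.comp measurable_snd)
    ((antitone_distrib u μ).measurable.comp measurable_fst)

/-- Tonelli for the subgraph of the distribution function. -/
theorem lintegral_subgraph_le (u : α → ℝ) (μ : Measure α) {T : Set ℝ}
    {w : ℝ → ℝ≥0∞} (hw : Measurable w) :
    ∫⁻ s in Ioi 0, ∫⁻ t in T, w t * {t | ENNReal.ofReal t < distrib u μ s}.indicator 1 t ≤
      ∫⁻ t in T, w t * decRearr u μ t := by
  rw [lintegral_lintegral_swap]
  · refine lintegral_mono fun t => ?_
    have hm : MeasurableSet {s : ℝ | ENNReal.ofReal t < distrib u μ s} :=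
      measurableSet_lt measurable_const (antitone_distrib u μ).measurable
    have h1 : ∀ s, {t | ENNReal.ofReal t < distrib u μ s}.indicator (1 : ℝ → ℝ≥0∞) t =
        {s : ℝ | ENNReal.ofReal t < distrib u μ s}.indicator 1 s := fun s => rfl
    simp_rw [h1]
    rw [lintegral_const_mul _ (measurable_one.indicator hm), lintegral_indicator_one hm,
      Measure.restrict_apply hm]
    gcongr
    refine le_trans (measure_mono fun s hs => ?_) (volume_distrib_gt_le_decRearr u μ t)
    exact ⟨hs.2, hs.1⟩
  · have h2 : Measurable fun p : ℝ × ℝ =>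
        {p : ℝ × ℝ | ENNReal.ofReal p.2 < distrib u μ p.1}.indicator (1 : ℝ × ℝ → ℝ≥0∞) p :=
      measurable_one.indicator (measurableSet_distrib_gt u μ)
    exact ((hw.comp measurable_snd).mul h2).aemeasurable

/-- The layer cake formula on a subset. -/
theorem setLIntegral_enorm_eq {u : α → ℝ} (hu : AEStronglyMeasurable u μ) (A : Set α) :
    ∫⁻ x in A, ‖u x‖ₑ ∂μ = ∫⁻ s in Ioi 0, distrib u (μ.restrict A) s := by
  simp_rw [← ofReal_norm]
  exact lintegral_eq_lintegral_meas_lt _ (ae_of_all _ fun x => norm_nonneg _)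
    hu.norm.aemeasurable.restrict

theorem distrib_restrict_le (u : α → ℝ) (A : Set α) (s : ℝ) :
    distrib u (μ.restrict A) s ≤ distrib u μ s :=
  Measure.restrict_apply_le _ _

theorem distrib_restrict_le_measure (u : α → ℝ) (A : Set α) (s : ℝ) :
    distrib u (μ.restrict A) s ≤ μ A :=
  (measure_mono (subset_univ _)).trans (by simp)

theorem distrib_le_univ (u : α → ℝ) (s : ℝ) : distrib u μ s ≤ μ univ :=
  measure_mono (subset_univ _)

/-- Since `∫₀ᴰ t^{1/n-1} dt = n D^{1/n}`, Tonelli on the subgraph of the distribution function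
bounds this integral by `∫ t^{1/n-1} |u|_*(t) dt`, and `|u|_* ≤ |u|_**`. This is the form in which
membership in `L^{n,1}` is used. -/
theorem lintegral_distrib_rpow_lt_top [IsFiniteMeasure μ] {n : ℕ} (hn : 2 ≤ n) {u : α → ℝ}
    (hu : MemLorentz u (n : ℝ≥0∞) 1 μ) :
    ∫⁻ s in Ioi 0, distrib u μ s ^ (1 / (n : ℝ)) < ⊤ := by
  have hn0 : (0 : ℝ) < n := by positivity
  have h1 := hu.2
  rw [lorentzNorm, if_neg (by simp)] at h1
  simp only [ENNReal.toReal_one, div_one, ENNReal.rpow_one, ENNReal.toReal_natCast] at h1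
  set T : Set ℝ := {t : ℝ | 0 < t ∧ ENNReal.ofReal t < μ univ} with hT
  set w : ℝ → ℝ≥0∞ := fun t => ENNReal.ofReal (t ^ (1 / (n : ℝ) - 1)) with hw
  have hwm : Measurable w := by
    rw [hw]
    fun_prop
  have hTm : MeasurableSet T := measurableSet_Ioi.inter
    (measurableSet_lt ENNReal.measurable_ofReal measurable_const)
  have h2 : ∫⁻ t in T, w t * decRearr u μ t < ⊤ := by
    refine lt_of_le_of_lt (setLIntegral_mono' hTm fun t ht => ?_) h1
    have ht0 : 0 < t := ht.1
    rw [mul_comm (ENNReal.ofReal (t ^ (1 / (n : ℝ)))) (avgRearr u μ t), mul_div_assoc,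
      ← ENNReal.ofReal_div_of_pos ht0, ← Real.rpow_sub_one ht0.ne', mul_comm]
    gcongr
    exact decRearr_le_avgRearr u μ ht0
  have h3 : ∫⁻ s in Ioi 0, ENNReal.ofReal n * distrib u μ s ^ (1 / (n : ℝ)) ≤
      ∫⁻ t in T, w t * decRearr u μ t := by
    refine le_trans (lintegral_mono fun s => ?_) (lintegral_subgraph_le u μ hwm)
    set D := distrib u μ s with hD
    have hDfin : D ≠ ⊤ := ne_top_of_le_ne_top (measure_ne_top μ univ) (distrib_le_univ u s)
    have h4 : ∫⁻ t in T, w t * {t | ENNReal.ofReal t < D}.indicator 1 t =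
        ∫⁻ t in Ioo 0 D.toReal, w t := by
      rw [← lintegral_indicator hTm, ← lintegral_indicator measurableSet_Ioo]
      refine lintegral_congr fun t => ?_
      by_cases ht : t ∈ Ioo 0 D.toReal
      · have h5 : ENNReal.ofReal t < D := (ENNReal.ofReal_lt_iff_lt_toReal ht.1.le hDfin).2 ht.2
        have h6 : t ∈ T := ⟨ht.1, h5.trans_le (distrib_le_univ u s)⟩
        rw [indicator_of_mem ht, indicator_of_mem h6,
          indicator_of_mem (show t ∈ {t | ENNReal.ofReal t < D} from h5)]
        simp
      · rw [indicator_of_notMem ht]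
        by_cases h6 : t ∈ T
        · rw [indicator_of_mem h6, indicator_of_notMem, mul_zero]
          intro h5
          exact ht ⟨h6.1, (ENNReal.ofReal_lt_iff_lt_toReal h6.1.le hDfin).1 h5⟩
        · rw [indicator_of_notMem h6]
    rw [h4]
    have hn1 : (-1 : ℝ) < 1 / (n : ℝ) - 1 := by
      have : 0 < 1 / (n : ℝ) := by positivity
      linarith
    have h7 : IntervalIntegrable (fun t : ℝ => t ^ (1 / (n : ℝ) - 1)) volume 0 D.toReal :=
      intervalIntegral.intervalIntegrable_rpow' hn1
    have h8 : IntegrableOn (fun t : ℝ => t ^ (1 / (n : ℝ) - 1)) (Ioo 0 D.toReal) :=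
      ((intervalIntegrable_iff_integrableOn_Ioc_of_le ENNReal.toReal_nonneg).1 h7).mono_set
        Ioo_subset_Ioc_self
    rw [← ofReal_integral_eq_lintegral_ofReal h8
      ((ae_restrict_iff' measurableSet_Ioo).2 (ae_of_all _ fun t ht => by
        exact Real.rpow_nonneg ht.1.le _)), ← integral_Ioc_eq_integral_Ioo,
      ← intervalIntegral.integral_of_le ENNReal.toReal_nonneg, integral_rpow (Or.inl hn1)]
    rw [sub_add_cancel, Real.zero_rpow (by positivity), sub_zero, div_div_eq_mul_div, div_one,
      mul_comm (D.toReal ^ _), ENNReal.ofReal_mul hn0.le,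
      ← ENNReal.ofReal_rpow_of_nonneg ENNReal.toReal_nonneg (by positivity),
      ENNReal.ofReal_toReal hDfin]
  rw [lintegral_const_mul' _ _ ENNReal.ofReal_ne_top] at h3
  by_contra hcon
  rw [not_lt, top_le_iff] at hcon
  rw [hcon, ENNReal.mul_top (by simpa using by omega)] at h3
  exact absurd (h3.trans_lt h2) (by simp)

/-- Layer cake for the measure `g dμ`: each superlevel set of `|u|` has `g`-mass at most `c μ(·)^a`.
With `a = 1/n` this is Hölder's inequality between weak `L^{n'}` and `L^{n,1}`; it serves for the
kernel, for `u`, and for the drift itself in the role of `g`. -/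
theorem setLIntegral_enorm_mul_le [IsFiniteMeasure μ] {a : ℝ} {u : α → ℝ}
    (hu : AEStronglyMeasurable u μ) {g : α → ℝ≥0∞} (hg : AEMeasurable g μ) {c : ℝ≥0∞}
    (hc : c ≠ ⊤) (hgc : ∀ A, MeasurableSet A → ∫⁻ x in A, g x ∂μ ≤ c * μ A ^ a)
    {E : Set α} (hE : MeasurableSet E) :
    ∫⁻ x in E, g x * ‖u x‖ₑ ∂μ ≤ c * ∫⁻ s in Ioi 0, distrib u (μ.restrict E) s ^ a := by
  set ν := (μ.restrict E).withDensity g with hν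
  have h1 : ∫⁻ x in E, g x * ‖u x‖ₑ ∂μ = ∫⁻ x, ENNReal.ofReal ‖u x‖ ∂ν := by
    simp_rw [ofReal_norm]
    rw [hν, lintegral_withDensity_eq_lintegral_mul₀ hg.restrict hu.enorm.restrict]
    rfl
  rw [h1, lintegral_eq_lintegral_meas_lt ν (ae_of_all _ fun x => norm_nonneg _)
    (hu.norm.aemeasurable.restrict.mono_ac (withDensity_absolutelyContinuous _ _)),
    ← lintegral_const_mul' _ _ hc]
  refine lintegral_mono fun s => ?_
  rw [hν, withDensity_apply']
  calc ∫⁻ x in {x | s < ‖u x‖}, g x ∂(μ.restrict E)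
      = ∫⁻ x in {x | s < ‖u x‖} ∩ E, g x ∂μ := by rw [Measure.restrict_restrict' hE]
    -- As `u` is only a.e. strongly measurable, its superlevel sets are replaced by measurable hulls
    -- of the same measure.
    _ ≤ ∫⁻ x in toMeasurable μ ({x | s < ‖u x‖} ∩ E), g x ∂μ :=
        lintegral_mono_set (subset_toMeasurable _ _)
    _ ≤ c * μ (toMeasurable μ ({x | s < ‖u x‖} ∩ E)) ^ a := hgc _ (measurableSet_toMeasurable _ _)
    _ = c * distrib u (μ.restrict E) s ^ a := by
        rw [measure_toMeasurable, distrib, Measure.restrict_apply' hE]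

/-- Absolute continuity of the `L^{n,1}` quantity: dominated convergence in the level `s`, where the
integrand is at most `μ(E k)^a`. -/
theorem tendsto_lintegral_distrib_restrict {a : ℝ} (ha : 0 < a) {u : α → ℝ}
    (hu : ∫⁻ s in Ioi 0, distrib u μ s ^ a < ⊤) {E : ℕ → Set α}
    (hE : Tendsto (fun k => μ (E k)) atTop (𝓝 0)) :
    Tendsto (fun k => ∫⁻ s in Ioi 0, distrib u (μ.restrict (E k)) s ^ a) atTop (𝓝 0) := by
  have h0 : ∫⁻ _ in Ioi (0 : ℝ), (0 : ℝ≥0∞) = 0 := lintegral_zero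
  rw [← h0]
  refine tendsto_lintegral_of_dominated_convergence (fun s => distrib u μ s ^ a) ?_ ?_ hu.ne ?_
  · exact fun k => (antitone_distrib _ _).measurable.pow_const a
  · exact fun k => ae_of_all _ fun s => ENNReal.rpow_le_rpow (distrib_restrict_le u _ s) ha.le
  · refine ae_of_all _ fun s => ?_
    have h1 := hE.ennrpow_const a
    rw [ENNReal.zero_rpow_of_pos ha] at h1
    exact tendsto_of_tendsto_of_tendsto_of_le_of_le tendsto_const_nhds h1 (fun _ => zero_le)
      fun k => ENNReal.rpow_le_rpow (distrib_restrict_le_measure u _ s) ha.le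

/-- Hardy–Littlewood: the integral over `A` is at most `∫₀ᵗ |u|_* = t |u|_**(t)` with `t = μ(A)`,
hence at most `t^{1-1/n'}` times the norm, and `1 - 1/n' = 1/n`. -/
theorem exists_setLIntegral_le_of_memLorentz_top [IsFiniteMeasure μ] {n : ℕ} (hn : 2 ≤ n)
    {u : α → ℝ} (hu : MemLorentz u (ENNReal.ofReal ((n : ℝ) / ((n : ℝ) - 1))) ⊤ μ) :
    ∃ c : ℝ≥0∞, c ≠ ⊤ ∧
      ∀ A, MeasurableSet A → ∫⁻ x in A, ‖u x‖ₑ ∂μ ≤ c * μ A ^ (1 / (n : ℝ)) := by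
  have hn2 : (2 : ℝ) ≤ n := by exact_mod_cast hn
  refine ⟨lorentzNorm u (ENNReal.ofReal ((n : ℝ) / ((n : ℝ) - 1))) ⊤ μ, hu.2.ne, fun A _ => ?_⟩
  rcases eq_or_ne (μ A) 0 with h0 | h0
  · rw [setLIntegral_measure_zero _ _ h0]
    exact zero_le
  set t : ℝ := (μ A).toReal with ht
  have hAt : μ A = ENNReal.ofReal t := (ENNReal.ofReal_toReal (measure_ne_top μ A)).symm
  have ht0 : 0 < t := ENNReal.toReal_pos h0 (measure_ne_top μ A)
  have h1 : ∫⁻ x in A, ‖u x‖ₑ ∂μ ≤ ∫⁻ τ in Ioo 0 t, decRearr u μ τ := by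
    rw [setLIntegral_enorm_eq hu.1]
    calc ∫⁻ s in Ioi 0, distrib u (μ.restrict A) s
        ≤ ∫⁻ s in Ioi 0, ∫⁻ τ in Ioo 0 t, (fun _ => 1) τ *
            {τ | ENNReal.ofReal τ < distrib u μ s}.indicator 1 τ := by
          refine lintegral_mono fun s => ?_
          set D := distrib u (μ.restrict A) s with hD
          have hDA : D ≤ μ A := distrib_restrict_le_measure u A s
          have hDfin : D ≠ ⊤ := ne_top_of_le_ne_top (measure_ne_top μ A) hDA
          calc D = ∫⁻ τ in Ioo 0 D.toReal, 1 := by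
                simp [ENNReal.ofReal_toReal hDfin]
            _ ≤ ∫⁻ τ in Ioo 0 D.toReal, (fun _ => 1) τ *
                {τ | ENNReal.ofReal τ < distrib u μ s}.indicator 1 τ := by
                refine setLIntegral_mono' measurableSet_Ioo fun τ hτ => ?_
                have : ENNReal.ofReal τ < distrib u μ s :=
                  ((ENNReal.ofReal_lt_iff_lt_toReal hτ.1.le hDfin).2 hτ.2).trans_le
                    (distrib_restrict_le u A s)
                rw [indicator_of_mem (show τ ∈ {τ | ENNReal.ofReal τ < distrib u μ s} from this)]
                simp
            _ ≤ _ := lintegral_mono_set (Ioo_subset_Ioo_right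
                (ENNReal.toReal_mono (measure_ne_top μ A) hDA))
      _ ≤ ∫⁻ τ in Ioo 0 t, (fun _ => 1) τ * decRearr u μ τ :=
          lintegral_subgraph_le u μ measurable_const
      _ = _ := by simp
  have h2 : ENNReal.ofReal (t ^ (1 / (ENNReal.ofReal ((n : ℝ) / ((n : ℝ) - 1))).toReal)) *
      avgRearr u μ t ≤ lorentzNorm u (ENNReal.ofReal ((n : ℝ) / ((n : ℝ) - 1))) ⊤ μ := by
    rw [lorentzNorm, if_pos rfl]
    refine le_iSup₂ (f := fun (t : ℝ) (_ : 0 < t ∧ ENNReal.ofReal t ≤ μ univ) =>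
      ENNReal.ofReal (t ^ (1 / (ENNReal.ofReal ((n : ℝ) / ((n : ℝ) - 1))).toReal)) *
        avgRearr u μ t) t ⟨ht0, ?_⟩
    rw [← hAt]
    exact measure_mono (subset_univ _)
  set p : ℝ := 1 / (ENNReal.ofReal ((n : ℝ) / ((n : ℝ) - 1))).toReal with hp
  have hpn : p + 1 / (n : ℝ) = 1 := by
    rw [hp, ENNReal.toReal_ofReal (div_nonneg (by linarith) (by linarith))]
    have : (n : ℝ) - 1 ≠ 0 := by linarith
    field_simp
    ring
  have h3 : ∫⁻ τ in Ioo 0 t, decRearr u μ τ = ENNReal.ofReal t * avgRearr u μ t := by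
    rw [avgRearr, ENNReal.mul_div_cancel (by simp [ht0]) (by simp)]
  calc ∫⁻ x in A, ‖u x‖ₑ ∂μ ≤ ENNReal.ofReal t * avgRearr u μ t := h1.trans h3.le
    _ = (ENNReal.ofReal (t ^ p) * avgRearr u μ t) * ENNReal.ofReal (t ^ (1 / (n : ℝ))) := by
        rw [mul_right_comm, ← ENNReal.ofReal_mul (by positivity), ← Real.rpow_add ht0, hpn,
          Real.rpow_one]
    _ ≤ _ := by
        rw [hAt, ENNReal.ofReal_rpow_of_pos ht0]
        gcongr

/-- Interpolate `D = D^{1-1/n} D^{1/n} ≤ μ(A)^{1-1/n} D^{1/n}`. The surplus power `1 - 2/n` is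
nonnegative because `n ≥ 2` and is absorbed by the total mass. So an `L^{n,1}` function may also
play the weak `L^{n'}` role, which yields `U ∈ L²`. -/
theorem exists_setLIntegral_le_of_memLorentz_one [IsFiniteMeasure μ] {n : ℕ} (hn : 2 ≤ n)
    {u : α → ℝ} (hu : MemLorentz u (n : ℝ≥0∞) 1 μ) :
    ∃ c : ℝ≥0∞, c ≠ ⊤ ∧
      ∀ A, MeasurableSet A → ∫⁻ x in A, ‖u x‖ₑ ∂μ ≤ c * μ A ^ (1 / (n : ℝ)) := by
  have hn2 : (2 : ℝ) ≤ n := by exact_mod_cast hn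
  have hn1 : 1 / (n : ℝ) ≤ 1 / 2 := one_div_le_one_div_of_le (by norm_num) hn2
  have hn0 : 0 < 1 / (n : ℝ) := by positivity
  set a := 1 / (n : ℝ) with ha
  set I := ∫⁻ s in Ioi 0, distrib u μ s ^ a with hI
  have hIfin : I < ⊤ := lintegral_distrib_rpow_lt_top hn hu
  refine ⟨μ univ ^ (1 - 2 * a) * I, ENNReal.mul_ne_top (ENNReal.rpow_ne_top_of_nonneg
    (by linarith) (measure_ne_top μ univ)) hIfin.ne, fun A _ => ?_⟩
  rw [setLIntegral_enorm_eq hu.1]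
  calc ∫⁻ s in Ioi 0, distrib u (μ.restrict A) s
      ≤ ∫⁻ s in Ioi 0, μ A ^ (1 - a) * distrib u μ s ^ a := by
        refine lintegral_mono fun s => ?_
        set D := distrib u (μ.restrict A) s
        calc D = D ^ (1 - a) * D ^ a := by
              rw [← ENNReal.rpow_add_of_nonneg _ _ (by linarith) (by linarith), sub_add_cancel,
                ENNReal.rpow_one]
          _ ≤ _ := mul_le_mul'
              (ENNReal.rpow_le_rpow (distrib_restrict_le_measure u A s) (by linarith))
              (ENNReal.rpow_le_rpow (distrib_restrict_le u A s) (by linarith))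
    _ = μ A ^ (1 - a) * I := by
        rw [lintegral_const_mul' _ _
          (ENNReal.rpow_ne_top_of_nonneg (by linarith) (measure_ne_top μ A))]
    _ = μ A ^ (1 - 2 * a) * μ A ^ a * I := by
        rw [← ENNReal.rpow_add_of_nonneg _ _ (by linarith) (by linarith)]
        ring_nf
    _ ≤ μ univ ^ (1 - 2 * a) * μ A ^ a * I := by
        gcongr
        · linarith
        · exact subset_univ _
    _ = _ := by ring

end LorentzEstimates

/-! ### Smooth approximations of the positive part -/

section Transition

/-- A smooth nondecreasing approximation of `signPos`. -/
def trans (ε s : ℝ) : ℝ := Real.smoothTransition (s / ε)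

/-- The primitive of `trans ε`, a smooth convex approximation of the positive part. -/
def prim (ε s : ℝ) : ℝ := ∫ t in (0 : ℝ)..s, trans ε t

variable {ε : ℝ}

theorem contDiff_trans : ContDiff ℝ ∞ (trans ε) :=
  Real.smoothTransition.contDiff.comp (contDiff_id.div_const ε)

theorem continuous_trans : Continuous (trans ε) := (contDiff_trans (ε := ε)).continuous

theorem trans_nonneg (s : ℝ) : 0 ≤ trans ε s := Real.smoothTransition.nonneg _

theorem trans_le_one (s : ℝ) : trans ε s ≤ 1 := Real.smoothTransition.le_one _

theorem abs_trans_le_one (s : ℝ) : |trans ε s| ≤ 1 := by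
  rw [abs_of_nonneg (trans_nonneg s)]
  exact trans_le_one s

theorem trans_of_nonpos (hε : 0 < ε) {s : ℝ} (hs : s ≤ 0) : trans ε s = 0 :=
  Real.smoothTransition.zero_of_nonpos (div_nonpos_of_nonpos_of_nonneg hs hε.le)

theorem trans_of_le (hε : 0 < ε) {s : ℝ} (hs : ε ≤ s) : trans ε s = 1 :=
  Real.smoothTransition.one_of_one_le ((one_le_div hε).2 hs)

theorem monotone_trans (hε : 0 < ε) : Monotone (trans ε) := fun _ _ h =>
  Real.smoothTransition.monotone (div_le_div_of_nonneg_right h hε.le)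

theorem deriv_trans_nonneg (hε : 0 < ε) (s : ℝ) : 0 ≤ deriv (trans ε) s :=
  (monotone_trans hε).deriv_nonneg

theorem hasDerivAt_trans (s : ℝ) : HasDerivAt (trans ε) (deriv (trans ε) s) s :=
  ((contDiff_trans (ε := ε)).differentiable (by simp) s).hasDerivAt

theorem continuous_deriv_trans : Continuous (deriv (trans ε)) :=
  (contDiff_trans (ε := ε)).continuous_deriv (by simp)

/-- The derivative is continuous and vanishes outside `[0, ε]`. -/
theorem exists_deriv_trans_le (hε : 0 < ε) : ∃ C, 0 ≤ C ∧ ∀ s, deriv (trans ε) s ≤ C := by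
  obtain ⟨C, hC⟩ := (isCompact_Icc (a := (0 : ℝ)) (b := ε)).exists_bound_of_continuousOn
    (continuous_deriv_trans (ε := ε)).continuousOn
  refine ⟨max C 0, le_max_right _ _, fun s => ?_⟩
  by_cases hs : s ∈ Icc 0 ε
  · exact (le_abs_self _).trans ((hC s hs).trans (le_max_left _ _))
  · refine le_trans (le_of_eq ?_) (le_max_right _ _)
    rw [mem_Icc, not_and_or, not_le, not_le] at hs
    rcases hs with hs | hs
    · have : trans ε =ᶠ[𝓝 s] fun _ => 0 := by
        filter_upwards [Iio_mem_nhds hs] with t ht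
        exact trans_of_nonpos hε ht.le
      rw [this.deriv_eq, deriv_const]
    · have : trans ε =ᶠ[𝓝 s] fun _ => 1 := by
        filter_upwards [Ioi_mem_nhds hs] with t ht
        exact trans_of_le hε ht.le
      rw [this.deriv_eq, deriv_const]

theorem hasDerivAt_prim (s : ℝ) : HasDerivAt (prim ε) (trans ε s) s :=
  intervalIntegral.integral_hasDerivAt_right (continuous_trans.intervalIntegrable _ _)
    (continuous_trans.stronglyMeasurableAtFilter _ _) continuous_trans.continuousAt

theorem deriv_prim : deriv (prim ε) = trans ε := funext fun s => (hasDerivAt_prim s).deriv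

theorem contDiff_prim : ContDiff ℝ ∞ (prim ε) := by
  rw [contDiff_infty_iff_deriv, deriv_prim]
  exact ⟨fun s => (hasDerivAt_prim s).differentiableAt, contDiff_trans⟩

theorem continuous_prim : Continuous (prim ε) := (contDiff_prim (ε := ε)).continuous

theorem abs_prim_sub_le (a b : ℝ) : |prim ε a - prim ε b| ≤ |a - b| := by
  have := Convex.norm_image_sub_le_of_norm_deriv_le (f := prim ε) (C := 1) (s := univ) (x := b)
    (y := a) (fun s _ => (hasDerivAt_prim s).differentiableAt) (fun s _ => by
      rw [deriv_prim]; exact abs_trans_le_one s) convex_univ (mem_univ _) (mem_univ _)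
  simpa using this

theorem prim_zero : prim ε 0 = 0 := by simp [prim]

theorem abs_prim_le (s : ℝ) : |prim ε s| ≤ |s| := by
  simpa [prim_zero] using abs_prim_sub_le (ε := ε) s 0

theorem monotone_prim : Monotone (prim ε) :=
  monotone_of_deriv_nonneg (fun s => (hasDerivAt_prim s).differentiableAt) fun s => by
    rw [deriv_prim]
    exact trans_nonneg s

theorem prim_of_nonpos (hε : 0 < ε) {s : ℝ} (hs : s ≤ 0) : prim ε s = 0 := by
  rw [prim, intervalIntegral.integral_congr (g := fun _ => (0 : ℝ)), intervalIntegral.integral_zero]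
  intro t ht
  rw [uIcc_of_ge hs] at ht
  exact trans_of_nonpos hε ht.2

theorem prim_nonneg (hε : 0 < ε) (s : ℝ) : 0 ≤ prim ε s := by
  rcases le_total s 0 with hs | hs
  · rw [prim_of_nonpos hε hs]
  · rw [← prim_zero (ε := ε)]
    exact monotone_prim hs

theorem prim_le_posPart (hε : 0 < ε) (s : ℝ) : prim ε s ≤ max s 0 := by
  rcases le_total s 0 with hs | hs
  · rw [prim_of_nonpos hε hs]
    exact le_max_right _ _
  · refine ((le_abs_self _).trans (abs_prim_le s)).trans ?_
    rw [abs_of_nonneg hs]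
    exact le_max_left _ _

theorem posPart_sub_le_prim (hε : 0 < ε) (s : ℝ) : max s 0 - ε ≤ prim ε s := by
  rcases le_total s ε with hs | hs
  · have : max s 0 ≤ ε := max_le hs hε.le
    linarith [prim_nonneg hε s]
  · rw [max_eq_left (hε.le.trans hs)]
    have h1 : prim ε s = prim ε ε + (s - ε) := by
      rw [prim, ← intervalIntegral.integral_add_adjacent_intervals
        (continuous_trans.intervalIntegrable 0 ε) (continuous_trans.intervalIntegrable ε s), prim]
      congr 1
      rw [intervalIntegral.integral_congr (g := fun _ => (1 : ℝ))]
      · simp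
      · intro t ht
        rw [uIcc_of_le hs] at ht
        exact trans_of_le hε ht.1
    linarith [prim_nonneg hε ε]

theorem tendsto_prim {e : ℕ → ℝ} (he : ∀ k, 0 < e k) (he0 : Tendsto e atTop (𝓝 0)) (s : ℝ) :
    Tendsto (fun k => prim (e k) s) atTop (𝓝 (max s 0)) := by
  refine tendsto_of_tendsto_of_tendsto_of_le_of_le (g := fun k => max s 0 - e k) ?_
    tendsto_const_nhds (fun k => posPart_sub_le_prim (he k) s) fun k => prim_le_posPart (he k) s
  simpa using tendsto_const_nhds.sub he0

theorem tendsto_trans {e : ℕ → ℝ} (he : ∀ k, 0 < e k) (he0 : Tendsto e atTop (𝓝 0)) (s : ℝ) :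
    Tendsto (fun k => trans (e k) s) atTop (𝓝 (signPos s)) := by
  unfold signPos
  split_ifs with hs
  · refine tendsto_const_nhds.congr' ?_
    filter_upwards [he0.eventually_lt_const hs] with k hk
    exact (trans_of_le (he k) hk.le).symm
  · exact tendsto_const_nhds.congr fun k => (trans_of_nonpos (he k) (not_lt.1 hs)).symm

end Transition

/-! ### Bounded solutions -/

section Bounded

variable {n : ℕ}

theorem integral_mul_laplacian {f g : EuclideanSpace ℝ (Fin n) → ℝ} (hf : ContDiff ℝ 1 f)
    (hg : ContDiff ℝ 2 g) (hgc : HasCompactSupport g) :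
    ∫ x, f x * Laplacian.laplacian g x = - ∫ x, ∑ i, pd i f x * pd i g x := by
  have hg' := fun i => contDiff_pd (m := 1) hg (by norm_num) i
  have hg'' := fun i => (contDiff_pd (m := 0) (hg' i) (by norm_num) i).continuous
  have hf' := fun i => (contDiff_pd (m := 0) hf (by norm_num) i).continuous
  have hc := fun i => hasCompactSupport_pd hgc i
  simp_rw [fun x => laplacian_eq_sum_pd (hg.contDiffAt (x := x)), Finset.mul_sum]
  rw [integral_finsetSum, integral_finsetSum, ← Finset.sum_neg_distrib]
  · exact Finset.sum_congr rfl fun i _ => integral_mul_pd hf (hg' i) (hc i) i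
  · exact fun i _ => ((hf' i).mul (hg' i).continuous).integrable_of_hasCompactSupport
      (hc i).mul_left
  · exact fun i _ => (hf.continuous.mul (hg'' i)).integrable_of_hasCompactSupport
      (hasCompactSupport_pd (hc i) i).mul_left

theorem integrable_clm_apply {μ : Measure (EuclideanSpace ℝ (Fin n))}
    {h : EuclideanSpace ℝ (Fin n) → EuclideanSpace ℝ (Fin n)}
    (hh : Integrable h μ) {T : EuclideanSpace ℝ (Fin n) → EuclideanSpace ℝ (Fin n) →L[ℝ] ℝ}
    (hT : Continuous T) (hTc : HasCompactSupport T) : Integrable (fun x => T x (h x)) μ := by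
  obtain ⟨C, hC⟩ := hTc.exists_bound_of_continuous hT
  refine (hh.norm.const_mul C).mono' ?_ (ae_of_all _ fun x => ?_)
  · exact (ContinuousLinearMap.apply ℝ ℝ).flip.aestronglyMeasurable_comp₂
      hT.aestronglyMeasurable hh.1
  · exact ((T x).le_opNorm _).trans (by gcongr; exact hC x)

/-- Split the commutator as `(w_k - w)V` plus `wV - (wV)_k`. The first part tends to zero by
dominated convergence, where boundedness of `w` is essential; the second is the mollification error
of the `L^q` field `wV`. -/
theorem tendsto_lintegral_commutator {q : ℝ} (hq : 1 ≤ q)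
    {V : EuclideanSpace ℝ (Fin n) → EuclideanSpace ℝ (Fin n)} (hV : MemLp V (ENNReal.ofReal q))
    {w : EuclideanSpace ℝ (Fin n) → ℝ} (hw : Integrable w) {M : ℝ} (hM : ∀ x, |w x| ≤ M) :
    Tendsto (fun k => ∫⁻ x, ‖moll k w x • V x - moll k (fun y => w y • V y) x‖ₑ ^ q)
      atTop (𝓝 0) := by
  have hq0 : 0 < q := by linarith
  have hM0 : 0 ≤ M := (abs_nonneg _).trans (hM 0)
  have hwV : MemLp (fun y => w y • V y) (ENNReal.ofReal q) := by
    refine (hV.const_smul M).of_le (hw.1.smul hV.1) (ae_of_all _ fun x => ?_)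
    rw [Pi.smul_apply, norm_smul, norm_smul, Real.norm_of_nonneg hM0]
    gcongr
    exact hM x
  have hVfin : ∫⁻ x, ‖V x‖ₑ ^ q ≠ ⊤ := by
    have := (eLpNorm_lt_top_iff_lintegral_rpow_enorm_lt_top (p := ENNReal.ofReal q)
      (by simpa using hq0) ENNReal.ofReal_ne_top (f := V) (μ := volume)).1 hV.2
    rw [ENNReal.toReal_ofReal hq0.le] at this
    exact this.ne
  have hmeas : ∀ k, AEMeasurable fun x => ‖moll k w x - w x‖ₑ ^ q * ‖V x‖ₑ ^ q := fun k =>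
    (((integrable_moll k hw).1.sub hw.1).enorm.pow_const q).mul (hV.1.enorm.pow_const q)
  have h1 : Tendsto (fun k => ∫⁻ x, ‖moll k w x - w x‖ₑ ^ q * ‖V x‖ₑ ^ q) atTop (𝓝 0) := by
    rw [show (0 : ℝ≥0∞) = ∫⁻ _ : EuclideanSpace ℝ (Fin n), 0 by simp]
    refine tendsto_lintegral_of_dominated_convergence'
      (fun x => ENNReal.ofReal (2 * M) ^ q * ‖V x‖ₑ ^ q) ?_ ?_ ?_ ?_
    · exact hmeas
    · refine fun k => ae_of_all _ fun x =>
        mul_le_mul' (ENNReal.rpow_le_rpow ?_ hq0.le) le_rfl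
      rw [← ofReal_norm]
      apply ENNReal.ofReal_le_ofReal
      calc ‖moll k w x - w x‖ ≤ ‖moll k w x‖ + ‖w x‖ := norm_sub_le _ _
        _ ≤ M + M := add_le_add (norm_moll_le hM x) (hM x)
        _ = 2 * M := by ring
    · rw [lintegral_const_mul' _ _ (ENNReal.rpow_ne_top_of_nonneg hq0.le ENNReal.ofReal_ne_top)]
      exact ENNReal.mul_ne_top (ENNReal.rpow_ne_top_of_nonneg hq0.le ENNReal.ofReal_ne_top) hVfin
    · have hfin : ∀ᵐ x, ‖V x‖ₑ ^ q ≠ ⊤ := ae_of_all _ fun x =>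
        ENNReal.rpow_ne_top_of_nonneg hq0.le enorm_ne_top
      filter_upwards [ae_tendsto_moll hw.locallyIntegrable, hfin] with x hx hxV
      have h2 : Tendsto (fun k => moll k w x - w x) atTop (𝓝 0) := by
        simpa using hx.sub_const (w x)
      have h3 := (h2.enorm.ennrpow_const q)
      rw [enorm_zero, ENNReal.zero_rpow_of_pos hq0] at h3
      simpa using ENNReal.Tendsto.mul_const h3 (Or.inr hxV)
  have h2 := tendsto_lintegral_moll_sub_rpow hq hwV
  -- The factor `2^{q-1}` comes from `(a + b)^q ≤ 2^{q-1}(a^q + b^q)`.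
  have h3 := ENNReal.Tendsto.const_mul (a := (2 : ℝ≥0∞) ^ (q - 1)) (h1.add h2)
    (Or.inr (ENNReal.rpow_ne_top_of_nonneg (by linarith) (by simp)))
  rw [add_zero, mul_zero] at h3
  refine tendsto_of_tendsto_of_tendsto_of_le_of_le tendsto_const_nhds h3 (fun _ => zero_le)
    fun k => ?_
  rw [← lintegral_add_left' (hmeas k), ← lintegral_const_mul' _ _
        (ENNReal.rpow_ne_top_of_nonneg (by linarith) (by simp))]
  refine lintegral_mono fun x => ?_
  refine le_trans ?_ (ENNReal.rpow_add_le_mul_rpow_add_rpow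
    (‖moll k w x - w x‖ₑ * ‖V x‖ₑ) ‖moll k (fun y => w y • V y) x - w x • V x‖ₑ hq) |>.trans ?_
  · gcongr
    rw [← enorm_smul, ← enorm_neg (moll k (fun y => w y • V y) x - w x • V x)]
    refine le_trans (le_of_eq ?_) (enorm_add_le _ _)
    congr 1
    rw [sub_smul]
    abel
  · rw [ENNReal.mul_rpow_of_nonneg _ _ hq0.le]

end Bounded

/-! ### Energy estimate for the mollified equation -/

section Bounded

variable {n : ℕ}

/-- Completing the square: the good term `|∇f|²` absorbs the commutator `c` at the price of
`|c|²/4`. -/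
theorem sum_pd_mul_pd_nonneg_bound (f : EuclideanSpace ℝ (Fin n) → ℝ)
    (x c : EuclideanSpace ℝ (Fin n)) :
    -(‖c‖ ^ 2 / 4) ≤ (∑ i, pd i f x * pd i f x) + fderiv ℝ f x c := by
  rw [fderiv_eq_sum_pd, EuclideanSpace.norm_sq_eq, Finset.sum_div, ← Finset.sum_neg_distrib,
    ← Finset.sum_add_distrib]
  refine Finset.sum_le_sum fun i _ => ?_
  rw [Real.norm_eq_abs, sq_abs]
  nlinarith [sq_nonneg (pd i f x + c i / 2)]

theorem pd_mul {f g : EuclideanSpace ℝ (Fin n) → ℝ} {x : EuclideanSpace ℝ (Fin n)}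
    (hf : DifferentiableAt ℝ f x) (hg : DifferentiableAt ℝ g x) (i : Fin n) :
    pd i (fun y => f y * g y) x = f x * pd i g x + g x * pd i f x := by
  unfold pd
  rw [fderiv_fun_mul hf hg]
  simp

theorem fderiv_comp_real {p : ℝ → ℝ} {p' : ℝ} {f : EuclideanSpace ℝ (Fin n) → ℝ}
    {x : EuclideanSpace ℝ (Fin n)} (hp : HasDerivAt p p' (f x)) (hf : DifferentiableAt ℝ f x) :
    fderiv ℝ (fun y => p (f y)) x = p' • fderiv ℝ f x :=
  (hp.comp_hasFDerivAt x hf.hasFDerivAt).fderiv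

set_option maxHeartbeats 400000 in
/-- The energy inequality for the mollified equation. -/
theorem energy_inequality {ε : ℝ} (hε : 0 < ε)
    {W ζ : EuclideanSpace ℝ (Fin n) → ℝ} (hW : ContDiff ℝ ∞ W) (hζ : ContDiff ℝ ∞ ζ)
    (hζc : HasCompactSupport ζ) (hζ0 : ∀ x, 0 ≤ ζ x)
    {V H : EuclideanSpace ℝ (Fin n) → EuclideanSpace ℝ (Fin n)} (hV : Integrable V)
    (hH : Integrable H) {g : EuclideanSpace ℝ (Fin n) → ℝ} (hg : Integrable g)
    (hc2 : Integrable fun x => ‖W x • V x - H x‖ ^ 2)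
    (hc1 : Integrable fun x => ‖W x • V x - H x‖)
    (hdiv : ∀ η, IsTestFunction (univ : Set (EuclideanSpace ℝ (Fin n))) η →
      tsupport η ⊆ tsupport ζ → ∫ x, fderiv ℝ η x (V x) = 0)
    (heq : ∀ η, IsTestFunction (univ : Set (EuclideanSpace ℝ (Fin n))) η →
      tsupport η ⊆ tsupport ζ →
      (∫ x, W x * Laplacian.laplacian η x) + ∫ x, fderiv ℝ η x (H x) = - ∫ x, g x * η x) 
    {C D : ℝ} (hC : ∀ s, deriv (trans ε) s ≤ C) (hζC : ∀ x, ζ x ≤ D)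
    (hζD : ∀ x, ‖fderiv ℝ ζ x‖ ≤ D) :
    ∫ x, prim ε (W x) * (- Laplacian.laplacian ζ x - fderiv ℝ ζ x (V x)) ≤
      (∫ x, trans ε (W x) * g x * ζ x) +
        (C * D / 4 * (∫ x, ‖W x • V x - H x‖ ^ 2) + D * ∫ x, ‖W x • V x - H x‖) := by
  have hW1 := contDiff_infty.1 hW 1
  have hζ1 := contDiff_infty.1 hζ 1
  have hζ2 := contDiff_infty.1 hζ 2
  have hWd : Differentiable ℝ W := hW1.differentiable (by norm_num)
  have hζd : Differentiable ℝ ζ := hζ1.differentiable (by norm_num)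
  have hpW : ContDiff ℝ ∞ fun x => trans ε (W x) := contDiff_trans.comp hW
  have hjW : ContDiff ℝ ∞ fun x => prim ε (W x) := contDiff_prim.comp hW
  -- With `p = trans ε` and `j = prim ε`, `η` tests the equation and `θ` tests `div V = 0`. The
  -- choice of `θ` rests on `(s p(s) - j(s))' = s p'(s)`, which reproduces the drift term `ζ W p'(W)
  -- ∇W·V`.
  set η := fun x => trans ε (W x) * ζ x with hη
  set θ := fun x => (W x * trans ε (W x) - prim ε (W x)) * ζ x with hθ
  have hηs : tsupport η ⊆ tsupport ζ := tsupport_mul_subset_right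
  have hθs : tsupport θ ⊆ tsupport ζ := tsupport_mul_subset_right
  have hηt : IsTestFunction (univ : Set (EuclideanSpace ℝ (Fin n))) η :=
    ⟨hpW.mul hζ, hζc.mul_left, subset_univ _⟩
  have hθt : IsTestFunction (univ : Set (EuclideanSpace ℝ (Fin n))) θ :=
    ⟨((hW.mul hpW).sub hjW).mul hζ, hζc.mul_left, subset_univ _⟩
  have hηd : ∀ x, fderiv ℝ η x = trans ε (W x) • fderiv ℝ ζ x +
      ζ x • deriv (trans ε) (W x) • fderiv ℝ W x := by
    intro x
    rw [hη, fderiv_fun_mul (hpW.differentiable (by simp) x) (hζd x),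
      fderiv_comp_real (hasDerivAt_trans _) (hWd x)]
  have hθd : ∀ x, fderiv ℝ θ x = (W x * trans ε (W x) - prim ε (W x)) • fderiv ℝ ζ x +
      ζ x • (W x * deriv (trans ε) (W x)) • fderiv ℝ W x := by
    intro x
    have h1 : HasDerivAt (fun s => s * trans ε s - prim ε s) (W x * deriv (trans ε) (W x)) (W x) := by
      have := ((hasDerivAt_id (W x)).mul (hasDerivAt_trans (ε := ε) (W x))).sub
        (hasDerivAt_prim (ε := ε) (W x))
      convert! this using 1
      simp
    have h2 : ContDiff ℝ ∞ fun x => W x * trans ε (W x) - prim ε (W x) := (hW.mul hpW).sub hjW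
    rw [hθ, fderiv_fun_mul (h2.differentiable (by simp) x) (hζd x), fderiv_comp_real h1 (hWd x)]
  have hcζ : Continuous (fderiv ℝ ζ) := hζ1.continuous_fderiv one_ne_zero
  have hcη : Continuous (fderiv ℝ η) := hηt.contDiff_one.continuous_fderiv one_ne_zero
  have hcθ : Continuous (fderiv ℝ θ) := hθt.contDiff_one.continuous_fderiv one_ne_zero
  have hpdW := fun i => (contDiff_pd (m := 0) hW1 (by norm_num) i).continuous
  have hpdζ := fun i => (contDiff_pd (m := 0) hζ1 (by norm_num) i).continuous
  set a := fun x => ζ x * deriv (trans ε) (W x) * ∑ i, pd i W x * pd i W x with ha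
  set b := fun x => ∑ i, pd i (fun y => prim ε (W y)) x * pd i ζ x with hb
  have hpdj : ∀ i x, pd i (fun y => prim ε (W y)) x = trans ε (W x) * pd i W x := by
    intro i x
    unfold pd
    rw [fderiv_comp_real (hasDerivAt_prim _) (hWd x)]
    simp
  have hai : Integrable a := by
    have : Continuous a := (hζ.continuous.mul (continuous_deriv_trans.comp hW.continuous)).mul
      (continuous_finsetSum _ fun i _ => (hpdW i).mul (hpdW i))
    exact this.integrable_of_hasCompactSupport hζc.mul_right.mul_right
  have hbi : Integrable b := by
    simp_rw [hb, hpdj]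
    exact integrable_finsetSum _ fun i _ =>
      ((hpW.continuous.mul (hpdW i)).mul (hpdζ i)).integrable_of_hasCompactSupport
        (hasCompactSupport_pd hζc i).mul_left
  have h3 : ∫ x, W x * Laplacian.laplacian η x = - ((∫ x, a x) + ∫ x, b x) := by
    rw [integral_mul_laplacian hW1 hηt.contDiff_two hηt.compact, ← integral_add hai hbi]
    congr 1
    refine integral_congr_ae (ae_of_all _ fun x => ?_)
    simp only [ha, hb, Finset.mul_sum, ← Finset.sum_add_distrib]
    refine Finset.sum_congr rfl fun i _ => ?_
    rw [hpdj]
    have : pd i η x = trans ε (W x) * pd i ζ x + ζ x * (deriv (trans ε) (W x) * pd i W x) := by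
      simp only [pd, hηd x]
      simp
    rw [this]
    ring
  have h4 : ∫ x, prim ε (W x) * Laplacian.laplacian ζ x = - ∫ x, b x :=
    integral_mul_laplacian (contDiff_infty.1 hjW 1) hζ2 hζc
  have h5 := heq η hηt hηs
  have h6 := hdiv θ hθt hθs
  have hi1 : Integrable fun x => prim ε (W x) * Laplacian.laplacian ζ x :=
    (hjW.continuous.mul (continuous_laplacian hζ2)).integrable_of_hasCompactSupport
      (hasCompactSupport_laplacian hζc).mul_left
  have hi2 : Integrable fun x => prim ε (W x) * fderiv ℝ ζ x (V x) := by
    have hT : Continuous fun x => prim ε (W x) • fderiv ℝ ζ x := hjW.continuous.smul hcζ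
    have hTc : HasCompactSupport fun x => prim ε (W x) • fderiv ℝ ζ x :=
      (hζc.fderiv ℝ).mono fun x hx h0 => hx (by simp only [h0, smul_zero])
    exact integrable_clm_apply hV hT hTc
  have hi3 : Integrable fun x => fderiv ℝ η x (H x) :=
    integrable_clm_apply hH hcη (hηt.compact.fderiv ℝ)
  have hi4 : Integrable fun x => fderiv ℝ θ x (V x) :=
    integrable_clm_apply hV hcθ (hθt.compact.fderiv ℝ)
  have hi5 : Integrable fun x => trans ε (W x) * g x * ζ x := by
    have := integrable_mul_of_continuous_of_hasCompactSupport hg hηt.smooth.continuous hηt.compact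
    refine this.congr (ae_of_all _ fun x => ?_)
    simp only [hη]
    ring
  have h7 : ∫ x, trans ε (W x) * g x * ζ x = ∫ x, g x * η x := by
    refine integral_congr_ae (ae_of_all _ fun x => ?_)
    simp only [hη]
    ring
  have h8 : ∫ x, prim ε (W x) * (- Laplacian.laplacian ζ x - fderiv ℝ ζ x (V x)) =
      (∫ x, b x) - ∫ x, prim ε (W x) * fderiv ℝ ζ x (V x) := by
    have : ∀ x, prim ε (W x) * (- Laplacian.laplacian ζ x - fderiv ℝ ζ x (V x)) =
        -(prim ε (W x) * Laplacian.laplacian ζ x) - prim ε (W x) * fderiv ℝ ζ x (V x) :=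
      fun x => by ring
    have hi1' : Integrable fun x => -(prim ε (W x) * Laplacian.laplacian ζ x) := hi1.neg
    simp_rw [this]
    rw [integral_sub hi1' hi2, integral_neg, h4, neg_neg]
  have h9 : (∫ x, fderiv ℝ η x (H x)) - (∫ x, a x) -
      (∫ x, prim ε (W x) * fderiv ℝ ζ x (V x)) - (∫ x, fderiv ℝ θ x (V x)) ≤
      C * D / 4 * (∫ x, ‖W x • V x - H x‖ ^ 2) + D * ∫ x, ‖W x • V x - H x‖ := by
    have hi6 : Integrable fun x => fderiv ℝ η x (H x) - a x := hi3.sub hai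
    have hi7 : Integrable fun x =>
        fderiv ℝ η x (H x) - a x - prim ε (W x) * fderiv ℝ ζ x (V x) := hi6.sub hi2
    rw [← integral_sub hi3 hai, ← integral_sub hi6 hi2,
      ← integral_sub hi7 hi4, ← integral_const_mul, ← integral_const_mul,
      ← integral_add (hc2.const_mul _) (hc1.const_mul _)]
    refine integral_mono (hi7.sub hi4) ((hc2.const_mul _).add (hc1.const_mul _)) fun x => ?_
    simp only
    set c := W x • V x - H x with hc
    have hHc : H x = W x • V x - c := by rw [hc]; abel
    -- After writing `H = WV - c` every term containing `V` cancels; only the commutator `c` and the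
    -- square of the gradient remain.
    have e1 : fderiv ℝ η x (H x) - a x - prim ε (W x) * fderiv ℝ ζ x (V x) - fderiv ℝ θ x (V x) =
        - (ζ x * deriv (trans ε) (W x)) * ((∑ i, pd i W x * pd i W x) + fderiv ℝ W x c) -
          trans ε (W x) * fderiv ℝ ζ x c := by
      rw [hηd, hθd, hHc]
      simp only [add_apply, smul_apply, smul_eq_mul, map_sub, map_smul, ha]
      ring
    rw [e1]
    have hk := mul_nonneg (hζ0 x) (deriv_trans_nonneg hε (W x))
    have hD : 0 ≤ D := (norm_nonneg _).trans (hζD x)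
    have hkD : ζ x * deriv (trans ε) (W x) ≤ C * D := by
      rw [mul_comm C D]
      exact mul_le_mul (hζC x) (hC _) (deriv_trans_nonneg hε _) hD
    have e2 := sum_pd_mul_pd_nonneg_bound W x c
    have e3 : |trans ε (W x) * fderiv ℝ ζ x c| ≤ D * ‖c‖ := by
      rw [abs_mul]
      calc |trans ε (W x)| * |fderiv ℝ ζ x c| ≤ 1 * (‖fderiv ℝ ζ x‖ * ‖c‖) :=
            mul_le_mul (abs_trans_le_one _) ((fderiv ℝ ζ x).le_opNorm c) (abs_nonneg _) zero_le_one
        _ ≤ D * ‖c‖ := by rw [one_mul]; gcongr; exact hζD x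
    have e4 : - (ζ x * deriv (trans ε) (W x)) *
        ((∑ i, pd i W x * pd i W x) + fderiv ℝ W x c) ≤ C * D / 4 * ‖c‖ ^ 2 := by
      nlinarith [mul_le_mul_of_nonneg_left e2 hk, sq_nonneg ‖c‖,
        mul_le_mul_of_nonneg_right hkD (sq_nonneg ‖c‖)]
    linarith [neg_abs_le (trans ε (W x) * fderiv ℝ ζ x c)]
  rw [h8, h7]
  linarith

end Bounded

/-! ### Removing the mollification for bounded solutions -/

section Bounded

variable {n : ℕ}

/-- Strong `L¹` convergence of one factor compensates for mere bounded a.e. convergence of the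
other. -/
theorem tendsto_integral_mul_of_tendsto_lintegral {α : Type*} [MeasurableSpace α] {μ : Measure α}
    {h : ℕ → α → ℝ} {h₀ : α → ℝ} (hh : ∀ k, Integrable (h k) μ) (hh₀ : Integrable h₀ μ)
    (hL : Tendsto (fun k => ∫⁻ x, ‖h k x - h₀ x‖ₑ ∂μ) atTop (𝓝 0))
    {φ : ℕ → α → ℝ} {φ₀ : α → ℝ} (hφ : ∀ k, AEStronglyMeasurable (φ k) μ) {C : ℝ}
    (hC : ∀ k x, |φ k x| ≤ C) (hae : ∀ᵐ x ∂μ, Tendsto (fun k => φ k x) atTop (𝓝 (φ₀ x))) :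
    Tendsto (fun k => ∫ x, φ k x * h k x ∂μ) atTop (𝓝 (∫ x, φ₀ x * h₀ x ∂μ)) := by
  have hi : ∀ k, Integrable (fun x => φ k x * h k x) μ := fun k =>
    (hh k).bdd_mul (hφ k) (ae_of_all _ (hC k))
  have hi₀ : ∀ k, Integrable (fun x => φ k x * h₀ x) μ := fun k =>
    hh₀.bdd_mul (hφ k) (ae_of_all _ (hC k))
  have h1 : Tendsto (fun k => ∫ x, φ k x * h₀ x ∂μ) atTop (𝓝 (∫ x, φ₀ x * h₀ x ∂μ)) := by
    refine tendsto_integral_of_dominated_convergence (fun x => C * ‖h₀ x‖)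
      (fun k => (hi₀ k).1) (hh₀.norm.const_mul C) (fun k => ae_of_all _ fun x => ?_) ?_
    · rw [norm_mul]
      gcongr
      exact hC k x
    · filter_upwards [hae] with x hx
      exact hx.mul_const _
  have h2 : Tendsto (fun k => (∫ x, φ k x * h k x ∂μ) - ∫ x, φ k x * h₀ x ∂μ) atTop (𝓝 0) := by
    rw [tendsto_zero_iff_enorm_tendsto_zero]
    have h3 := ENNReal.Tendsto.const_mul (a := ENNReal.ofReal C) hL (Or.inr ENNReal.ofReal_ne_top)
    rw [mul_zero] at h3
    refine tendsto_of_tendsto_of_tendsto_of_le_of_le tendsto_const_nhds h3 (fun _ => zero_le)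
      fun k => ?_
    rw [← integral_sub (hi k) (hi₀ k), ← lintegral_const_mul' _ _ ENNReal.ofReal_ne_top]
    refine (enorm_integral_le_lintegral_enorm _).trans (lintegral_mono fun x => ?_)
    rw [← mul_sub, enorm_mul]
    gcongr
    rw [← ofReal_norm]
    exact ENNReal.ofReal_le_ofReal (hC k x)
  simpa using h2.add h1

theorem tendsto_integral_norm_rpow_of_lintegral {α : Type*} [MeasurableSpace α] {μ : Measure α}
    {F : Type*} [NormedAddCommGroup F] {c : ℕ → α → F} (hc : ∀ k, AEStronglyMeasurable (c k) μ)
    {q : ℝ} (hq : 0 < q) (h : Tendsto (fun k => ∫⁻ x, ‖c k x‖ₑ ^ q ∂μ) atTop (𝓝 0)) :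
    (∀ᶠ k in atTop, Integrable (fun x => ‖c k x‖ ^ q) μ) ∧
      Tendsto (fun k => ∫ x, ‖c k x‖ ^ q ∂μ) atTop (𝓝 0) := by
  have he : ∀ k x, ‖c k x‖ₑ ^ q = ENNReal.ofReal (‖c k x‖ ^ q) := fun k x => by
    rw [← ofReal_norm, ENNReal.ofReal_rpow_of_nonneg (norm_nonneg _) hq.le]
  have hm : ∀ k, AEStronglyMeasurable (fun x => ‖c k x‖ ^ q) μ := fun k =>
    ((hc k).norm.aemeasurable.pow_const q).aestronglyMeasurable
  have hnn : ∀ k x, 0 ≤ ‖c k x‖ ^ q := fun k x => by positivity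
  constructor
  · filter_upwards [h.eventually_lt_const (zero_lt_one)] with k hk
    refine ⟨hm k, ?_⟩
    rw [hasFiniteIntegral_iff_ofReal (ae_of_all _ (hnn k))]
    simp_rw [← he]
    exact hk.trans ENNReal.one_lt_top
  · have h1 := (ENNReal.tendsto_toReal ENNReal.zero_ne_top).comp h
    rw [ENNReal.toReal_zero] at h1
    refine h1.congr fun k => ?_
    rw [Function.comp_apply, integral_eq_lintegral_of_nonneg_ae (ae_of_all _ (hnn k)) (hm k)]
    simp_rw [he]

/-- Kato's inequality for bounded solutions of the drift-diffusion equation. -/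
theorem kato_of_bounded {O : Set (EuclideanSpace ℝ (Fin n))} (hO : IsOpen O)
    {V : EuclideanSpace ℝ (Fin n) → EuclideanSpace ℝ (Fin n)} (hV1 : Integrable V)
    (hV2 : MemLp V 2) {w : EuclideanSpace ℝ (Fin n) → ℝ} (hw : Integrable w) {M : ℝ}
    (hM : ∀ x, |w x| ≤ M) {g : EuclideanSpace ℝ (Fin n) → ℝ} (hg : Integrable g)
    (hdiv : ∀ η, IsTestFunction O η → ∫ x, fderiv ℝ η x (V x) = 0)
    (heq : ∀ η, IsTestFunction O η → (∫ x, w x * Laplacian.laplacian η x) +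
      (∫ x, fderiv ℝ η x (w x • V x)) = - ∫ x, g x * η x)
    {ε : ℝ} (hε : 0 < ε) {ζ : EuclideanSpace ℝ (Fin n) → ℝ} (hζ : IsTestFunction O ζ)
    (hζ0 : ∀ x, 0 ≤ ζ x) :
    ∫ x, prim ε (w x) * (- Laplacian.laplacian ζ x - fderiv ℝ ζ x (V x)) ≤
      ∫ x, trans ε (w x) * g x * ζ x := by
  have hwV : Integrable fun y => w y • V y :=
    hV1.bdd_smul M hw.1 (ae_of_all _ hM)
  have hζ1 := hζ.contDiff_one
  have hcζ : Continuous (fderiv ℝ ζ) := hζ1.continuous_fderiv one_ne_zero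
  obtain ⟨C, hC0, hC⟩ := exists_deriv_trans_le hε
  obtain ⟨D₁, hD₁⟩ := hζ.compact.exists_bound_of_continuous hζ1.continuous
  obtain ⟨D₂, hD₂⟩ := (hζ.compact.fderiv ℝ).exists_bound_of_continuous hcζ
  set D := max D₁ D₂
  have hae := ae_tendsto_moll hw.locallyIntegrable
  set c := fun (k : ℕ) x => moll k w x • V x - moll k (fun y => w y • V y) x with hc
  have hcm : ∀ k, AEStronglyMeasurable (c k) := fun k =>
    ((contDiff_moll k hw.locallyIntegrable).continuous.aestronglyMeasurable.smul hV1.1).sub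
      (integrable_moll k hwV).1
  have hcq2 := tendsto_integral_norm_rpow_of_lintegral hcm (by norm_num)
    (tendsto_lintegral_commutator (q := 2) (by norm_num) (by simpa using hV2) hw hM)
  have hcq1 := tendsto_integral_norm_rpow_of_lintegral hcm zero_lt_one
    (tendsto_lintegral_commutator (q := 1) le_rfl (by simpa [memLp_one_iff_integrable]) hw hM)
  simp only [Real.rpow_one, Real.rpow_two] at hcq1 hcq2
  have hbase : Integrable fun x => - Laplacian.laplacian ζ x - fderiv ℝ ζ x (V x) :=
    ((continuous_laplacian hζ.contDiff_two).integrable_of_hasCompactSupport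
      (hasCompactSupport_laplacian hζ.compact)).neg.sub
      (integrable_clm_apply hV1 hcζ (hζ.compact.fderiv ℝ))
  have hlim1 : Tendsto (fun k => ∫ x, prim ε (moll k w x) *
      (- Laplacian.laplacian ζ x - fderiv ℝ ζ x (V x))) atTop
      (𝓝 (∫ x, prim ε (w x) * (- Laplacian.laplacian ζ x - fderiv ℝ ζ x (V x)))) := by
    refine tendsto_integral_mul_of_tendsto_lintegral (C := M) (fun _ => hbase) hbase (by simp)
      (fun k => ?_) (fun k x => ?_) ?_
    · exact (continuous_prim.comp
        (contDiff_moll k hw.locallyIntegrable).continuous).aestronglyMeasurable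
    · refine (abs_prim_le _).trans ?_
      rw [← Real.norm_eq_abs]
      exact norm_moll_le hM x
    · filter_upwards [hae] with x hx
      exact (continuous_prim.tendsto _).comp hx
  have hlim2 : Tendsto (fun k => ∫ x, trans ε (moll k w x) * moll k g x * ζ x) atTop
      (𝓝 (∫ x, trans ε (w x) * g x * ζ x)) := by
    have hbd : ∀ k x, |trans ε (moll k w x) * ζ x| ≤ D := by
      intro k x
      rw [abs_mul]
      calc |trans ε (moll k w x)| * |ζ x| ≤ 1 * D₁ :=
            mul_le_mul (abs_trans_le_one _) (hD₁ x) (abs_nonneg _) zero_le_one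
        _ ≤ D := by rw [one_mul]; exact le_max_left _ _
    have := tendsto_integral_mul_of_tendsto_lintegral
      (φ := fun k x => trans ε (moll k w x) * ζ x) (φ₀ := fun x => trans ε (w x) * ζ x)
      (fun k => integrable_moll k hg) hg (tendsto_lintegral_moll_sub hg) (fun k => ?_) hbd ?_
    · simpa only [mul_right_comm] using this
    · exact ((continuous_trans.comp (contDiff_moll k hw.locallyIntegrable).continuous).mul
        hζ1.continuous).aestronglyMeasurable
    · filter_upwards [hae] with x hx
      exact ((continuous_trans.tendsto _).comp hx).mul_const _
  have hlim3 : Tendsto (fun k => (∫ x, trans ε (moll k w x) * moll k g x * ζ x) +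
      (C * D / 4 * (∫ x, ‖c k x‖ ^ 2) + D * ∫ x, ‖c k x‖)) atTop
      (𝓝 (∫ x, trans ε (w x) * g x * ζ x)) := by
    have := hlim2.add ((hcq2.2.const_mul (C * D / 4)).add (hcq1.2.const_mul D))
    simpa using this
  refine le_of_tendsto_of_tendsto hlim1 hlim3 ?_
  -- The mollified equation tested with `η` is the original one tested with `moll k η`, so `k` must
  -- be large enough to keep the enlarged support inside `O`.
  filter_upwards [hcq1.1, hcq2.1, eventually_cthickening_subset hζ.compact.isCompact hO hζ.supp]
    with k hk1 hk2 hk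
  have hηO : ∀ {η : EuclideanSpace ℝ (Fin n) → ℝ},
      IsTestFunction (univ : Set (EuclideanSpace ℝ (Fin n))) η →
      tsupport η ⊆ tsupport ζ → IsTestFunction O (moll k η) := fun hη hs =>
    hη.moll ((Metric.cthickening_subset_of_subset _ hs).trans hk)
  refine energy_inequality hε (contDiff_moll k hw.locallyIntegrable) hζ.smooth hζ.compact hζ0 hV1
    (integrable_moll k hwV) (integrable_moll k hg) hk2 hk1 ?_ ?_ hC
    (fun x => (le_abs_self _).trans ((hD₁ x).trans (le_max_left _ _)))
    (fun x => (hD₂ x).trans (le_max_right _ _))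
  · exact fun η hη hs => hdiv η ⟨hη.smooth, hη.compact, hs.trans hζ.supp⟩
  · intro η hη hs
    have h1 := heq _ (hηO hη hs)
    rw [laplacian_moll hη.contDiff_two hη.compact] at h1
    rw [integral_moll_mul hw (continuous_laplacian hη.contDiff_two)
      (hasCompactSupport_laplacian hη.compact), integral_fderiv_moll hwV hη.contDiff_one hη.compact,
      h1, integral_moll_mul hg hη.smooth.continuous hη.compact]

end Bounded

/-! ### Local Kato inequality -/

section PotentialEstimates

variable {n : ℕ}

theorem ae_enorm_pot_sub_le (hn : 2 ≤ n)
    {h₁ h₂ : EuclideanSpace ℝ (Fin n) → EuclideanSpace ℝ (Fin n)} (hh₁ : Integrable h₁)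
    (hh₂ : Integrable h₂) :
    ∀ᵐ x, ‖pot h₁ x - pot h₂ x‖ₑ ≤ ‖(cK n)⁻¹‖ₑ * rieszPot (fun y => h₁ y - h₂ y) x := by
  filter_upwards [ae_rieszPot_ne_top hn hh₁, ae_rieszPot_ne_top hn hh₂] with x hx₁ hx₂
  rw [← pot_sub hh₁.1 hh₂.1 hx₁ hx₂]
  exact enorm_pot_le _ x

theorem exists_setLIntegral_pot_sub_le (hn : 2 ≤ n) {A : Set (EuclideanSpace ℝ (Fin n))}
    (hA : MeasurableSet A) (hAfin : volume A ≠ ⊤) : ∃ c : ℝ≥0∞, c ≠ ⊤ ∧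
    ∀ h₁ h₂ : EuclideanSpace ℝ (Fin n) → EuclideanSpace ℝ (Fin n), Integrable h₁ →
      Integrable h₂ → ∫⁻ x in A, ‖pot h₁ x - pot h₂ x‖ₑ ≤ c * ∫⁻ y, ‖h₁ y - h₂ y‖ₑ := by
  obtain ⟨c, hc, hcA⟩ := exists_setLIntegral_rieszPot_le hn hA hAfin
  refine ⟨‖(cK n)⁻¹‖ₑ * c, ENNReal.mul_ne_top enorm_ne_top hc, fun h₁ h₂ hh₁ hh₂ => ?_⟩
  calc ∫⁻ x in A, ‖pot h₁ x - pot h₂ x‖ₑ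
      ≤ ∫⁻ x in A, ‖(cK n)⁻¹‖ₑ * rieszPot (fun y => h₁ y - h₂ y) x :=
        lintegral_mono_ae (ae_restrict_of_ae (ae_enorm_pot_sub_le hn hh₁ hh₂))
    _ = ‖(cK n)⁻¹‖ₑ * ∫⁻ x in A, rieszPot (fun y => h₁ y - h₂ y) x :=
        lintegral_const_mul' _ _ enorm_ne_top
    _ ≤ _ := by
        rw [mul_assoc]
        gcongr
        exact hcA _ (hh₁.1.sub hh₂.1)

/-- The dual of the sup-norm contraction: the same factor `1/2` bounds `pot` from `L¹` to
`L¹(|V|dx)`. -/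
theorem lintegral_enorm_mul_pot_sub_le (hn : 2 ≤ n)
    {V : EuclideanSpace ℝ (Fin n) → EuclideanSpace ℝ (Fin n)} (hV : AEStronglyMeasurable V)
    (hθ : ∀ x, ‖(cK n)⁻¹‖ₑ * rieszPot V x ≤ ENNReal.ofReal (1 / 2))
    {h₁ h₂ : EuclideanSpace ℝ (Fin n) → EuclideanSpace ℝ (Fin n)} (hh₁ : Integrable h₁)
    (hh₂ : Integrable h₂) :
    ∫⁻ x, ‖pot h₁ x - pot h₂ x‖ₑ * ‖V x‖ₑ ≤
      ENNReal.ofReal (1 / 2) * ∫⁻ y, ‖h₁ y - h₂ y‖ₑ := by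
  calc ∫⁻ x, ‖pot h₁ x - pot h₂ x‖ₑ * ‖V x‖ₑ
      ≤ ∫⁻ x, (‖(cK n)⁻¹‖ₑ * ‖V x‖ₑ) * rieszPot (fun y => h₁ y - h₂ y) x := by
        refine lintegral_mono_ae ?_
        filter_upwards [ae_enorm_pot_sub_le hn hh₁ hh₂] with x hx
        calc ‖pot h₁ x - pot h₂ x‖ₑ * ‖V x‖ₑ
            ≤ ‖(cK n)⁻¹‖ₑ * rieszPot (fun y => h₁ y - h₂ y) x * ‖V x‖ₑ := by gcongr
          _ = _ := by ring
    _ ≤ _ := by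
        refine lintegral_mul_rieszPot_le (hh₁.1.sub hh₂.1) (hV.enorm.const_mul _) fun y => ?_
        refine le_trans (le_of_eq ?_) (hθ y)
        rw [rieszPot, ← lintegral_const_mul' _ _ enorm_ne_top]
        exact lintegral_congr fun x => by ring

/-- Within distance `1` of `x` the kernel is integrable and `h` bounded; farther away the kernel is
at most `1` and `h` integrable. -/
theorem exists_abs_pot_le (hn : 2 ≤ n)
    {h : EuclideanSpace ℝ (Fin n) → EuclideanSpace ℝ (Fin n)} (hh : Integrable h) {C : ℝ}
    (hC : ∀ x, ‖h x‖ ≤ C) : ∃ M, ∀ x, |pot h x| ≤ M := by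
  obtain ⟨c, hc, hcA⟩ := exists_lintegral_rieszK_le hn
  set B := ‖(cK n)⁻¹‖ₑ * (c * volume (Metric.ball (0 : EuclideanSpace ℝ (Fin n)) 1) ^ (1 / (n : ℝ)) *
    ENNReal.ofReal C + ∫⁻ y, ‖h y‖ₑ) with hB
  have hBfin : B ≠ ⊤ := by
    have h1 : volume (Metric.ball (0 : EuclideanSpace ℝ (Fin n)) 1) ^ (1 / (n : ℝ)) ≠ ⊤ :=
      ENNReal.rpow_ne_top_of_nonneg (by positivity) Metric.isBounded_ball.measure_lt_top.ne
    have h2 : ∫⁻ y, ‖h y‖ₑ ≠ ⊤ := hh.2.ne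
    finiteness
  refine ⟨B.toReal, fun x => ?_⟩
  have hpt : rieszPot h x ≤ c * volume (Metric.ball (0 : EuclideanSpace ℝ (Fin n)) 1) ^
      (1 / (n : ℝ)) * ENNReal.ofReal C + ∫⁻ y, ‖h y‖ₑ := by
    rw [rieszPot, ← lintegral_add_compl _ (Metric.isOpen_ball.measurableSet :
      MeasurableSet (Metric.ball x 1))]
    refine add_le_add ?_ ?_
    · calc ∫⁻ y in Metric.ball x 1, ‖rieszK (x - y)‖ₑ * ‖h y‖ₑ
          ≤ ∫⁻ y in Metric.ball x 1, ‖rieszK (x - y)‖ₑ * ENNReal.ofReal C := by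
            refine lintegral_mono fun y => mul_le_mul' le_rfl ?_
            rw [← ofReal_norm]
            exact ENNReal.ofReal_le_ofReal (hC y)
        _ = (∫⁻ y in Metric.ball x 1, ‖rieszK (x - y)‖ₑ) * ENNReal.ofReal C :=
            lintegral_mul_const' _ _ ENNReal.ofReal_ne_top
        _ ≤ _ := by
            gcongr
            refine (hcA x _ Metric.isOpen_ball.measurableSet).trans (le_of_eq ?_)
            rw [Measure.addHaar_ball_center]
    · refine (setLIntegral_mono' (g := fun y => ‖h y‖ₑ)
        Metric.isOpen_ball.measurableSet.compl fun y hy => ?_).trans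
        (setLIntegral_le_lintegral _ _)
      have h1 : 1 ≤ ‖x - y‖ := by
        rw [mem_compl_iff, Metric.mem_ball, not_lt, dist_comm, dist_eq_norm] at hy
        exact hy
      have h2 : ‖rieszK (x - y)‖ₑ ≤ 1 := by
        rw [← ofReal_norm, norm_rieszK hn]
        exact ENNReal.ofReal_le_one.2 (inv_le_one_of_one_le₀ (one_le_pow₀ h1))
      simpa using mul_le_mul' h2 (le_refl ‖h y‖ₑ)
  have h3 : ‖pot h x‖ₑ ≤ B := (enorm_pot_le h x).trans (by rw [hB]; gcongr)
  have h4 := ENNReal.toReal_mono hBfin h3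
  rwa [toReal_enorm, Real.norm_eq_abs] at h4

theorem exists_norm_moll_le {F : Type*} [NormedAddCommGroup F] [NormedSpace ℝ F] [CompleteSpace F]
    (k : ℕ) {h : EuclideanSpace ℝ (Fin n) → F} (hh : Integrable h) :
    ∃ C, ∀ x, ‖moll k h x‖ ≤ C := by
  obtain ⟨R, hR⟩ := (hasCompactSupport_rho (n := n) k).exists_bound_of_continuous (continuous_rho k)
  refine ⟨∫ y, R * ‖h y‖, fun x => ?_⟩
  rw [moll_eq_swap]
  refine norm_integral_le_of_norm_le (hh.norm.const_mul R) (ae_of_all _ fun y => ?_)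
  rw [norm_smul]
  gcongr
  exact hR _

theorem isTestFunction_rho_sub (k : ℕ) (x : EuclideanSpace ℝ (Fin n)) :
    IsTestFunction univ fun y => rho k (x - y) :=
  ⟨(contDiff_rho k).comp (contDiff_const.sub contDiff_id),
    (hasCompactSupport_rho k).comp_homeomorph (Homeomorph.subLeft x), subset_univ _⟩

/-- A compactly supported Sobolev function is the potential of its gradient. -/
theorem ae_eq_pot_of_weakGradient (hn : 2 ≤ n) {v : EuclideanSpace ℝ (Fin n) → ℝ}
    (hv : Integrable v) (hvc : HasCompactSupport v)
    {Dv : EuclideanSpace ℝ (Fin n) → EuclideanSpace ℝ (Fin n)} (hDv : Integrable Dv)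
    (hweak : HasWeakGradient univ v Dv) : v =ᵐ[volume] pot Dv := by
  -- The weak gradient is tested with `y ↦ rho k (x - y)`.
  have hgrad : ∀ k, gradient (moll k v) = moll k Dv := by
    intro k
    funext x
    ext i
    rw [gradient_apply, pd_moll_of_locallyIntegrable hv.locallyIntegrable]
    have h1 := hweak _ (isTestFunction_rho_sub k x) i
    simp only [Measure.restrict_univ] at h1
    rw [← moll_apply k hDv.locallyIntegrable, moll_eq_swap]
    unfold pd
    rw [h1, neg_neg]
    exact integral_congr_ae (ae_of_all _ fun y => by simp [mul_comm])
  have hpot : ∀ k x, pot (moll k Dv) x = moll k v x := by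
    intro k x
    rw [← hgrad]
    exact pot_gradient hn (contDiff_infty.1 (contDiff_moll k hv.locallyIntegrable) 1)
      (hasCompactSupport_moll k hvc) x
  have h1 : ∀ N : ℕ, ∀ᵐ x, x ∈ Metric.ball (0 : EuclideanSpace ℝ (Fin n)) N → v x = pot Dv x := by
    intro N
    set A := Metric.ball (0 : EuclideanSpace ℝ (Fin n)) N
    have hA : MeasurableSet A := Metric.isOpen_ball.measurableSet
    obtain ⟨c, hc, hcA⟩ := exists_setLIntegral_pot_sub_le hn (A := A) hA
      Metric.isBounded_ball.measure_lt_top.ne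
    -- The mollified function is recovered exactly from its gradient by `pot_gradient`; both errors
    -- vanish because `pot` is bounded from `L¹` into `L¹(A)`.
    have hle : ∀ k, ∫⁻ x in A, ‖v x - pot Dv x‖ₑ ≤ (∫⁻ x, ‖moll k v x - v x‖ₑ) +
        c * ∫⁻ x, ‖moll k Dv x - Dv x‖ₑ := by
      intro k
      refine le_trans ?_ (add_le_add (setLIntegral_le_lintegral A _)
        (hcA _ _ (integrable_moll k hDv) hDv))
      have hm1 : AEMeasurable (fun x => ‖moll k v x - v x‖ₑ) (volume.restrict A) :=
        ((integrable_moll k hv).1.sub hv.1).enorm.restrict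
      rw [← lintegral_add_left' hm1]
      refine lintegral_mono fun x => ?_
      simp only [hpot]
      rw [← enorm_neg (moll k v x - v x)]
      refine le_trans (le_of_eq ?_) (enorm_add_le _ _)
      congr 1
      abel
    have hlim : Tendsto (fun k => (∫⁻ x, ‖moll k v x - v x‖ₑ) +
        c * ∫⁻ x, ‖moll k Dv x - Dv x‖ₑ) atTop (𝓝 0) := by
      have := (tendsto_lintegral_moll_sub hv).add
        (ENNReal.Tendsto.const_mul (a := c) (tendsto_lintegral_moll_sub hDv) (Or.inr hc))
      simpa using this
    have hzero : ∫⁻ x in A, ‖v x - pot Dv x‖ₑ = 0 :=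
      le_antisymm (ge_of_tendsto hlim (Eventually.of_forall hle)) zero_le
    have hm2 : AEMeasurable (fun x => ‖v x - pot Dv x‖ₑ) (volume.restrict A) :=
      (hv.1.sub (aestronglyMeasurable_pot hDv.1)).enorm.restrict
    rw [lintegral_eq_zero_iff' hm2] at hzero
    rw [← ae_restrict_iff' hA]
    filter_upwards [hzero] with x hx
    simpa [sub_eq_zero] using hx
  filter_upwards [ae_all_iff.2 h1] with x hx
  obtain ⟨N, hN⟩ := exists_nat_gt ‖x‖
  exact hx N (mem_ball_zero_iff.2 hN)

end PotentialEstimates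

/-! ### Approximation by bounded solutions -/

section LocalSmooth

variable {n : ℕ} {V : EuclideanSpace ℝ (Fin n) → EuclideanSpace ℝ (Fin n)}

theorem integrable_bounded_smul (hV : Integrable V) {w : EuclideanSpace ℝ (Fin n) → ℝ}
    (hw : AEStronglyMeasurable w) {M : ℝ} (hM : ∀ x, |w x| ≤ M) :
    Integrable fun x => w x • V x :=
  hV.bdd_smul M hw (ae_of_all _ hM)

/-- Bounded solutions of `w = P h + P (w V)` approximate solutions with integrable data. -/
theorem exists_bounded_approx (hn : 2 ≤ n) (hV : Integrable V)
    (hθ : ∀ x, ‖(cK n)⁻¹‖ₑ * rieszPot V x ≤ ENNReal.ofReal (1 / 2))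
    {v : EuclideanSpace ℝ (Fin n) → ℝ}
    {Dv : EuclideanSpace ℝ (Fin n) → EuclideanSpace ℝ (Fin n)} (hDv : Integrable Dv)
    (hv : v =ᵐ[volume] pot Dv) (hvV : Integrable fun x => v x • V x)
    {h : EuclideanSpace ℝ (Fin n) → EuclideanSpace ℝ (Fin n)} (hh : Integrable h) {C : ℝ}
    (hC : ∀ x, ‖h x‖ ≤ C) :
    ∃ w : EuclideanSpace ℝ (Fin n) → ℝ, AEStronglyMeasurable w ∧ (∃ M, ∀ x, |w x| ≤ M) ∧
      (w =ᵐ[volume] pot fun y => h y + w y • V y) ∧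
      (∫⁻ x, ‖w x - v x‖ₑ * ‖V x‖ₑ ≤ ∫⁻ x, ‖Dv x - (h x + w x • V x)‖ₑ) ∧
      ∫⁻ x, ‖Dv x - (h x + w x • V x)‖ₑ ≤ 2 * ∫⁻ x, ‖(Dv x - v x • V x) - h x‖ₑ := by
  obtain ⟨M, hM⟩ := exists_abs_pot_le hn hh hC
  obtain ⟨w, hwm, hwM, hw⟩ := exists_bounded_fixedPoint hn hV.1 hθ
    (aestronglyMeasurable_pot hh.1) hM
  have hwV : Integrable fun x => w x • V x := integrable_bounded_smul hV hwm hwM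
  have hs : Integrable fun x => h x + w x • V x := hh.add hwV
  have hwp : w =ᵐ[volume] pot fun y => h y + w y • V y := by
    filter_upwards [ae_rieszPot_ne_top hn hs, ae_rieszPot_ne_top hn hwV] with x hx₁ hx₂
    have := pot_sub hs.1 hwV.1 hx₁ hx₂
    simp only [add_sub_cancel_right] at this
    rw [hw x, this]
    ring
  refine ⟨w, hwm, ⟨_, hwM⟩, hwp, ?_⟩
  set X := ∫⁻ x, ‖v x - w x‖ₑ * ‖V x‖ₑ with hX
  set D := ∫⁻ x, ‖(Dv x - v x • V x) - h x‖ₑ with hD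
  set S := ∫⁻ x, ‖Dv x - (h x + w x • V x)‖ₑ with hS
  -- Almost everywhere `v - w = pot Dv - pot (h + wV)`, so the dual contraction gains a factor
  -- `1/2`.
  have h1 : X ≤ ENNReal.ofReal (1 / 2) * S := by
    refine le_trans (le_of_eq (lintegral_congr_ae ?_))
      (lintegral_enorm_mul_pot_sub_le hn hV.1 hθ hDv hs)
    filter_upwards [hv, hwp] with x h1 h2
    rw [h1, ← h2]
  -- Triangle inequality for `Dv - h - wV = (Dv - vV - h) + (v - w)V`.
  have h2 : S ≤ D + X := by
    have hm : AEMeasurable (fun x => ‖(Dv x - v x • V x) - h x‖ₑ) :=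
      ((hDv.sub hvV).sub hh).1.enorm
    rw [hD, hX, ← lintegral_add_left' hm]
    refine lintegral_mono fun x => ?_
    rw [← enorm_smul]
    refine le_trans (le_of_eq ?_) (enorm_add_le _ _)
    rw [sub_smul]
    congr 1
    abel
  have h5 : ∫⁻ x, ‖w x - v x‖ₑ * ‖V x‖ₑ ≤ S := by
    simp_rw [enorm_sub_rev (w _)]
    refine h1.trans ((mul_le_mul' (ENNReal.ofReal_le_one.2 (by norm_num)) le_rfl).trans ?_)
    rw [one_mul]
  refine ⟨h5, ?_⟩
  -- Finiteness of `S` permits absorption: `S ≤ D + S/2` gives `S ≤ 2D`.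
  have hSfin : S ≠ ⊤ := (hDv.sub hs).2.ne
  have hXfin : X ≠ ⊤ := ne_top_of_le_ne_top (by finiteness) h1
  by_cases hDfin : D = ⊤
  · rw [hDfin]
    simp
  have h3 : S.toReal ≤ D.toReal + X.toReal := by
    rw [← ENNReal.toReal_add hDfin hXfin]
    exact ENNReal.toReal_mono (by finiteness) h2
  have h4 : X.toReal ≤ 1 / 2 * S.toReal := by
    have := ENNReal.toReal_mono (by finiteness) h1
    rwa [ENNReal.toReal_mul, ENNReal.toReal_ofReal (by norm_num)] at this
  rw [← ENNReal.toReal_le_toReal hSfin (by finiteness), ENNReal.toReal_mul]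
  simp only [ENNReal.toReal_ofNat]
  linarith

/-- The integral equation implies the differential one, through the weak form of `Δ (pot h) = div
h`. -/
theorem integral_fixedPoint_equation (hn : 2 ≤ n) (hV : Integrable V)
    {h : EuclideanSpace ℝ (Fin n) → EuclideanSpace ℝ (Fin n)} (hh : Integrable h)
    {w : EuclideanSpace ℝ (Fin n) → ℝ} (hwm : AEStronglyMeasurable w) {M : ℝ}
    (hM : ∀ x, |w x| ≤ M) (hw : w =ᵐ[volume] pot fun y => h y + w y • V y)
    {η : EuclideanSpace ℝ (Fin n) → ℝ} (hη : ContDiff ℝ 2 η) (hηc : HasCompactSupport η) :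
    (∫ x, w x * Laplacian.laplacian η x) + (∫ x, fderiv ℝ η x (w x • V x)) =
      - ∫ x, fderiv ℝ η x (h x) := by
  have hwV : Integrable fun x => w x • V x := integrable_bounded_smul hV hwm hM
  have h1 : ∫ x, w x * Laplacian.laplacian η x =
      - ∫ x, fderiv ℝ η x (h x + w x • V x) := by
    refine Eq.trans (integral_congr_ae ?_)
      (integral_pot_mul_laplacian (h := fun y => h y + w y • V y) hn (hh.add hwV) hη hηc)
    filter_upwards [hw] with x hx
    rw [hx]
  have hc : Continuous (fderiv ℝ η) := hη.continuous_fderiv (by norm_num)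
  have hs : HasCompactSupport (fderiv ℝ η) := hηc.fderiv ℝ
  simp_rw [map_add] at h1
  rw [h1, integral_add (integrable_clm_apply hh hc hs) (integrable_clm_apply hwV hc hs)]
  ring

/-- The unbounded `v` is approximated by bounded solutions driven by mollifications of the field `Dv
- vV`. As this field pairs with `∇η` to give `∫ f η`, the approximations solve the same equation
with `f` mollified, so `kato_of_bounded` applies to them and the inequality passes to the limit. -/
theorem kato_local_smooth (hn : 2 ≤ n) {O : Set (EuclideanSpace ℝ (Fin n))} (hO : IsOpen O)
    (hV : Integrable V) (hV2 : MemLp V 2)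
    (hθ : ∀ x, ‖(cK n)⁻¹‖ₑ * rieszPot V x ≤ ENNReal.ofReal (1 / 2))
    {v : EuclideanSpace ℝ (Fin n) → ℝ} (hv : Integrable v) (hvc : HasCompactSupport v)
    {Dv : EuclideanSpace ℝ (Fin n) → EuclideanSpace ℝ (Fin n)} (hDv : Integrable Dv)
    (hweak : HasWeakGradient univ v Dv) (hvV : Integrable fun x => v x • V x)
    {f : EuclideanSpace ℝ (Fin n) → ℝ} (hf : Integrable f)
    (hdiv : ∀ η, IsTestFunction O η → ∫ x, fderiv ℝ η x (V x) = 0)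
    (heq : ∀ η, IsTestFunction O η → ∫ x, fderiv ℝ η x (Dv x - v x • V x) = ∫ x, f x * η x)
    {ε : ℝ} (hε : 0 < ε) {ζ : EuclideanSpace ℝ (Fin n) → ℝ} (hζ : IsTestFunction O ζ)
    (hζ0 : ∀ x, 0 ≤ ζ x) :
    ∫ x, prim ε (v x) * (- Laplacian.laplacian ζ x - fderiv ℝ ζ x (V x)) ≤
      ∫ x, trans ε (v x) * f x * ζ x := by
  have hvp : v =ᵐ[volume] pot Dv := ae_eq_pot_of_weakGradient hn hv hvc hDv hweak
  set H : EuclideanSpace ℝ (Fin n) → EuclideanSpace ℝ (Fin n) :=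
    fun x => Dv x - v x • V x with hHdef
  have hH : Integrable H := hDv.sub hvV
  -- The intermediate set `A` leaves room: test functions supported in `A` stay supported in `O`
  -- after mollification.
  obtain ⟨A, hAo, hζA, hAO, hAc⟩ := exists_open_between_and_isCompact_closure hζ.compact hO hζ.supp
  have hAm := hAo.measurableSet
  have hAfin : volume A ≠ ⊤ :=
    ((measure_mono subset_closure).trans_lt hAc.measure_lt_top).ne
  have hex : ∀ k, _ := fun k => (exists_norm_moll_le k hH).elim fun C hC =>
    exists_bounded_approx hn hV hθ hDv hvp hvV (integrable_moll k hH) hC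
  choose w hwm hwM hwp hwX hwS using hex
  choose M hwM using hwM
  set D : ℕ → ℝ≥0∞ := fun k => ∫⁻ x, ‖moll k H x - H x‖ₑ with hD
  have hDlim : Tendsto D atTop (𝓝 0) := tendsto_lintegral_moll_sub hH
  have hS : ∀ k, ∫⁻ x, ‖Dv x - (moll k H x + w k x • V x)‖ₑ ≤ 2 * D k := by
    intro k
    refine (hwS k).trans (le_of_eq ?_)
    simp_rw [hD, enorm_sub_rev (moll k H _)]
    rfl
  have hX : ∀ k, ∫⁻ x, ‖w k x - v x‖ₑ * ‖V x‖ₑ ≤ 2 * D k := fun k => (hwX k).trans (hS k)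
  obtain ⟨c, hc, hcA⟩ := exists_setLIntegral_pot_sub_le hn hAm hAfin
  have hY : ∀ k, ∫⁻ x in A, ‖w k x - v x‖ₑ ≤ c * (2 * D k) := by
    intro k
    refine le_trans (le_of_eq (lintegral_congr_ae ?_)) ((hcA _ _ hDv ((integrable_moll k hH).add
      (integrable_bounded_smul hV (hwm k) (hwM k)))).trans (mul_le_mul' le_rfl (hS k)))
    filter_upwards [ae_restrict_of_ae hvp, ae_restrict_of_ae (hwp k)] with x h1 h2
    rw [h1, h2, enorm_sub_rev]
    rfl
  have h2D : Tendsto (fun k => 2 * D k) atTop (𝓝 0) := by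
    simpa using ENNReal.Tendsto.const_mul (a := 2) hDlim (Or.inr (by norm_num))
  have hYlim : Tendsto (fun k => ∫⁻ x in A, ‖w k x - v x‖ₑ) atTop (𝓝 0) := by
    refine tendsto_of_tendsto_of_tendsto_of_le_of_le tendsto_const_nhds ?_ (fun _ => zero_le) hY
    simpa using ENNReal.Tendsto.const_mul (a := c) h2D (Or.inr hc)
  have hXlim : Tendsto (fun k => ∫⁻ x, ‖w k x - v x‖ₑ * ‖V x‖ₑ) atTop (𝓝 0) :=
    tendsto_of_tendsto_of_tendsto_of_le_of_le tendsto_const_nhds h2D (fun _ => zero_le) hX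
  have hDζ : Continuous (fderiv ℝ ζ) := hζ.contDiff_two.continuous_fderiv (by norm_num)
  have hDζc : HasCompactSupport (fderiv ℝ ζ) := hζ.compact.fderiv ℝ
  have hLζ : Continuous (Laplacian.laplacian ζ) := continuous_laplacian hζ.contDiff_two
  have hLζc : HasCompactSupport (Laplacian.laplacian ζ) := hasCompactSupport_laplacian hζ.compact
  have hkato : ∀ᶠ k in atTop,
      ∫ x, prim ε (w k x) * (- Laplacian.laplacian ζ x - fderiv ℝ ζ x (V x)) ≤
        ∫ x, trans ε (w k x) * moll k f x * ζ x := by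
    filter_upwards [eventually_cthickening_subset hAc hO hAO] with k hk
    have hmoll : ∀ η, IsTestFunction A η → IsTestFunction O (moll k η) := fun η hη =>
      hη.moll ((Metric.cthickening_subset_of_subset _ (hη.supp.trans subset_closure)).trans hk)
    have hind : ∀ η : EuclideanSpace ℝ (Fin n) → ℝ, IsTestFunction A η → ∀ x,
        A.indicator (w k) x ≠ w k x → x ∉ tsupport η := fun η hη x hx hxη =>
      hx (indicator_of_mem (hη.supp hxη) _)
    -- The approximations are bounded but need not be integrable over the whole space. Truncation to
    -- `A` makes them so and changes no integral against a function supported in `A`.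
    have key := kato_of_bounded hAo hV hV2 (w := A.indicator (w k)) (M := M k)
      (g := moll k f) ?_ ?_ (integrable_moll k hf)
      (fun η hη => hdiv η (hη.mono (subset_closure.trans hAO))) ?_ hε
      ⟨hζ.smooth, hζ.compact, hζA⟩ hζ0
    · refine le_trans (le_of_eq (integral_congr_ae (ae_of_all _ fun x => ?_)))
        (key.trans (le_of_eq (integral_congr_ae (ae_of_all _ fun x => ?_))))
      · by_cases hx : A.indicator (w k) x = w k x
        · simp only [hx]
        · have := hind ζ ⟨hζ.smooth, hζ.compact, hζA⟩ x hx
          simp [laplacian_eq_zero_of_notMem_tsupport this, fderiv_eq_zero_of_notMem_tsupport this]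
      · by_cases hx : A.indicator (w k) x = w k x
        · simp only [hx]
        · have := hind ζ ⟨hζ.smooth, hζ.compact, hζA⟩ x hx
          simp [image_eq_zero_of_notMem_tsupport this]
    · rw [integrable_indicator_iff hAm]
      exact Measure.integrableOn_of_bounded hAfin (hwm k) (ae_of_all _ (hwM k))
    · intro x
      by_cases hx : x ∈ A
      · rw [indicator_of_mem hx]
        exact hwM k x
      · rw [indicator_of_notMem hx, abs_zero]
        exact (abs_nonneg _).trans (hwM k x)
    · intro η hη
      have h1 := integral_fixedPoint_equation hn hV (integrable_moll k hH) (hwm k) (hwM k) (hwp k)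
        hη.contDiff_two hη.compact
      rw [integral_fderiv_moll hH hη.contDiff_one hη.compact, heq _ (hmoll η hη),
        ← integral_moll_mul hf hη.smooth.continuous hη.compact] at h1
      rw [← h1]
      congr 1
      · refine integral_congr_ae (ae_of_all _ fun x => ?_)
        by_cases hx : A.indicator (w k) x = w k x
        · simp only [hx]
        · simp [laplacian_eq_zero_of_notMem_tsupport (hind η hη x hx)]
      · refine integral_congr_ae (ae_of_all _ fun x => ?_)
        by_cases hx : A.indicator (w k) x = w k x
        · simp only [hx]
        · simp [fderiv_eq_zero_of_notMem_tsupport (hind η hη x hx)]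
  have hlimL : Tendsto (fun k => ∫ x, prim ε (w k x) *
      (- Laplacian.laplacian ζ x - fderiv ℝ ζ x (V x))) atTop
      (𝓝 (∫ x, prim ε (v x) * (- Laplacian.laplacian ζ x - fderiv ℝ ζ x (V x)))) := by
    have hLint : Integrable (Laplacian.laplacian ζ) := hLζ.integrable_of_hasCompactSupport hLζc
    have hF : Integrable fun x => - Laplacian.laplacian ζ x - fderiv ℝ ζ x (V x) :=
      hLint.neg.sub (integrable_clm_apply hV hDζ hDζc)
    have hpm : AEStronglyMeasurable fun x => prim ε (v x) :=
      continuous_prim.comp_aestronglyMeasurable hv.1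
    have hFv : Integrable fun x => prim ε (v x) *
        (- Laplacian.laplacian ζ x - fderiv ℝ ζ x (V x)) := by
      refine ((integrable_mul_of_continuous_of_hasCompactSupport hv hLζ hLζc).norm.add
        (integrable_clm_apply hvV hDζ hDζc).norm).mono' (hpm.mul hF.1) (ae_of_all _ fun x => ?_)
      simp only [Pi.add_apply, Real.norm_eq_abs, abs_mul, map_smul, smul_eq_mul]
      rw [← mul_add]
      refine mul_le_mul (abs_prim_le _) ?_ (abs_nonneg _) (abs_nonneg _)
      refine (abs_sub _ _).trans ?_
      rw [abs_neg]
    obtain ⟨C₁, hC₁⟩ := hLζc.exists_bound_of_continuous hLζ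
    obtain ⟨C₂, hC₂⟩ := hDζc.exists_bound_of_continuous hDζ
    -- The difference of the integrands is at most `|w_k - v|(|Δζ| + |∇ζ||V|)`: convergence in
    -- `L¹(A)` handles the first part and convergence in `L¹(|V|dx)` the second.
    refine tendsto_integral_of_L1 _ hFv.1 (Eventually.of_forall fun k => ?_) ?_
    · refine hF.bdd_mul (c := M k) (continuous_prim.comp_aestronglyMeasurable (hwm k))
        (ae_of_all _ fun x => (abs_prim_le _).trans (hwM k x))
    · refine tendsto_of_tendsto_of_tendsto_of_le_of_le tendsto_const_nhds
        (h := fun k => ENNReal.ofReal C₁ * (∫⁻ x in A, ‖w k x - v x‖ₑ) +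
          ENNReal.ofReal C₂ * ∫⁻ x, ‖w k x - v x‖ₑ * ‖V x‖ₑ) ?_ (fun _ => zero_le) fun k => ?_
      · simpa using (ENNReal.Tendsto.const_mul (a := ENNReal.ofReal C₁) hYlim
          (Or.inr ENNReal.ofReal_ne_top)).add (ENNReal.Tendsto.const_mul (a := ENNReal.ofReal C₂)
          hXlim (Or.inr ENNReal.ofReal_ne_top))
      · have hm1 : AEMeasurable fun x => A.indicator (fun x => ‖w k x - v x‖ₑ) x :=
          ((hwm k).sub hv.1).enorm.indicator hAm
        beta_reduce
        rw [← lintegral_indicator hAm, ← lintegral_const_mul' _ _ ENNReal.ofReal_ne_top,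
          ← lintegral_const_mul' _ _ ENNReal.ofReal_ne_top,
          ← lintegral_add_left' (hm1.const_mul _)]
        refine lintegral_mono fun x => ?_
        rw [← sub_mul, enorm_mul]
        have h1 : ‖prim ε (w k x) - prim ε (v x)‖ₑ ≤ ‖w k x - v x‖ₑ := by
          rw [← ofReal_norm, ← ofReal_norm]
          exact ENNReal.ofReal_le_ofReal (abs_prim_sub_le _ _)
        have h2 : ‖fderiv ℝ ζ x (V x)‖ₑ ≤ ENNReal.ofReal C₂ * ‖V x‖ₑ := by
          rw [← ofReal_norm, ← ofReal_norm (V x), ← ENNReal.ofReal_mul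
            ((norm_nonneg _).trans (hC₂ x))]
          exact ENNReal.ofReal_le_ofReal (((fderiv ℝ ζ x).le_opNorm _).trans
            (mul_le_mul_of_nonneg_right (hC₂ x) (norm_nonneg _)))
        have h3 : ‖- Laplacian.laplacian ζ x‖ₑ * ‖w k x - v x‖ₑ ≤
            ENNReal.ofReal C₁ * A.indicator (fun x => ‖w k x - v x‖ₑ) x := by
          by_cases hx : x ∈ A
          · rw [indicator_of_mem hx, enorm_neg]
            gcongr
            rw [← ofReal_norm]
            exact ENNReal.ofReal_le_ofReal (hC₁ x)
          · simp [laplacian_eq_zero_of_notMem_tsupport fun h => hx (hζA h)]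
        calc ‖prim ε (w k x) - prim ε (v x)‖ₑ * ‖- Laplacian.laplacian ζ x - fderiv ℝ ζ x (V x)‖ₑ
            ≤ ‖w k x - v x‖ₑ * (‖- Laplacian.laplacian ζ x‖ₑ + ‖fderiv ℝ ζ x (V x)‖ₑ) :=
              mul_le_mul' h1 enorm_sub_le
          _ = ‖- Laplacian.laplacian ζ x‖ₑ * ‖w k x - v x‖ₑ +
              ‖fderiv ℝ ζ x (V x)‖ₑ * ‖w k x - v x‖ₑ := by ring
          _ ≤ _ := by
              refine add_le_add h3 ?_
              rw [mul_comm (‖w k x - v x‖ₑ), ← mul_assoc]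
              gcongr
  -- The right side involves the bounded function `trans ε (w k)` against data that are merely
  -- integrable, so a.e. convergence is needed and a subsequence is extracted.
  have hmeas : TendstoInMeasure (volume.restrict A) w atTop v := by
    refine tendstoInMeasure_of_tendsto_eLpNorm one_ne_zero (fun k => (hwm k).restrict)
      hv.1.restrict ?_
    simpa [eLpNorm_one_eq_lintegral_enorm] using hYlim
  obtain ⟨ns, hns, hae⟩ := hmeas.exists_seq_tendsto_ae
  obtain ⟨C, hC⟩ := hζ.compact.exists_bound_of_continuous hζ.smooth.continuous
  have hlimR : Tendsto (fun k => ∫ x, trans ε (w (ns k) x) * moll (ns k) f x * ζ x) atTop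
      (𝓝 (∫ x, trans ε (v x) * f x * ζ x)) := by
    have hset : ∀ F g : EuclideanSpace ℝ (Fin n) → ℝ,
        ∫ x in A, F x * (g x * ζ x) = ∫ x, F x * g x * ζ x := by
      intro F g
      simp_rw [← mul_assoc]
      refine setIntegral_eq_integral_of_forall_compl_eq_zero fun x hx => ?_
      rw [image_eq_zero_of_notMem_tsupport fun h => hx (hζA h), mul_zero]
    simp_rw [← hset]
    refine tendsto_integral_mul_of_tendsto_lintegral (C := 1)
      (fun k => (integrable_mul_of_continuous_of_hasCompactSupport (integrable_moll (ns k) hf)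
        hζ.smooth.continuous hζ.compact).restrict)
      (integrable_mul_of_continuous_of_hasCompactSupport hf
        hζ.smooth.continuous hζ.compact).restrict ?_
      (fun k => (continuous_trans.comp_aestronglyMeasurable (hwm _)).restrict)
      (fun k x => abs_trans_le_one _) ?_
    · have h1 := (tendsto_lintegral_moll_sub hf).comp hns.tendsto_atTop
      have h2 := ENNReal.Tendsto.const_mul (a := ENNReal.ofReal C) h1
        (Or.inr ENNReal.ofReal_ne_top)
      rw [mul_zero] at h2
      refine tendsto_of_tendsto_of_tendsto_of_le_of_le tendsto_const_nhds h2
        (fun _ => zero_le) fun k => ?_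
      simp only [Function.comp_apply]
      rw [← lintegral_const_mul' _ _ ENNReal.ofReal_ne_top]
      refine (setLIntegral_le_lintegral _ _).trans (lintegral_mono fun x => ?_)
      rw [← sub_mul, enorm_mul, mul_comm]
      gcongr
      rw [← ofReal_norm]
      exact ENNReal.ofReal_le_ofReal (hC x)
    · filter_upwards [hae] with x hx
      exact (continuous_trans.tendsto _).comp hx
  exact le_of_tendsto_of_tendsto (hlimL.comp hns.tendsto_atTop) hlimR
    (hns.tendsto_atTop.eventually hkato)

end LocalSmooth

/-! ### Passage to the positive part -/

section LocalPosPart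

variable {n : ℕ} {V : EuclideanSpace ℝ (Fin n) → EuclideanSpace ℝ (Fin n)}

theorem abs_signPos_le_one (s : ℝ) : |signPos s| ≤ 1 := by
  unfold signPos
  split_ifs <;> simp

theorem measurable_signPos : Measurable signPos :=
  Measurable.ite measurableSet_Ioi measurable_const measurable_const

/-- Dominated convergence as `ε → 0`: `|prim ε s| ≤ |s|` uniformly in `ε`, and both `v Δζ` and
`∇ζ·(vV)` are integrable. -/
theorem kato_local_posPart (hn : 2 ≤ n) {O : Set (EuclideanSpace ℝ (Fin n))} (hO : IsOpen O)
    (hV : Integrable V) (hV2 : MemLp V 2)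
    (hθ : ∀ x, ‖(cK n)⁻¹‖ₑ * rieszPot V x ≤ ENNReal.ofReal (1 / 2))
    {v : EuclideanSpace ℝ (Fin n) → ℝ} (hv : Integrable v) (hvc : HasCompactSupport v)
    {Dv : EuclideanSpace ℝ (Fin n) → EuclideanSpace ℝ (Fin n)} (hDv : Integrable Dv)
    (hweak : HasWeakGradient univ v Dv) (hvV : Integrable fun x => v x • V x)
    {f : EuclideanSpace ℝ (Fin n) → ℝ} (hf : Integrable f)
    (hdiv : ∀ η, IsTestFunction O η → ∫ x, fderiv ℝ η x (V x) = 0)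
    (heq : ∀ η, IsTestFunction O η → ∫ x, fderiv ℝ η x (Dv x - v x • V x) = ∫ x, f x * η x)
    {ζ : EuclideanSpace ℝ (Fin n) → ℝ} (hζ : IsTestFunction O ζ) (hζ0 : ∀ x, 0 ≤ ζ x) :
    ∫ x, max (v x) 0 * (- Laplacian.laplacian ζ x - fderiv ℝ ζ x (V x)) ≤
      ∫ x, signPos (v x) * f x * ζ x := by
  set e : ℕ → ℝ := fun k => 1 / ((k : ℝ) + 1) with he
  have he0 : ∀ k, 0 < e k := fun k => Nat.one_div_pos_of_nat
  have helim : Tendsto e atTop (𝓝 0) := tendsto_one_div_add_atTop_nhds_zero_nat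
  have hDζ : Continuous (fderiv ℝ ζ) := hζ.contDiff_two.continuous_fderiv (by norm_num)
  have hDζc : HasCompactSupport (fderiv ℝ ζ) := hζ.compact.fderiv ℝ
  have hLζ : Continuous (Laplacian.laplacian ζ) := continuous_laplacian hζ.contDiff_two
  have hLζc : HasCompactSupport (Laplacian.laplacian ζ) := hasCompactSupport_laplacian hζ.compact
  have hFm : AEStronglyMeasurable fun x => - Laplacian.laplacian ζ x - fderiv ℝ ζ x (V x) :=
    hLζ.aestronglyMeasurable.neg.sub (integrable_clm_apply hV hDζ hDζc).1
  refine le_of_tendsto_of_tendsto' (b := atTop) ?_ ?_ fun k => kato_local_smooth hn hO hV hV2 hθ hv hvc hDv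
    hweak hvV hf hdiv heq (he0 k) hζ hζ0
  · refine tendsto_integral_of_dominated_convergence
      (fun x => ‖v x * Laplacian.laplacian ζ x‖ + ‖fderiv ℝ ζ x (v x • V x)‖)
      (fun k => (continuous_prim.comp_aestronglyMeasurable hv.1).mul hFm)
      ((integrable_mul_of_continuous_of_hasCompactSupport hv hLζ hLζc).norm.add
        (integrable_clm_apply hvV hDζ hDζc).norm) (fun k => ae_of_all _ fun x => ?_)
      (ae_of_all _ fun x => (tendsto_prim he0 helim _).mul_const _)
    simp only [Real.norm_eq_abs, abs_mul, map_smul, smul_eq_mul]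
    rw [← mul_add]
    refine mul_le_mul (abs_prim_le _) ?_ (abs_nonneg _) (abs_nonneg _)
    refine (abs_sub _ _).trans ?_
    rw [abs_neg]
  · have hfζ := integrable_mul_of_continuous_of_hasCompactSupport hf hζ.smooth.continuous
      hζ.compact
    refine tendsto_integral_of_dominated_convergence (fun x => ‖f x * ζ x‖)
      (fun k => ((continuous_trans.comp_aestronglyMeasurable hv.1).mul hf.1).mul
        hζ.smooth.continuous.aestronglyMeasurable) hfζ.norm (fun k => ae_of_all _ fun x => ?_)
      (ae_of_all _ fun x => ((tendsto_trans he0 helim _).mul_const _).mul_const _)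
    rw [mul_assoc, norm_mul]
    exact mul_le_of_le_one_left (norm_nonneg _) (abs_trans_le_one _)

end LocalPosPart

/-! ### Integrability and local smallness of the drift -/

section Drift

variable {n : ℕ} {Ω : Set (EuclideanSpace ℝ (Fin n))}

theorem integrableOn_mul_of_memLorentz {μ : Measure (EuclideanSpace ℝ (Fin n))} [IsFiniteMeasure μ]
    (hn : 2 ≤ n) {g h : EuclideanSpace ℝ (Fin n) → ℝ} (hg : AEStronglyMeasurable g μ)
    {c : ℝ≥0∞} (hc : c ≠ ⊤)
    (hgc : ∀ A, MeasurableSet A → ∫⁻ x in A, ‖g x‖ₑ ∂μ ≤ c * μ A ^ (1 / (n : ℝ)))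
    (hh : MemLorentz h (n : ℝ≥0∞) 1 μ) : Integrable (fun x => g x * h x) μ := by
  refine ⟨hg.mul hh.1, ?_⟩
  have h1 := setLIntegral_enorm_mul_le hh.1 hg.enorm hc hgc MeasurableSet.univ
  rw [Measure.restrict_univ] at h1
  simp_rw [HasFiniteIntegral, enorm_mul]
  exact h1.trans_lt (ENNReal.mul_lt_top hc.lt_top (lintegral_distrib_rpow_lt_top hn hh))

theorem integrable_of_memLorentz_one {μ : Measure (EuclideanSpace ℝ (Fin n))} [IsFiniteMeasure μ]
    (hn : 2 ≤ n) {h : EuclideanSpace ℝ (Fin n) → ℝ} (hh : MemLorentz h (n : ℝ≥0∞) 1 μ) :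
    Integrable h μ := by
  obtain ⟨c, hc, hcA⟩ := exists_setLIntegral_le_of_memLorentz_one hn hh
  refine ⟨hh.1, ?_⟩
  have := hcA univ MeasurableSet.univ
  rw [Measure.restrict_univ] at this
  refine this.trans_lt (ENNReal.mul_lt_top hc.lt_top (ENNReal.rpow_lt_top_of_nonneg (by positivity)
    (measure_ne_top _ _)))

variable {μ : Measure (EuclideanSpace ℝ (Fin n))} [IsFiniteMeasure μ]
  {U : EuclideanSpace ℝ (Fin n) → EuclideanSpace ℝ (Fin n)}

theorem integrable_drift (hn : 2 ≤ n) (hU : ∀ i, MemLorentz (fun x => U x i) (n : ℝ≥0∞) 1 μ) :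
    Integrable U μ :=
  Integrable.of_eval_piLp fun i => integrable_of_memLorentz_one hn (hU i)

/-- Hölder's inequality of each component with itself, one factor being measured by its bound on
integrals over sets. -/
theorem memLp_two_drift (hn : 2 ≤ n) (hU : ∀ i, MemLorentz (fun x => U x i) (n : ℝ≥0∞) 1 μ) :
    MemLp U 2 μ := by
  refine MemLp.of_eval_piLp fun i => ?_
  obtain ⟨c, hc, hcA⟩ := exists_setLIntegral_le_of_memLorentz_one hn (hU i)
  rw [memLp_two_iff_integrable_sq (hU i).1]
  simpa [sq] using integrableOn_mul_of_memLorentz hn (hU i).1 hc hcA (hU i)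

theorem integrable_smul_drift (hn : 2 ≤ n)
    (hU : ∀ i, MemLorentz (fun x => U x i) (n : ℝ≥0∞) 1 μ) {u : EuclideanSpace ℝ (Fin n) → ℝ}
    (hu : MemLorentz u (ENNReal.ofReal ((n : ℝ) / ((n : ℝ) - 1))) ⊤ μ) :
    Integrable (fun x => u x • U x) μ := by
  obtain ⟨c, hc, hcA⟩ := exists_setLIntegral_le_of_memLorentz_top hn hu
  exact Integrable.of_eval_piLp fun i => integrableOn_mul_of_memLorentz hn hu.1 hc hcA (hU i)

theorem enorm_le_sum_enorm (x : EuclideanSpace ℝ (Fin n)) : ‖x‖ₑ ≤ ∑ i, ‖x i‖ₑ := by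
  have h : x = ∑ i, x i • EuclideanSpace.single i (1 : ℝ) := by
    ext j
    simp [Pi.single_apply]
  conv_lhs => rw [h]
  refine (enorm_sum_le _ _).trans (Finset.sum_le_sum fun i _ => ?_)
  rw [enorm_smul]
  simp [← ofReal_norm]

/-- The potential of the drift restricted to a small ball is small. -/
theorem exists_ball_rieszPot_le (hn : 2 ≤ n) (hΩ : MeasurableSet Ω) (hΩfin : volume Ω ≠ ⊤)
    (hU : ∀ i, MemLorentz (fun x => U x i) (n : ℝ≥0∞) 1 (volume.restrict Ω))
    (x₀ : EuclideanSpace ℝ (Fin n)) {θ : ℝ≥0∞} (hθ : 0 < θ) :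
    ∃ r > 0, ∀ x, ‖(cK n)⁻¹‖ₑ * rieszPot ((Metric.ball x₀ r ∩ Ω).indicator U) x ≤ θ := by
  have : IsFiniteMeasure (volume.restrict Ω) := ⟨by simpa using hΩfin.lt_top⟩
  obtain ⟨c, hc, hcA⟩ := exists_lintegral_rieszK_le hn
  set B : ℕ → Set (EuclideanSpace ℝ (Fin n)) := fun k => Metric.ball x₀ (1 / ((k : ℝ) + 1)) with hB
  have hn0 : (0 : ℝ) < 1 / (n : ℝ) := by
    have : 0 < n := by omega
    positivity
  have hBlim : Tendsto (fun k => volume.restrict Ω (B k)) atTop (𝓝 0) := by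
    have h1 : Tendsto (fun k : ℕ => volume (Metric.ball x₀ (1 / ((k : ℝ) + 1)))) atTop (𝓝 0) := by
      have : Nonempty (Fin n) := ⟨⟨0, by omega⟩⟩
      simp_rw [EuclideanSpace.volume_ball]
      have h2 : Tendsto (fun k : ℕ => ENNReal.ofReal (1 / ((k : ℝ) + 1)) ^ Fintype.card (Fin n))
          atTop (𝓝 0) := by
        have h3 := ENNReal.tendsto_ofReal (tendsto_one_div_add_atTop_nhds_zero_nat (𝕜 := ℝ))
        have h4 := ENNReal.Tendsto.pow (n := Fintype.card (Fin n)) h3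
        simpa [show n ≠ 0 by omega] using h4
      simpa using ENNReal.Tendsto.mul_const h2 (Or.inr ENNReal.ofReal_ne_top)
    exact tendsto_of_tendsto_of_tendsto_of_le_of_le tendsto_const_nhds h1 (fun _ => zero_le)
      fun k => Measure.restrict_apply_le _ _
  -- By Hölder, this quantity bounds the potential of the drift on the `k`-th ball uniformly in the
  -- evaluation point; it vanishes by absolute continuity.
  have hlim : Tendsto (fun k => ‖(cK n)⁻¹‖ₑ * ∑ i, c * ∫⁻ s in Ioi 0,
      distrib (fun x => U x i) ((volume.restrict Ω).restrict (B k)) s ^ (1 / (n : ℝ)))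
      atTop (𝓝 0) := by
    have h1 := tendsto_finsetSum (Finset.univ : Finset (Fin n)) fun i _ =>
      ENNReal.Tendsto.const_mul (a := c) (tendsto_lintegral_distrib_restrict hn0
        (lintegral_distrib_rpow_lt_top hn (hU i)) hBlim) (Or.inr hc)
    simpa using ENNReal.Tendsto.const_mul (a := ‖(cK n)⁻¹‖ₑ) h1 (Or.inr enorm_ne_top)
  obtain ⟨k, hk⟩ := (hlim.eventually_lt_const hθ).exists
  refine ⟨1 / ((k : ℝ) + 1), by positivity, fun x => ?_⟩
  refine le_trans ?_ hk.le
  gcongr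
  have hBm : MeasurableSet (B k) := Metric.isOpen_ball.measurableSet
  have hm : ∀ i, AEMeasurable (fun y => ‖rieszK (x - y)‖ₑ * ‖U y i‖ₑ)
      ((volume.restrict Ω).restrict (B k)) := fun i =>
    ((measurable_rieszK.comp (measurable_const.sub measurable_id)).enorm.aemeasurable.mul
      (hU i).1.enorm.restrict)
  calc rieszPot ((B k ∩ Ω).indicator U) x
      = ∫⁻ y in B k ∩ Ω, ‖rieszK (x - y)‖ₑ * ‖U y‖ₑ := by
        rw [← lintegral_indicator (hBm.inter hΩ), rieszPot]
        refine lintegral_congr fun y => ?_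
        by_cases hy : y ∈ B k ∩ Ω
        · simp only [indicator_of_mem hy]
        · simp only [indicator_of_notMem hy, enorm_zero, mul_zero]
    _ = ∫⁻ y, ‖rieszK (x - y)‖ₑ * ‖U y‖ₑ ∂((volume.restrict Ω).restrict (B k)) := by
        rw [Measure.restrict_restrict hBm]
    _ ≤ ∫⁻ y, ∑ i, ‖rieszK (x - y)‖ₑ * ‖U y i‖ₑ ∂((volume.restrict Ω).restrict (B k)) := by
        refine lintegral_mono fun y => ?_
        rw [← Finset.mul_sum]
        gcongr
        exact enorm_le_sum_enorm _
    _ = ∑ i, ∫⁻ y, ‖rieszK (x - y)‖ₑ * ‖U y i‖ₑ ∂((volume.restrict Ω).restrict (B k)) :=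
        lintegral_finsetSum' _ fun i _ => hm i
    _ ≤ _ := by
        refine Finset.sum_le_sum fun i _ => setLIntegral_enorm_mul_le (hU i).1
          (measurable_rieszK.comp (measurable_const.sub measurable_id)).enorm.aemeasurable hc
          (fun A hA => ?_) hBm
        rw [Measure.restrict_restrict hA, Measure.restrict_apply hA]
        exact hcA x _ (hA.inter hΩ)

end Drift

/-! ### The distance to the boundary -/

section BoundaryDistance

variable {n : ℕ} {Ω : Set (EuclideanSpace ℝ (Fin n))}

/-- Connectedness of `ℝⁿ`. Without a boundary point, `Metric.infDist` would take its default value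
`0` and the weight `δ` would be meaningless. -/
theorem frontier_nonempty_of_isBounded (hn : 2 ≤ n) (hΩb : Bornology.IsBounded Ω)
    (hne : Ω.Nonempty) : (frontier Ω).Nonempty := by
  have : Nontrivial (EuclideanSpace ℝ (Fin n)) := by
    have : Nonempty (Fin n) := ⟨⟨0, by omega⟩⟩
    infer_instance
  rw [nonempty_iff_ne_empty, Ne, frontier_eq_empty_iff, not_or]
  refine ⟨hne.ne_empty, fun h => ?_⟩
  rw [h] at hΩb
  exact NormedSpace.unbounded_univ ℝ (EuclideanSpace ℝ (Fin n)) hΩb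

theorem bdist_pos (hn : 2 ≤ n) (hΩ : IsOpen Ω) (hΩb : Bornology.IsBounded Ω)
    {x : EuclideanSpace ℝ (Fin n)} (hx : x ∈ Ω) : 0 < bdist Ω x := by
  rw [bdist, ← isClosed_frontier.notMem_iff_infDist_pos
    (frontier_nonempty_of_isBounded hn hΩb ⟨x, hx⟩), hΩ.frontier_eq]
  exact fun h => h.2 hx

theorem continuous_bdist : Continuous (bdist Ω) := Metric.continuous_infDist_pt _

end BoundaryDistance

/-! ### Localisation near an interior point -/

section NearPoint

variable {n : ℕ} {Ω K : Set (EuclideanSpace ℝ (Fin n))}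

theorem setIntegral_mul_eq_integral_indicator (hK : K ⊆ Ω)
    (u : EuclideanSpace ℝ (Fin n) → ℝ) {ψ : EuclideanSpace ℝ (Fin n) → ℝ}
    (hψ : ∀ x, x ∉ K → ψ x = 0) : ∫ x in Ω, u x * ψ x = ∫ x, K.indicator u x * ψ x := by
  rw [← setIntegral_eq_integral_of_forall_compl_eq_zero (s := Ω)
    (f := fun x => K.indicator u x * ψ x) fun x hx => by rw [hψ x fun h => hx (hK h), mul_zero]]
  refine integral_congr_ae (ae_of_all _ fun x => ?_)
  by_cases hx : x ∈ K
  · simp only [indicator_of_mem hx]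
  · simp only [hψ x hx, mul_zero]

/-- The product of a Sobolev function with a cutoff has the expected weak gradient. -/
theorem hasWeakGradient_cutoff_mul (hK : IsCompact K) (hKΩ : K ⊆ Ω)
    {u : EuclideanSpace ℝ (Fin n) → ℝ} {G : EuclideanSpace ℝ (Fin n) → EuclideanSpace ℝ (Fin n)}
    (hu : IntegrableOn u K) (hG : IntegrableOn G K) (huG : HasWeakGradient Ω u G)
    {χ : EuclideanSpace ℝ (Fin n) → ℝ} (hχ : ContDiff ℝ ∞ χ) (hχK : tsupport χ ⊆ K) :
    HasWeakGradient univ (fun x => χ x * K.indicator u x)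
      (fun x => χ x • K.indicator G x + K.indicator u x • gradient χ x) := by
  intro η hη i
  have hχc : HasCompactSupport χ := hK.of_isClosed_subset (isClosed_tsupport _) hχK
  have hχη : IsTestFunction Ω fun x => χ x * η x :=
    ⟨hχ.mul hη.smooth, hχc.mul_right, ((tsupport_mul_subset_left).trans hχK).trans hKΩ⟩
  have huK : Integrable (K.indicator u) := (integrable_indicator_iff hK.measurableSet).2 hu
  have hGK : Integrable (K.indicator G) := (integrable_indicator_iff hK.measurableSet).2 hG
  have hoff : ∀ x, x ∉ K → x ∉ tsupport (fun x => χ x * η x) := fun x hx h =>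
    hx (hχK (tsupport_mul_subset_left h))
  have h1 := huG _ hχη i
  change ∫ x in Ω, u x * pd i (fun x => χ x * η x) x = _ at h1
  rw [setIntegral_mul_eq_integral_indicator hKΩ u (fun x hx => by
      rw [pd, fderiv_eq_zero_of_notMem_tsupport (hoff x hx), zero_apply]),
    setIntegral_mul_eq_integral_indicator hKΩ (fun x => G x i) (fun x hx =>
      image_eq_zero_of_notMem_tsupport (hoff x hx))] at h1
  have hχ1 : ContDiff ℝ 1 χ := contDiff_infty.1 hχ 1
  have hpd : ∀ x, pd i (fun x => χ x * η x) x = χ x * pd i η x + η x * pd i χ x := by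
    intro x
    simp only [pd]
    rw [fderiv_fun_mul ((hχ1.differentiable (by norm_num)) x)
      ((hη.contDiff_one.differentiable (by norm_num)) x)]
    simp
  have hI1 : Integrable fun x => K.indicator u x * pd i (fun x => χ x * η x) x :=
    integrable_mul_of_continuous_of_hasCompactSupport huK
      (contDiff_pd (m := 0) hχη.contDiff_one (by norm_num) i).continuous
      (hasCompactSupport_pd hχη.compact i)
  have hI2 : Integrable fun x => K.indicator u x * (η x * pd i χ x) :=
    integrable_mul_of_continuous_of_hasCompactSupport huK
      (hη.smooth.continuous.mul (contDiff_pd (m := 0) hχ1 (by norm_num) i).continuous)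
      (hη.compact.mul_right)
  have hI3 : Integrable fun x => K.indicator (fun x => G x i) x * (χ x * η x) := by
    refine integrable_mul_of_continuous_of_hasCompactSupport ?_ hχη.smooth.continuous hχη.compact
    rw [integrable_indicator_iff hK.measurableSet]
    exact integrable_apply hG i
  rw [Measure.restrict_univ]
  change ∫ x, χ x * K.indicator u x * pd i η x = _
  have e1 : ∫ x, χ x * K.indicator u x * pd i η x =
      (∫ x, K.indicator u x * pd i (fun x => χ x * η x) x) -
        ∫ x, K.indicator u x * (η x * pd i χ x) := by
    rw [← integral_sub hI1 hI2]
    refine integral_congr_ae (ae_of_all _ fun x => ?_)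
    simp only [hpd]
    ring
  have e2 : ∫ x, (χ x • K.indicator G x + K.indicator u x • gradient χ x) i * η x =
      (∫ x, K.indicator (fun x => G x i) x * (χ x * η x)) +
        ∫ x, K.indicator u x * (η x * pd i χ x) := by
    rw [← integral_add hI3 hI2]
    refine integral_congr_ae (ae_of_all _ fun x => ?_)
    by_cases hx : x ∈ K
    · simp only [indicator_of_mem hx, PiLp.add_apply, PiLp.smul_apply, gradient_apply, smul_eq_mul]
      ring
    · simp only [indicator_of_notMem hx]
      simp
  rw [e1, e2, h1]
  ring

/-- The weak gradient is tested with each `∂ᵢη` and the results are summed; extension by zero off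
`K` is harmless as `η` is supported there. -/
theorem integral_fderiv_weakGradient (hK : IsCompact K) (hKΩ : K ⊆ Ω)
    {u : EuclideanSpace ℝ (Fin n) → ℝ} {G : EuclideanSpace ℝ (Fin n) → EuclideanSpace ℝ (Fin n)}
    (hu : IntegrableOn u K) (hG : IntegrableOn G K) (huG : HasWeakGradient Ω u G)
    {η : EuclideanSpace ℝ (Fin n) → ℝ} (hη : IsTestFunction Ω η) (hηK : tsupport η ⊆ K) :
    ∫ x, fderiv ℝ η x (K.indicator G x) =
      - ∫ x, K.indicator u x * Laplacian.laplacian η x := by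
  have huK : Integrable (K.indicator u) := (integrable_indicator_iff hK.measurableSet).2 hu
  have hGK : Integrable (K.indicator G) := (integrable_indicator_iff hK.measurableSet).2 hG
  have hpdK : ∀ i x, x ∉ K → pd i η x = 0 := fun i x hx => by
    rw [pd, fderiv_eq_zero_of_notMem_tsupport fun h => hx (hηK h), zero_apply]
  have hpdpdK : ∀ i x, x ∉ K → pd i (pd i η) x = 0 := fun i x hx => by
    rw [pd, fderiv_eq_zero_of_notMem_tsupport fun h =>
      hx (hηK (tsupport_pd_subset _ _ h)), zero_apply]
  have h1 : ∀ i, ∫ x, K.indicator (fun x => G x i) x * pd i η x =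
      - ∫ x, K.indicator u x * pd i (pd i η) x := by
    intro i
    rw [← setIntegral_mul_eq_integral_indicator hKΩ _ (hpdK i),
      ← setIntegral_mul_eq_integral_indicator hKΩ _ (hpdpdK i)]
    exact (neg_eq_iff_eq_neg.2 (huG _ (hη.pd i) i)).symm
  have hc1 := fun i => contDiff_pd (m := 1) hη.contDiff_two (by norm_num) i
  have hc0 := fun i => contDiff_pd (m := 0) (hc1 i) (by norm_num) i
  have e1 : ∀ x, fderiv ℝ η x (K.indicator G x) =
      ∑ i, K.indicator (fun x => G x i) x * pd i η x := by
    intro x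
    rw [fderiv_eq_sum_pd]
    by_cases hx : x ∈ K
    · simp only [indicator_of_mem hx]
    · simp only [indicator_of_notMem hx]
      simp
  simp_rw [e1, laplacian_eq_sum_pd hη.contDiff_two.contDiffAt, Finset.mul_sum]
  rw [integral_finsetSum, integral_finsetSum, ← Finset.sum_neg_distrib]
  · exact Finset.sum_congr rfl fun i _ => h1 i
  · exact fun i _ => integrable_mul_of_continuous_of_hasCompactSupport huK (hc0 i).continuous
      (hasCompactSupport_pd (hasCompactSupport_pd hη.compact i) i)
  · refine fun i _ => integrable_mul_of_continuous_of_hasCompactSupport ?_ (hc1 i).continuous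
      (hasCompactSupport_pd hη.compact i)
    rw [integrable_indicator_iff hK.measurableSet]
    exact integrable_apply hG i

/-- The radius is dictated by the smallness of the potential of the drift. A cutoff equal to `1` on
the half ball `O` transplants the problem to the whole space: on `O` the cut-off function, its
gradient and the truncated drift agree with `u`, `G` and `U`, so test functions supported in `O` see
the original equation. -/
theorem exists_ball_kato (hn : 2 ≤ n) (hΩ : IsOpen Ω) (hΩb : Bornology.IsBounded Ω)
    {u f : EuclideanSpace ℝ (Fin n) → ℝ} {U : EuclideanSpace ℝ (Fin n) → EuclideanSpace ℝ (Fin n)}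
    (hu_sob : MemW11Loc Ω u)
    (hu_lor : MemLorentz u (ENNReal.ofReal ((n : ℝ) / ((n : ℝ) - 1))) ⊤ (volume.restrict Ω))
    (hU_lor : ∀ i : Fin n, MemLorentz (fun x => U x i) (n : ℝ≥0∞) 1 (volume.restrict Ω))
    (hU_div : DivFree Ω U) (hLu : DistribL Ω U u f) (hf : LocallyIntegrableOn f Ω)
    {x₀ : EuclideanSpace ℝ (Fin n)} (hx₀ : x₀ ∈ Ω) :
    ∃ ρ > 0, Metric.ball x₀ ρ ⊆ Ω ∧ ∀ ζ, IsTestFunction (Metric.ball x₀ ρ) ζ → (∀ x, 0 ≤ ζ x) →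
      ∫ x in Ω, max (u x) 0 * Lstar U ζ x ≤ ∫ x in Ω, ζ x * signPos (u x) * f x := by
  have hΩm := hΩ.measurableSet
  have : IsFiniteMeasure (volume.restrict Ω) := ⟨by simpa using hΩb.measure_lt_top⟩
  obtain ⟨hu_loc, G, hG_loc, huG⟩ := hu_sob
  obtain ⟨r, hr, hθ⟩ := exists_ball_rieszPot_le hn hΩm hΩb.measure_lt_top.ne hU_lor x₀
    (θ := ENNReal.ofReal (1 / 2)) (by simp)
  obtain ⟨R, hR, hRsub⟩ := Metric.nhds_basis_closedBall.mem_iff.1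
    ((Metric.isOpen_ball.inter hΩ).mem_nhds ⟨Metric.mem_ball_self hr, hx₀⟩)
  set K := Metric.closedBall x₀ R with hKdef
  set S := Metric.ball x₀ r ∩ Ω with hSdef
  have hSm : MeasurableSet S := Metric.isOpen_ball.measurableSet.inter hΩm
  have hKc : IsCompact K := isCompact_closedBall _ _
  have hKΩ : K ⊆ Ω := hRsub.trans inter_subset_right
  have hu := hu_loc.integrableOn_compact_subset hKΩ hKc
  have hG := hG_loc.integrableOn_compact_subset hKΩ hKc
  have hfK := hf.integrableOn_compact_subset hKΩ hKc
  have huK : Integrable (K.indicator u) := (integrable_indicator_iff hKc.measurableSet).2 hu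
  have hGK : Integrable (K.indicator G) := (integrable_indicator_iff hKc.measurableSet).2 hG
  let χ : ContDiffBump x₀ := ⟨R / 2, R, by positivity, by linarith⟩
  set O := Metric.ball x₀ (R / 2) with hOdef
  have hOK : O ⊆ K := fun x hx => Metric.mem_closedBall.2
    ((Metric.mem_ball.1 hx).le.trans (by linarith))
  have hOS : O ⊆ S := hOK.trans hRsub
  have hχ1 : ∀ x ∈ O, χ x = 1 := fun x hx => χ.one_of_mem_closedBall (Metric.ball_subset_closedBall hx)
  have hDχ : ∀ x ∈ O, gradient χ x = 0 := by
    intro x hx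
    have : (χ : EuclideanSpace ℝ (Fin n) → ℝ) =ᶠ[𝓝 x] fun _ => 1 :=
      eventually_of_mem (Metric.isOpen_ball.mem_nhds hx) hχ1
    rw [gradient, this.fderiv_eq]
    simp
  set V := S.indicator U with hVdef
  have hV : Integrable V := (integrable_indicator_iff hSm).2
    (IntegrableOn.mono_set (t := Ω) (integrable_drift hn hU_lor) inter_subset_right)
  have hV2 : MemLp V 2 := (memLp_indicator_iff_restrict hSm).2
    ((memLp_two_drift hn hU_lor).mono_measure (Measure.restrict_mono inter_subset_right le_rfl))
  have huU := integrable_smul_drift hn hU_lor hu_lor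
  have hχK : tsupport χ ⊆ K := χ.tsupport_eq.subset
  have hχs : ContDiff ℝ ∞ χ := χ.contDiff
  have hχc : HasCompactSupport χ := χ.hasCompactSupport
  have huV : ∀ x, K.indicator u x • V x = K.indicator (fun x => u x • U x) x := by
    intro x
    by_cases hx : x ∈ K
    · simp only [indicator_of_mem hx, hVdef, indicator_of_mem (hRsub hx)]
    · simp only [indicator_of_notMem hx, zero_smul]
  have huVint : Integrable fun x => K.indicator u x • V x := by
    simp_rw [huV]
    exact (integrable_indicator_iff hKc.measurableSet).2
      (IntegrableOn.mono_set (t := Ω) huU hKΩ)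
  set v : EuclideanSpace ℝ (Fin n) → ℝ := fun x => χ x * K.indicator u x with hvdef
  set Dv : EuclideanSpace ℝ (Fin n) → EuclideanSpace ℝ (Fin n) :=
    fun x => χ x • K.indicator G x + K.indicator u x • gradient χ x with hDvdef
  have hv : Integrable v := by
    simp_rw [hvdef, mul_comm (χ _)]
    exact integrable_mul_of_continuous_of_hasCompactSupport huK hχs.continuous hχc
  have hvc : HasCompactSupport v := hχc.mul_right
  have hgrad : Continuous (gradient χ) := by
    unfold gradient
    exact (LinearIsometryEquiv.continuous _).comp (hχs.continuous_fderiv (by simp))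
  have hgradc : HasCompactSupport (gradient χ) := (hχc.fderiv ℝ).comp_left (by simp)
  have hDv : Integrable Dv := by
    obtain ⟨C₁, hC₁⟩ := hχc.exists_bound_of_continuous hχs.continuous
    obtain ⟨C₂, hC₂⟩ := hgradc.exists_bound_of_continuous hgrad
    exact (hGK.bdd_smul C₁ hχs.continuous.aestronglyMeasurable (ae_of_all _ hC₁)).add
      (huK.smul_bdd C₂ hgrad.aestronglyMeasurable (ae_of_all _ hC₂))
  have hvV : Integrable fun x => v x • V x := by
    obtain ⟨C₁, hC₁⟩ := hχc.exists_bound_of_continuous hχs.continuous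
    simp_rw [hvdef, mul_smul]
    exact huVint.bdd_smul C₁ hχs.continuous.aestronglyMeasurable (ae_of_all _ hC₁)
  have hvO : ∀ x ∈ O, v x = K.indicator u x := fun x hx => by simp only [hvdef, hχ1 x hx, one_mul]
  have hDvO : ∀ x ∈ O, Dv x = K.indicator G x := fun x hx => by
    simp only [hDvdef, hχ1 x hx, hDχ x hx, one_smul, smul_zero, add_zero]
  have hdiv : ∀ η, IsTestFunction O η → ∫ x, fderiv ℝ η x (V x) = 0 := by
    intro η hη
    rw [← hU_div η (hη.mono (hOK.trans hKΩ)), ← setIntegral_eq_integral_of_forall_compl_eq_zero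
      (s := Ω) fun x hx => by
        rw [fderiv_eq_zero_of_notMem_tsupport fun h => hx (hKΩ (hOK (hη.supp h))), zero_apply]]
    refine integral_congr_ae (ae_of_all _ fun x => ?_)
    by_cases hx : x ∈ O
    · simp only [hVdef, indicator_of_mem (hOS hx)]
    · simp [fderiv_eq_zero_of_notMem_tsupport fun h => hx (hη.supp h)]
  have heq : ∀ η, IsTestFunction O η →
      ∫ x, fderiv ℝ η x (Dv x - v x • V x) = ∫ x, K.indicator f x * η x := by
    intro η hη
    have hηΩ : IsTestFunction Ω η := hη.mono (hOK.trans hKΩ)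
    have hηK : tsupport η ⊆ K := hη.supp.trans hOK
    have hc : Continuous (fderiv ℝ η) := hη.contDiff_two.continuous_fderiv (by norm_num)
    have hs : HasCompactSupport (fderiv ℝ η) := hη.compact.fderiv ℝ
    have hLη : Continuous (Laplacian.laplacian η) := continuous_laplacian hη.contDiff_two
    have hLηc : HasCompactSupport (Laplacian.laplacian η) := hasCompactSupport_laplacian hη.compact
    have e1 : ∫ x, fderiv ℝ η x (Dv x - v x • V x) =
        (∫ x, fderiv ℝ η x (K.indicator G x)) - ∫ x, fderiv ℝ η x (K.indicator u x • V x) := by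
      rw [← integral_sub (integrable_clm_apply hGK hc hs) (integrable_clm_apply huVint hc hs)]
      refine integral_congr_ae (ae_of_all _ fun x => ?_)
      by_cases hx : x ∈ O
      · simp only [hvO x hx, hDvO x hx, map_sub]
      · simp [fderiv_eq_zero_of_notMem_tsupport fun h => hx (hη.supp h)]
    have e2 : ∫ x in Ω, u x * Lstar U η x = (- ∫ x, K.indicator u x * Laplacian.laplacian η x) -
        ∫ x, fderiv ℝ η x (K.indicator u x • V x) := by
      have hI : Integrable fun x => -(K.indicator u x * Laplacian.laplacian η x) :=
        (integrable_mul_of_continuous_of_hasCompactSupport huK hLη hLηc).neg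
      rw [setIntegral_mul_eq_integral_indicator hKΩ u (ψ := Lstar U η) fun x hx => by
        simp [Lstar, fderiv_eq_zero_of_notMem_tsupport fun h => hx (hηK h),
          laplacian_eq_zero_of_notMem_tsupport fun h => hx (hηK h)],
        ← integral_neg, ← integral_sub hI (integrable_clm_apply huVint hc hs)]
      refine integral_congr_ae (ae_of_all _ fun x => ?_)
      by_cases hx : x ∈ K
      · simp only [hVdef, indicator_of_mem (hRsub hx), Lstar, map_smul, smul_eq_mul]
        ring
      · simp only [indicator_of_notMem hx]
        simp
    rw [e1, integral_fderiv_weakGradient hKc hKΩ hu hG huG hηΩ hηK, ← e2, hLu η hηΩ,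
      setIntegral_mul_eq_integral_indicator hKΩ f fun x hx =>
        image_eq_zero_of_notMem_tsupport fun h => hx (hηK h)]
  refine ⟨R / 2, by positivity, hOK.trans hKΩ, fun ζ hζ hζ0 => ?_⟩
  have key := kato_local_posPart hn Metric.isOpen_ball hV hV2 hθ hv hvc hDv
    (hasWeakGradient_cutoff_mul hKc hKΩ hu hG huG hχs hχK) hvV
    ((integrable_indicator_iff hKc.measurableSet).2 hfK) hdiv heq hζ hζ0
  have hoff : ∀ x, x ∉ Ω → x ∉ tsupport ζ := fun x hx h => hx (hKΩ (hOK (hζ.supp h)))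
  rw [← setIntegral_eq_integral_of_forall_compl_eq_zero (s := Ω)
      (f := fun x => max (v x) 0 * _) fun x hx => by
      simp [fderiv_eq_zero_of_notMem_tsupport (hoff x hx),
        laplacian_eq_zero_of_notMem_tsupport (hoff x hx)],
    ← setIntegral_eq_integral_of_forall_compl_eq_zero (s := Ω)
      (f := fun x => signPos (v x) * _ * ζ x) fun x hx => by
      rw [image_eq_zero_of_notMem_tsupport (hoff x hx), mul_zero]] at key
  refine le_trans (le_of_eq (integral_congr_ae (ae_of_all _ fun x => ?_)))
    (key.trans (le_of_eq (integral_congr_ae (ae_of_all _ fun x => ?_))))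
  · by_cases hx : x ∈ O
    · simp only [hvO x hx, indicator_of_mem (hOK hx), hVdef, indicator_of_mem (hOS hx), Lstar]
    · simp [Lstar, fderiv_eq_zero_of_notMem_tsupport fun h => hx (hζ.supp h),
        laplacian_eq_zero_of_notMem_tsupport fun h => hx (hζ.supp h)]
  · by_cases hx : x ∈ O
    · simp only [hvO x hx, indicator_of_mem (hOK hx)]
      ring
    · simp [image_eq_zero_of_notMem_tsupport fun h => hx (hζ.supp h)]

end NearPoint

open scoped Manifold

/-! ### Compactly supported test functions in `Ω` -/

section Interior

variable {n : ℕ} {Ω : Set (EuclideanSpace ℝ (Fin n))}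
  {u f : EuclideanSpace ℝ (Fin n) → ℝ} {U : EuclideanSpace ℝ (Fin n) → EuclideanSpace ℝ (Fin n)}

theorem abs_max_zero_le (s : ℝ) : |max s 0| ≤ |s| := by
  rw [abs_of_nonneg (le_max_right _ _)]
  exact max_le (le_abs_self _) (abs_nonneg _)

theorem aestronglyMeasurable_Lstar {μ : Measure (EuclideanSpace ℝ (Fin n))}
    (hU : AEStronglyMeasurable U μ) {φ : EuclideanSpace ℝ (Fin n) → ℝ}
    (hL : AEStronglyMeasurable (Laplacian.laplacian φ) μ)
    (hD : AEStronglyMeasurable (fderiv ℝ φ) μ) : AEStronglyMeasurable (Lstar U φ) μ :=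
  hL.neg.sub ((ContinuousLinearMap.apply ℝ ℝ).flip.aestronglyMeasurable_comp₂ hD hU)

theorem abs_posPart_mul_Lstar_le {φ : EuclideanSpace ℝ (Fin n) → ℝ} {C₁ C₂ : ℝ}
    {x : EuclideanSpace ℝ (Fin n)} (h₁ : |Laplacian.laplacian φ x| ≤ C₁)
    (h₂ : ‖fderiv ℝ φ x‖ ≤ C₂) :
    ‖max (u x) 0 * Lstar U φ x‖ ≤ C₁ * ‖u x‖ + C₂ * ‖u x • U x‖ := by
  rw [norm_mul, norm_smul]
  have h3 : ‖Lstar U φ x‖ ≤ C₁ + C₂ * ‖U x‖ := by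
    refine (norm_sub_le _ _).trans (add_le_add ?_ ?_)
    · rwa [norm_neg]
    · exact ((fderiv ℝ φ x).le_opNorm _).trans (mul_le_mul_of_nonneg_right h₂ (norm_nonneg _))
  calc ‖max (u x) 0‖ * ‖Lstar U φ x‖ ≤ ‖u x‖ * (C₁ + C₂ * ‖U x‖) :=
        mul_le_mul (abs_max_zero_le _) h3 (norm_nonneg _) (norm_nonneg _)
    _ = _ := by ring

theorem integrable_posPart_mul_Lstar {μ : Measure (EuclideanSpace ℝ (Fin n))}
    (hu : Integrable u μ) (hU : Integrable U μ) (huU : Integrable (fun x => u x • U x) μ)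
    {φ : EuclideanSpace ℝ (Fin n) → ℝ} (hL : AEStronglyMeasurable (Laplacian.laplacian φ) μ)
    (hD : AEStronglyMeasurable (fderiv ℝ φ) μ) {C₁ C₂ : ℝ}
    (h₁ : ∀ᵐ x ∂μ, |Laplacian.laplacian φ x| ≤ C₁) (h₂ : ∀ᵐ x ∂μ, ‖fderiv ℝ φ x‖ ≤ C₂) :
    Integrable (fun x => max (u x) 0 * Lstar U φ x) μ := by
  refine ((hu.norm.const_mul C₁).add (huU.norm.const_mul C₂)).mono'
    ((hu.1.sup aestronglyMeasurable_const).mul (aestronglyMeasurable_Lstar hU.1 hL hD)) ?_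
  filter_upwards [h₁, h₂] with x h1 h2
  exact abs_posPart_mul_Lstar_le h1 h2

theorem integrable_posPart_mul_Lstar_of_compact {μ : Measure (EuclideanSpace ℝ (Fin n))}
    (hu : Integrable u μ) (hU : Integrable U μ) (huU : Integrable (fun x => u x • U x) μ)
    {ζ : EuclideanSpace ℝ (Fin n) → ℝ} (hζ : ContDiff ℝ 2 ζ) (hζc : HasCompactSupport ζ) :
    Integrable (fun x => max (u x) 0 * Lstar U ζ x) μ := by
  have hL := continuous_laplacian hζ
  have hD : Continuous (fderiv ℝ ζ) := hζ.continuous_fderiv (by norm_num)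
  obtain ⟨C₁, hC₁⟩ := (hasCompactSupport_laplacian hζc).exists_bound_of_continuous hL
  obtain ⟨C₂, hC₂⟩ := (hζc.fderiv ℝ).exists_bound_of_continuous hD
  exact integrable_posPart_mul_Lstar hu hU huU hL.aestronglyMeasurable hD.aestronglyMeasurable
    (ae_of_all _ hC₁) (ae_of_all _ hC₂)

theorem integrableOn_mul_signPos_mul
    (hu : AEStronglyMeasurable u (volume.restrict Ω)) (hf : LocallyIntegrableOn f Ω)
    (hfm : AEStronglyMeasurable f (volume.restrict Ω))
    {ζ : EuclideanSpace ℝ (Fin n) → ℝ} (hζ : Continuous ζ) (hζc : HasCompactSupport ζ)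
    (hζΩ : tsupport ζ ⊆ Ω) : IntegrableOn (fun x => ζ x * signPos (u x) * f x) Ω := by
  obtain ⟨C, hC⟩ := hζc.exists_bound_of_continuous hζ
  have hK := hf.integrableOn_compact_subset hζΩ hζc
  have hI : Integrable ((tsupport ζ).indicator f) :=
    (integrable_indicator_iff (isClosed_tsupport ζ).measurableSet).2 hK
  refine (hI.norm.const_mul C).restrict.mono' ((hζ.aestronglyMeasurable.mul
    (measurable_signPos.comp_aemeasurable hu.aemeasurable).aestronglyMeasurable).mul hfm)
    (ae_of_all _ fun x => ?_)
  by_cases hx : x ∈ tsupport ζ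
  · rw [indicator_of_mem hx, norm_mul, norm_mul]
    refine mul_le_mul_of_nonneg_right ?_ (norm_nonneg _)
    exact (mul_le_of_le_one_right (norm_nonneg _) (abs_signPos_le_one _)).trans (hC x)
  · simp [image_eq_zero_of_notMem_tsupport hx, indicator_of_notMem hx]

theorem Lstar_add {φ ψ : EuclideanSpace ℝ (Fin n) → ℝ} (hφ : ContDiff ℝ 2 φ) (hψ : ContDiff ℝ 2 ψ)
    (x : EuclideanSpace ℝ (Fin n)) :
    Lstar U (fun x => φ x + ψ x) x = Lstar U φ x + Lstar U ψ x := by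
  have h1 := (hφ.contDiffAt (x := x)).laplacian_add (hψ.contDiffAt (x := x))
  have h2 := fderiv_fun_add ((hφ.differentiable (by norm_num)) x)
    ((hψ.differentiable (by norm_num)) x)
  change Laplacian.laplacian (fun x => φ x + ψ x) x = _ at h1
  simp only [Lstar, h1, h2, add_apply]
  ring

theorem IsTestFunction.add {φ ψ : EuclideanSpace ℝ (Fin n) → ℝ} (hφ : IsTestFunction Ω φ)
    (hψ : IsTestFunction Ω ψ) : IsTestFunction Ω fun x => φ x + ψ x :=
  ⟨hφ.smooth.add hψ.smooth, hφ.compact.add hψ.compact,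
    (tsupport_add φ ψ).trans (union_subset hφ.supp hψ.supp)⟩

theorem isTestFunction_zero : IsTestFunction Ω fun _ => 0 :=
  ⟨contDiff_const, HasCompactSupport.zero, by simp [tsupport, Function.support]⟩

/-- Locality of the Kato inequality for smooth test functions. -/
theorem kato_of_forall_ball (hu : Integrable u (volume.restrict Ω))
    (hU : Integrable U (volume.restrict Ω)) (huU : Integrable (fun x => u x • U x) (volume.restrict Ω))
    (hf : LocallyIntegrableOn f Ω) (hfm : AEStronglyMeasurable f (volume.restrict Ω))
    (hloc : ∀ x₀ ∈ Ω, ∃ ρ > 0, Metric.ball x₀ ρ ⊆ Ω ∧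
      ∀ ζ, IsTestFunction (Metric.ball x₀ ρ) ζ → (∀ x, 0 ≤ ζ x) →
      ∫ x in Ω, max (u x) 0 * Lstar U ζ x ≤ ∫ x in Ω, ζ x * signPos (u x) * f x)
    {ζ : EuclideanSpace ℝ (Fin n) → ℝ} (hζ : IsTestFunction Ω ζ) (hζ0 : ∀ x, 0 ≤ ζ x) :
    ∫ x in Ω, max (u x) 0 * Lstar U ζ x ≤ ∫ x in Ω, ζ x * signPos (u x) * f x := by
  choose! ρ hρ hρΩ hk using hloc
  obtain ⟨t, htK, htcov⟩ := hζ.compact.elim_nhds_subcover (fun x => Metric.ball x (ρ x))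
    fun x hx => Metric.ball_mem_nhds x (hρ x (hζ.supp hx))
  -- The partition sums to one on the whole of `tsupport ζ`. Each `P i * ζ` is a nonnegative test
  -- function in one ball, and both sides of the inequality are additive in the test function.
  obtain ⟨P, hP⟩ := SmoothPartitionOfUnity.exists_isSubordinate 𝓘(ℝ, EuclideanSpace ℝ (Fin n))
    (isClosed_tsupport ζ) (fun i : t => Metric.ball (i : EuclideanSpace ℝ (Fin n)) (ρ i))
    (fun i => Metric.isOpen_ball) (by rwa [iUnion_subtype (· ∈ t)
      (fun i => Metric.ball (i : EuclideanSpace ℝ (Fin n)) (ρ i))])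
  have hmem : ∀ i : t, (i : EuclideanSpace ℝ (Fin n)) ∈ Ω := fun i => hζ.supp (htK i i.2)
  have htest : ∀ i : t, IsTestFunction (Metric.ball (i : EuclideanSpace ℝ (Fin n)) (ρ i))
      fun x => P i x * ζ x := fun i =>
    ⟨(P i).contMDiff.contDiff.mul hζ.smooth, hζ.compact.mul_left,
      (tsupport_mul_subset_left).trans (hP i)⟩
  have hind : ∀ s : Finset t, IsTestFunction Ω (fun x => ∑ i ∈ s, P i x * ζ x) ∧
      ∫ x in Ω, max (u x) 0 * Lstar U (fun x => ∑ i ∈ s, P i x * ζ x) x ≤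
        ∫ x in Ω, (∑ i ∈ s, P i x * ζ x) * signPos (u x) * f x := by
    classical
    intro s
    induction s using Finset.induction_on with
    | empty =>
      simp only [Finset.sum_empty]
      refine ⟨isTestFunction_zero, ?_⟩
      have h1 : ∀ x, Lstar U (fun _ => (0 : ℝ)) x = 0 := fun x => by
        have := laplacian_eq_zero_of_notMem_tsupport
          (f := fun _ : EuclideanSpace ℝ (Fin n) => (0 : ℝ)) (x := x)
          (by simp [tsupport, Function.support])
        simp [Lstar, this]
      simp [h1]
    | insert i s hi ih =>
      simp only [Finset.sum_insert hi]
      have hti := (htest i).mono (hρΩ _ (hmem i))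
      refine ⟨hti.add ih.1, ?_⟩
      simp_rw [Lstar_add hti.contDiff_two ih.1.contDiff_two, mul_add, add_mul]
      rw [integral_add (integrable_posPart_mul_Lstar_of_compact hu hU huU hti.contDiff_two
          hti.compact) (integrable_posPart_mul_Lstar_of_compact hu hU huU ih.1.contDiff_two
          ih.1.compact),
        integral_add (integrableOn_mul_signPos_mul hu.1 hf hfm
          hti.smooth.continuous hti.compact hti.supp)
          (integrableOn_mul_signPos_mul hu.1 hf hfm
          ih.1.smooth.continuous ih.1.compact ih.1.supp)]
      exact add_le_add (hk _ (hmem i) _ (htest i) fun x => mul_nonneg (P.nonneg i x) (hζ0 x)) ih.2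
  have hsum : (fun x => ∑ i, P i x * ζ x) = ζ := by
    funext x
    by_cases hx : x ∈ tsupport ζ
    · have := P.sum_eq_one hx
      rw [finsum_eq_sum_of_fintype] at this
      rw [← Finset.sum_mul, this, one_mul]
    · simp [image_eq_zero_of_notMem_tsupport hx]
  have hfin := (hind Finset.univ).2
  have hsum' : ∀ x, ∑ i, P i x * ζ x = ζ x := congrFun hsum
  rw [hsum] at hfin
  simpa only [hsum'] using hfin

/-- The Kato inequality extends from smooth to `C²` compactly supported test functions. -/
theorem kato_contDiff_two (hΩ : IsOpen Ω) (hu : Integrable u (volume.restrict Ω))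
    (hU : Integrable U (volume.restrict Ω)) (huU : Integrable (fun x => u x • U x) (volume.restrict Ω))
    (hf : LocallyIntegrableOn f Ω) (hfm : AEStronglyMeasurable f (volume.restrict Ω))
    (hsmooth : ∀ ζ, IsTestFunction Ω ζ → (∀ x, 0 ≤ ζ x) →
      ∫ x in Ω, max (u x) 0 * Lstar U ζ x ≤ ∫ x in Ω, ζ x * signPos (u x) * f x)
    {ζ : EuclideanSpace ℝ (Fin n) → ℝ} (hζ : ContDiff ℝ 2 ζ) (hζc : HasCompactSupport ζ)
    (hζΩ : tsupport ζ ⊆ Ω) (hζ0 : ∀ x, 0 ≤ ζ x) :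
    ∫ x in Ω, max (u x) 0 * Lstar U ζ x ≤ ∫ x in Ω, ζ x * signPos (u x) * f x := by
  have hL := continuous_laplacian hζ
  have hD : Continuous (fderiv ℝ ζ) := hζ.continuous_fderiv (by norm_num)
  obtain ⟨C₀, hC₀⟩ := hζc.exists_bound_of_continuous hζ.continuous
  obtain ⟨C₁, hC₁⟩ := (hasCompactSupport_laplacian hζc).exists_bound_of_continuous hL
  obtain ⟨C₂, hC₂⟩ := (hζc.fderiv ℝ).exists_bound_of_continuous hD
  have hζ1 : ContDiff ℝ 1 ζ := hζ.of_le (by norm_num)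
  have hLk : ∀ k x, Laplacian.laplacian (moll k ζ) x = moll k (Laplacian.laplacian ζ) x :=
    fun k x => congrFun (laplacian_moll hζ hζc k) x
  have hDk : ∀ k x, fderiv ℝ (moll k ζ) x = moll k (fderiv ℝ ζ) x :=
    fun k x => congrFun (fderiv_moll hζ1 hζc k) x
  have hs : ∀ k, ContDiff ℝ ∞ (moll k ζ) := fun k => contDiff_moll_compact k hζ.continuous
  have hs2 : ∀ k, ContDiff ℝ 2 (moll k ζ) := fun k => contDiff_infty.1 (hs k) 2
  obtain ⟨A, hAo, hζA, hAΩ, hAc⟩ := exists_open_between_and_isCompact_closure hζc hΩ hζΩ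
  have hev := eventually_cthickening_subset hζc hAo hζA
  have hsuppA : ∀ᶠ k in atTop, tsupport (moll k ζ) ⊆ A :=
    hev.mono fun k hk => (tsupport_moll_subset k).trans hk
  refine le_of_tendsto_of_tendsto (b := atTop) ?_ ?_ (hsuppA.mono fun k hk =>
    hsmooth (moll k ζ) ⟨hs k, hasCompactSupport_moll k hζc, hk.trans (subset_closure.trans hAΩ)⟩
      (moll_nonneg hζ0))
  · refine tendsto_integral_of_dominated_convergence
      (fun x => C₁ * ‖u x‖ + C₂ * ‖u x • U x‖) (fun k =>
        (hu.1.sup aestronglyMeasurable_const).mul (aestronglyMeasurable_Lstar hU.1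
          (continuous_laplacian (hs2 k)).aestronglyMeasurable
          ((hs2 k).continuous_fderiv (by norm_num)).aestronglyMeasurable))
      ((hu.norm.const_mul C₁).add (huU.norm.const_mul C₂)) (fun k => ae_of_all _ fun x => ?_)
      (ae_of_all _ fun x => ?_)
    · refine abs_posPart_mul_Lstar_le ?_ ?_
      · rw [hLk, ← Real.norm_eq_abs]
        exact norm_moll_le hC₁ x
      · rw [hDk]
        exact norm_moll_le hC₂ x
    · refine Tendsto.const_mul _ (Tendsto.sub (Tendsto.neg ?_) ?_)
      · simp_rw [hLk]
        exact tendsto_moll hL x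
      · simp_rw [hDk]
        exact ((ContinuousLinearMap.apply ℝ ℝ (U x)).continuous.tendsto _).comp (tendsto_moll hD x)
  -- As `f` is only locally integrable, domination takes place on the fixed compact set `closure A`,
  -- which eventually contains the supports of all the mollified test functions.
  · have hI : Integrable ((closure A).indicator f) :=
      (integrable_indicator_iff isClosed_closure.measurableSet).2
        (hf.integrableOn_compact_subset hAΩ hAc)
    refine tendsto_integral_filter_of_dominated_convergence
      (fun x => C₀ * ‖(closure A).indicator f x‖) (Eventually.of_forall fun k =>
        (((hs k).continuous.aestronglyMeasurable.mul (measurable_signPos.comp_aemeasurable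
          hu.1.aemeasurable).aestronglyMeasurable).mul hfm)) (hsuppA.mono fun k hk =>
        ae_of_all _ fun x => ?_) (hI.norm.const_mul C₀).restrict (ae_of_all _ fun x => ?_)
    · by_cases hx : x ∈ closure A
      · rw [indicator_of_mem hx, norm_mul, norm_mul]
        refine mul_le_mul_of_nonneg_right ?_ (norm_nonneg _)
        exact (mul_le_of_le_one_right (norm_nonneg _) (abs_signPos_le_one _)).trans
          (norm_moll_le hC₀ x)
      · simp [image_eq_zero_of_notMem_tsupport fun h => hx (subset_closure (hk h)),
          indicator_of_notMem hx]
    · exact ((tendsto_moll hζ.continuous x).mul_const _).mul_const _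

end Interior

/-! ### Pointwise estimates for functions in `W₂` -/

section BoundaryEstimates

variable {n : ℕ} {Ω : Set (EuclideanSpace ℝ (Fin n))} {φ : EuclideanSpace ℝ (Fin n) → ℝ}

/-- A nearest point of the complement lies on the frontier, so the distances to the frontier and to
the complement agree. -/
theorem exists_mem_frontier_bdist_eq (hn : 2 ≤ n) (hΩ : IsOpen Ω)
    (hΩb : Bornology.IsBounded Ω) {x : EuclideanSpace ℝ (Fin n)} (hx : x ∈ Ω) :
    Metric.ball x (bdist Ω x) ⊆ Ω ∧ ∃ z ∈ frontier Ω, bdist Ω x = dist x z := by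
  have hne : Ω ≠ univ := by
    rintro rfl
    simpa using frontier_nonempty_of_isBounded hn hΩb ⟨x, hx⟩
  obtain ⟨z, hz, hd⟩ := exists_mem_frontier_infDist_compl_eq_dist hx hne
  have h1 : bdist Ω x = Metric.infDist x Ωᶜ := by
    refine le_antisymm ?_ (Metric.infDist_le_infDist_of_subset ?_ ⟨z, hz⟩)
    · rw [hd]
      exact Metric.infDist_le_dist_of_mem hz
    · rw [hΩ.frontier_eq]
      exact fun y hy => hy.2
  refine ⟨?_, z, hz, h1.trans hd⟩
  rw [h1]
  exact Metric.ball_infDist_compl_subset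

theorem exists_bdist_le (hΩb : Bornology.IsBounded Ω) :
    ∃ D, ∀ x ∈ Ω, bdist Ω x ≤ D := by
  obtain ⟨D, hD⟩ := hΩb.isCompact_closure.exists_bound_of_continuousOn
    (continuous_bdist (Ω := Ω)).continuousOn
  exact ⟨D, fun x hx => (le_abs_self _).trans (hD x (subset_closure hx))⟩

theorem MemW2.exists_bound (hφ : MemW2 Ω φ) (hΩb : Bornology.IsBounded Ω) :
    ∃ C, 0 ≤ C ∧ ∀ x ∈ Ω, |φ x| ≤ C ∧ ‖fderiv ℝ φ x‖ ≤ C ∧ ‖fderiv ℝ (fderiv ℝ φ) x‖ ≤ C := by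
  obtain ⟨C₀, h₀⟩ := hΩb.isCompact_closure.exists_bound_of_continuousOn hφ.continuousOn
  obtain ⟨D, hD, hDe⟩ := hφ.extend_fderiv
  obtain ⟨H, hH, hHe⟩ := hφ.extend_fderiv_two
  obtain ⟨C₁, h₁⟩ := hΩb.isCompact_closure.exists_bound_of_continuousOn hD
  obtain ⟨C₂, h₂⟩ := IsCompact.exists_bound_of_continuousOn
    (E := EuclideanSpace ℝ (Fin n) →L[ℝ] EuclideanSpace ℝ (Fin n) →L[ℝ] ℝ)
    hΩb.isCompact_closure hH
  refine ⟨max 0 (max C₀ (max C₁ C₂)), le_max_left _ _, fun x hx => ⟨?_, ?_, ?_⟩⟩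
  · exact (h₀ x (subset_closure hx)).trans (by simp)
  · rw [← hDe hx]
    exact (h₁ x (subset_closure hx)).trans (by simp)
  · rw [← hHe hx]
    exact (h₂ x (subset_closure hx)).trans (by simp)

theorem MemW2.contDiffAt (hφ : MemW2 Ω φ) (hΩ : IsOpen Ω) {x : EuclideanSpace ℝ (Fin n)}
    (hx : x ∈ Ω) : ContDiffAt ℝ 2 φ x :=
  hφ.contDiffOn.contDiffAt (hΩ.mem_nhds hx)

theorem abs_laplacian_le {x : EuclideanSpace ℝ (Fin n)} {C : ℝ}
    (hC : ‖fderiv ℝ (fderiv ℝ φ) x‖ ≤ C) : |Laplacian.laplacian φ x| ≤ n * C := by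
  rw [laplacian_eq_sum]
  refine (Finset.abs_sum_le_sum_abs _ _).trans ?_
  refine (Finset.sum_le_card_nsmul _ _ C fun i _ => ?_).trans (by simp)
  refine ((fderiv ℝ (fderiv ℝ φ) x).le_opNorm₂ _ _).trans ?_
  simpa using hC

theorem MemW2.aestronglyMeasurable_fderiv (hφ : MemW2 Ω φ) (hΩ : IsOpen Ω) :
    AEStronglyMeasurable (fderiv ℝ φ) (volume.restrict Ω) :=
  (hφ.contDiffOn.continuousOn_fderiv_of_isOpen hΩ (by norm_num)).aestronglyMeasurable
    hΩ.measurableSet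

theorem MemW2.aestronglyMeasurable_laplacian (hφ : MemW2 Ω φ) (hΩ : IsOpen Ω) :
    AEStronglyMeasurable (Laplacian.laplacian φ) (volume.restrict Ω) := by
  obtain ⟨H, hH, hHe⟩ := hφ.extend_fderiv_two
  have h1 : ContinuousOn (fderiv ℝ (fderiv ℝ φ)) Ω := (hH.mono subset_closure).congr hHe.symm
  have h2 : Laplacian.laplacian φ = fun x => ∑ i : Fin n,
      fderiv ℝ (fderiv ℝ φ) x (EuclideanSpace.single i 1) (EuclideanSpace.single i 1) :=
    funext fun x => laplacian_eq_sum φ x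
  rw [h2]
  refine ContinuousOn.aestronglyMeasurable ?_ hΩ.measurableSet
  exact continuousOn_finsetSum _ fun i _ =>
    (h1.clm_apply continuousOn_const).clm_apply continuousOn_const

/-- Mean value inequality on the ball of radius `δ(x)`, which is convex and contained in `Ω`
whatever the shape of `Ω`, extended by continuity to the nearest boundary point, where `φ` vanishes.
-/
theorem MemW2.abs_le_mul_bdist (hφ : MemW2 Ω φ) (hn : 2 ≤ n) (hΩ : IsOpen Ω)
    (hΩb : Bornology.IsBounded Ω) {C : ℝ} (hC : ∀ x ∈ Ω, ‖fderiv ℝ φ x‖ ≤ C)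
    {x : EuclideanSpace ℝ (Fin n)} (hx : x ∈ Ω) : |φ x| ≤ C * bdist Ω x := by
  obtain ⟨hball, z, hz, hd⟩ := exists_mem_frontier_bdist_eq hn hΩ hΩb hx
  have hpos := bdist_pos hn hΩ hΩb hx
  have h1 : ∀ y ∈ Metric.ball x (bdist Ω x), |φ y - φ x| ≤ C * ‖y - x‖ := fun y hy =>
    (convex_ball x (bdist Ω x)).norm_image_sub_le_of_norm_fderiv_le
      (fun w hw => (hφ.contDiffAt hΩ (hball hw)).differentiableAt (by norm_num))
      (fun w hw => hC w (hball hw)) (Metric.mem_ball_self hpos) hy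
  have hzc : z ∈ closure (Metric.ball x (bdist Ω x)) := by
    rw [closure_ball x hpos.ne', Metric.mem_closedBall, dist_comm, hd]
  have hcont : ContinuousWithinAt φ (Metric.ball x (bdist Ω x)) z :=
    (hφ.continuousOn z (frontier_subset_closure hz)).mono (hball.trans subset_closure)
  have h2 : |φ z - φ x| ≤ C * ‖z - x‖ := ContinuousWithinAt.closure_le hzc
    (hcont.sub continuousWithinAt_const).abs
    (by fun_prop) h1
  rwa [hφ.boundary z hz, zero_sub, abs_neg, ← dist_eq_norm, dist_comm, ← hd] at h2

/-- Two mean value inequalities on the closed ball of radius `‖v‖`; the constant `C` instead of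
`C/2` is immaterial. -/
theorem abs_taylor_le (hn : 2 ≤ n) (hΩ : IsOpen Ω) (hΩb : Bornology.IsBounded Ω)
    (hφ : MemW2 Ω φ) {C : ℝ} (hC : ∀ x ∈ Ω, ‖fderiv ℝ (fderiv ℝ φ) x‖ ≤ C)
    {x v : EuclideanSpace ℝ (Fin n)} (hx : x ∈ Ω) (hv : ‖v‖ < bdist Ω x) :
    x + v ∈ Ω ∧ |φ (x + v) - φ x - fderiv ℝ φ x v| ≤ C * ‖v‖ ^ 2 := by
  obtain ⟨hball, -⟩ := exists_mem_frontier_bdist_eq hn hΩ hΩb hx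
  have hsub : Metric.closedBall x ‖v‖ ⊆ Ω := (Metric.closedBall_subset_ball hv).trans hball
  have hxs : x ∈ Metric.closedBall x ‖v‖ := Metric.mem_closedBall_self (norm_nonneg _)
  have hvs : x + v ∈ Metric.closedBall x ‖v‖ := by simp
  have hC0 : 0 ≤ C := (norm_nonneg (fderiv ℝ (fderiv ℝ φ) x)).trans (hC x hx)
  refine ⟨hsub hvs, ?_⟩
  have h1 : ∀ y ∈ Metric.closedBall x ‖v‖, ‖fderiv ℝ φ y - fderiv ℝ φ x‖ ≤ C * ‖v‖ := by
    intro y hy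
    refine ((convex_closedBall x ‖v‖).norm_image_sub_le_of_norm_fderiv_le
      (fun w hw => differentiableAt_fderiv (hφ.contDiffAt hΩ (hsub hw)))
      (fun w hw => hC w (hsub hw)) hxs hy).trans ?_
    rw [Metric.mem_closedBall, dist_eq_norm] at hy
    gcongr
  have h2 := (convex_closedBall x ‖v‖).norm_image_sub_le_of_norm_fderiv_le'
    (fun w hw => (hφ.contDiffAt hΩ (hsub hw)).differentiableAt (by norm_num)) h1 hxs hvs
  simp only [add_sub_cancel_left, Real.norm_eq_abs] at h2
  linarith [sq ‖v‖, mul_assoc C ‖v‖ ‖v‖, h2, congrArg (C * ·) (sq ‖v‖)]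

/-- A nonnegative function with bounded second derivatives satisfies `|∇φ|² ≤ C φ / δ`. -/
theorem sq_norm_fderiv_le (hn : 2 ≤ n) (hΩ : IsOpen Ω) (hΩb : Bornology.IsBounded Ω)
    (hφ : MemW2 Ω φ) (hφ0 : ∀ x ∈ Ω, 0 ≤ φ x) : ∃ A, 0 ≤ A ∧ ∀ x ∈ Ω,
      ‖fderiv ℝ φ x‖ ^ 2 * bdist Ω x ≤ A * φ x := by
  obtain ⟨C', hC'0, hC'⟩ := hφ.exists_bound hΩb
  obtain ⟨D, hD⟩ := exists_bdist_le hΩb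
  -- The added `1` makes `C` positive, since it is divided by.
  set C := C' + 1 with hCdef
  have hC1 : ∀ x ∈ Ω, ‖fderiv ℝ φ x‖ ≤ C := fun x hx => (hC' x hx).2.1.trans (by linarith)
  have hC2 : ∀ x ∈ Ω, ‖fderiv ℝ (fderiv ℝ φ) x‖ ≤ C := fun x hx =>
    (hC' x hx).2.2.trans (by linarith)
  have hCpos : 0 < C := by linarith
  refine ⟨4 * C * |D| + 4 * C, by positivity, fun x hx => ?_⟩
  have hδ := bdist_pos hn hΩ hΩb hx
  set δ := bdist Ω x with hδdef
  have hδD : δ ≤ |D| := (hD x hx).trans (le_abs_self _)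
  have hp := hφ0 x hx
  have hgrad : ‖gradient φ x‖ = ‖fderiv ℝ φ x‖ := by
    rw [gradient]
    exact LinearIsometryEquiv.norm_map _ _
  set g := ‖fderiv ℝ φ x‖ with hg
  have hg0 : 0 ≤ g := norm_nonneg _
  rcases hg0.eq_or_lt with h0 | hgpos
  · rw [← h0]
    simp only [ne_eq, OfNat.ofNat_ne_zero, not_false_eq_true, zero_pow, zero_mul]
    positivity
  -- Moving a distance `t` against the gradient: `0 ≤ φ(x + v) ≤ φ(x) - t g + C t²`.
  have key : ∀ t, 0 ≤ t → t < δ → t * g ≤ φ x + C * t ^ 2 := by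
    intro t ht htδ
    set v : EuclideanSpace ℝ (Fin n) := -((t / g) • gradient φ x) with hvdef
    have hv : ‖v‖ = t := by
      rw [hvdef, norm_neg, norm_smul, hgrad, Real.norm_eq_abs, abs_of_nonneg (by positivity)]
      field_simp
    obtain ⟨hmem, hT⟩ := abs_taylor_le hn hΩ hΩb hφ hC2 hx (v := v) (by rw [hv]; exact htδ)
    have hDv : fderiv ℝ φ x v = -(t * g) := by
      rw [hvdef, map_neg, map_smul, ← inner_gradient, real_inner_self_eq_norm_sq, hgrad,
        smul_eq_mul]
      field_simp
    rw [hDv, hv] at hT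
    have h1 := (abs_le.1 hT).2
    have h2 := hφ0 _ hmem
    linarith
  -- The best step is `t = g/(2C)` if it fits inside the ball. Otherwise `g ≥ 2Cδ`, and `t = δ/2`
  -- suffices because `C t²` is then at most `gδ/8`.
  rcases lt_or_ge (g / (2 * C)) δ with h | h
  · have h1 := key (g / (2 * C)) (by positivity) h
    have h2 : g ^ 2 ≤ 4 * C * φ x := by
      have h3 : g / (2 * C) * g - C * (g / (2 * C)) ^ 2 = g ^ 2 / (4 * C) := by
        field_simp
        ring
      have h4 : g ^ 2 / (4 * C) ≤ φ x := by linarith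
      rw [div_le_iff₀ (by positivity)] at h4
      linarith
    calc g ^ 2 * δ ≤ (4 * C * φ x) * |D| := by gcongr
      _ ≤ (4 * C * |D| + 4 * C) * φ x := by nlinarith [mul_nonneg hCpos.le hp]
  · have h1 := key (δ / 2) (by positivity) (by linarith)
    rw [le_div_iff₀ (by positivity)] at h
    have h2 : g * δ ≤ 4 * φ x := by nlinarith
    calc g ^ 2 * δ = g * (g * δ) := by ring
      _ ≤ C * (4 * φ x) := by
        gcongr
        exact hC1 x hx
      _ ≤ (4 * C * |D| + 4 * C) * φ x := by
        have : 0 ≤ 4 * C * |D| * φ x := by positivity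
        linarith

theorem hasDerivAt_line {x e : EuclideanSpace ℝ (Fin n)} (t : ℝ) :
    HasDerivAt (fun s : ℝ => x + s • e) e t := by
  simpa using ((hasDerivAt_id t).smul_const e).const_add x

/-- Second-order necessary condition at an interior minimum. -/
theorem laplacian_nonneg_of_isLocalMin {x : EuclideanSpace ℝ (Fin n)} (hφ : ContDiffAt ℝ 2 φ x)
    (hmin : IsLocalMin φ x) : 0 ≤ Laplacian.laplacian φ x := by
  rw [laplacian_eq_sum_pd hφ]
  refine Finset.sum_nonneg fun i _ => ?_
  set e : EuclideanSpace ℝ (Fin n) := EuclideanSpace.single i 1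
  set g : ℝ → ℝ := fun t => φ (x + t • e) with hg
  have hline : Tendsto (fun t : ℝ => x + t • e) (𝓝 0) (𝓝 x) := by
    have := (hasDerivAt_line (x := x) (e := e) 0).continuousAt.tendsto
    simpa using this
  have hd : ∀ᶠ t in 𝓝 (0 : ℝ), deriv g t = pd i φ (x + t • e) := by
    have h1 : ∀ᶠ y in 𝓝 x, DifferentiableAt ℝ φ y :=
      (hφ.eventually (by simp)).mono fun y hy => hy.differentiableAt (by norm_num)
    filter_upwards [hline.eventually h1] with t ht
    exact (ht.hasFDerivAt.comp_hasDerivAt t (hasDerivAt_line t)).deriv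
  have hdd : deriv (deriv g) 0 = pd i (pd i φ) x := by
    rw [EventuallyEq.deriv_eq hd]
    have h0 : DifferentiableAt ℝ (pd i φ) x :=
      (differentiableAt_fderiv hφ).clm_apply (differentiableAt_const _)
    have h1 : HasFDerivAt (pd i φ) (fderiv ℝ (pd i φ) x) (x + (0 : ℝ) • e) := by
      simpa using h0.hasFDerivAt
    exact (h1.comp_hasDerivAt (0 : ℝ) (hasDerivAt_line 0)).deriv
  have hgmin : IsLocalMin g 0 := by
    have := hline.eventually hmin
    filter_upwards [this] with t ht
    simpa [hg] using ht
  by_contra hneg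
  rw [not_le, ← hdd] at hneg
  have hcont : ContinuousAt g 0 := by
    refine ContinuousAt.comp (f := fun t : ℝ => x + t • e) (g := φ) ?_
      (hasDerivAt_line 0).continuousAt
    simpa using hφ.continuousAt
  -- A negative second derivative would make `0` a local maximum as well, so `g` would be locally
  -- constant with zero second derivative.
  have hmax := isLocalMax_of_deriv_deriv_neg hneg hgmin.deriv_eq_zero hcont
  have hconst : g =ᶠ[𝓝 0] fun _ => g 0 := by
    filter_upwards [hmax, hgmin] with t h1 h2 using le_antisymm h1 h2
  have h3 : deriv (deriv g) 0 = 0 := by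
    rw [hconst.deriv.deriv_eq]
    simp
  linarith

end BoundaryEstimates

/-! ### Truncation of small values -/

section Cut

theorem deriv_trans_of_neg {ε : ℝ} (hε : 0 < ε) {s : ℝ} (hs : s < 0) : deriv (trans ε) s = 0 := by
  have : trans ε =ᶠ[𝓝 s] fun _ => 0 :=
    eventually_of_mem (Iio_mem_nhds hs) fun t ht => trans_of_nonpos hε (le_of_lt ht)
  rw [this.deriv_eq]
  simp

theorem deriv_trans_of_lt {ε : ℝ} (hε : 0 < ε) {s : ℝ} (hs : ε < s) : deriv (trans ε) s = 0 := by
  have : trans ε =ᶠ[𝓝 s] fun _ => 1 :=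
    eventually_of_mem (Ioi_mem_nhds hs) fun t ht => trans_of_le hε (le_of_lt ht)
  rw [this.deriv_eq]
  simp

/-- Smooth convex approximation of the identity on `[0, ∞)` that vanishes near `0`. -/
def cut (k : ℕ) (s : ℝ) : ℝ := prim 1 (((k : ℝ) + 1) * s - 1) / ((k : ℝ) + 1)

theorem contDiff_cut (k : ℕ) : ContDiff ℝ 2 (cut k) :=
  ((contDiff_infty.1 contDiff_prim 2).comp
    ((contDiff_const.mul contDiff_id).sub contDiff_const)).div_const _

theorem hasDerivAt_affine (k : ℕ) (s : ℝ) :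
    HasDerivAt (fun s : ℝ => ((k : ℝ) + 1) * s - 1) ((k : ℝ) + 1) s := by
  simpa using ((hasDerivAt_id s).const_mul ((k : ℝ) + 1)).sub_const 1

theorem hasDerivAt_cut (k : ℕ) (s : ℝ) :
    HasDerivAt (cut k) (trans 1 (((k : ℝ) + 1) * s - 1)) s := by
  have h1 := ((hasDerivAt_prim (ε := 1) (((k : ℝ) + 1) * s - 1)).comp s
    (hasDerivAt_affine k s)).div_const ((k : ℝ) + 1)
  have hk : (k : ℝ) + 1 ≠ 0 := by positivity
  rwa [mul_div_cancel_right₀ _ hk] at h1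

/-- The second derivative of `cut k`. -/
def cutTwo (k : ℕ) (s : ℝ) : ℝ := deriv (trans 1) (((k : ℝ) + 1) * s - 1) * ((k : ℝ) + 1)

theorem hasDerivAt_deriv_cut (k : ℕ) (s : ℝ) :
    HasDerivAt (fun s => trans 1 (((k : ℝ) + 1) * s - 1)) (cutTwo k s) s :=
  HasDerivAt.comp (h₂ := trans 1) s (hasDerivAt_trans _) (hasDerivAt_affine k s)

theorem cut_nonneg (k : ℕ) (s : ℝ) : 0 ≤ cut k s :=
  div_nonneg (prim_nonneg one_pos _) (by positivity)

theorem cut_le (k : ℕ) {s : ℝ} (hs : 0 ≤ s) : cut k s ≤ s := by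
  rw [cut, div_le_iff₀ (by positivity)]
  refine (prim_le_posPart one_pos _).trans (max_le ?_ (by positivity))
  linarith

theorem cut_eq_zero {k : ℕ} {s : ℝ} (hs : s ≤ 1 / ((k : ℝ) + 1)) : cut k s = 0 := by
  rw [le_div_iff₀ (by positivity)] at hs
  rw [cut, prim_of_nonpos one_pos (by linarith), zero_div]

theorem tendsto_cut {s : ℝ} (hs : 0 ≤ s) : Tendsto (fun k => cut k s) atTop (𝓝 s) := by
  -- One `1/(k+1)` is lost to the shift by `1` in `cut`, the other to the gap between `prim 1` and
  -- the positive part.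
  have h1 : Tendsto (fun k : ℕ => s - 2 * (1 / ((k : ℝ) + 1))) atTop (𝓝 s) := by
    simpa using (tendsto_one_div_add_atTop_nhds_zero_nat (𝕜 := ℝ)).const_mul 2 |>.const_sub s
  refine tendsto_of_tendsto_of_tendsto_of_le_of_le h1 tendsto_const_nhds (fun k => ?_)
    fun k => cut_le k hs
  have hk : (0 : ℝ) < (k : ℝ) + 1 := by positivity
  simp only [cut]
  rw [le_div_iff₀ hk, sub_mul, mul_assoc, one_div_mul_cancel hk.ne']
  have h2 := posPart_sub_le_prim one_pos (((k : ℝ) + 1) * s - 1)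
  have h3 := le_max_left (((k : ℝ) + 1) * s - 1) 0
  linarith

theorem eventually_one_lt_affine {s : ℝ} (hs : 0 < s) :
    ∀ᶠ k : ℕ in atTop, 1 < ((k : ℝ) + 1) * s - 1 := by
  have h1 : Tendsto (fun k : ℕ => ((k : ℝ) + 1) * s - 1) atTop atTop :=
    tendsto_atTop_add_const_right _ _ ((tendsto_atTop_add_const_right _ _
      tendsto_natCast_atTop_atTop).atTop_mul_const hs)
  exact h1.eventually_gt_atTop 1

/-- At `s = 0` the argument of `trans` is `-1`, so the limit there is `0` and not `1`; the set `{φ =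
0}` therefore needs separate treatment at the end. -/
theorem tendsto_deriv_cut {s : ℝ} (hs : 0 ≤ s) :
    Tendsto (fun k : ℕ => trans 1 (((k : ℝ) + 1) * s - 1)) atTop (𝓝 (signPos s)) := by
  rcases hs.eq_or_lt with rfl | hs
  · have : ∀ k : ℕ, trans 1 (((k : ℝ) + 1) * 0 - 1) = 0 := fun k =>
      trans_of_nonpos one_pos (by norm_num)
    simp only [this, signPos, lt_irrefl, if_false, tendsto_const_nhds_iff]
  · rw [signPos, if_pos hs]
    exact tendsto_const_nhds.congr' ((eventually_one_lt_affine hs).mono fun k hk =>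
      (trans_of_le one_pos hk.le).symm)

theorem tendsto_cutTwo {s : ℝ} (hs : 0 ≤ s) : Tendsto (fun k => cutTwo k s) atTop (𝓝 0) := by
  rcases hs.eq_or_lt with rfl | hs
  · have : ∀ k : ℕ, cutTwo k 0 = 0 := fun k => by
      rw [cutTwo, deriv_trans_of_neg one_pos (by norm_num), zero_mul]
    simp [this]
  · exact tendsto_const_nhds.congr' ((eventually_one_lt_affine hs).mono fun k hk => by
      simp only [cutTwo, deriv_trans_of_lt one_pos hk, zero_mul])

theorem cutTwo_nonneg (k : ℕ) (s : ℝ) : 0 ≤ cutTwo k s :=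
  mul_nonneg (deriv_trans_nonneg one_pos _) (by positivity)

/-- The second derivative is of size `k + 1`, but only where `(k+1)s ≤ 2`; the product with `s` is
scale invariant. This matches the bound `|∇φ|² ≤ Aφ/δ`. -/
theorem exists_cutTwo_mul_le : ∃ C, 0 ≤ C ∧ ∀ (k : ℕ) (s : ℝ), cutTwo k s * s ≤ C := by
  obtain ⟨C, hC0, hC⟩ := exists_deriv_trans_le one_pos
  refine ⟨2 * C, by positivity, fun k s => ?_⟩
  rw [cutTwo]
  set a := ((k : ℝ) + 1) * s - 1 with ha
  have h0 := deriv_trans_nonneg one_pos a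
  rcases lt_or_ge 1 a with h | h
  · rw [deriv_trans_of_lt one_pos h]
    simp only [zero_mul]
    positivity
  · calc deriv (trans 1) a * ((k : ℝ) + 1) * s = deriv (trans 1) a * (a + 1) := by
          rw [ha]
          ring
      _ ≤ deriv (trans 1) a * 2 := by
          gcongr
          linarith
      _ ≤ 2 * C := by linarith [hC a]

end Cut

/-! ### Chain rule for the adjoint operator -/

section Composition

variable {n : ℕ} {φ : EuclideanSpace ℝ (Fin n) → ℝ}
  {U : EuclideanSpace ℝ (Fin n) → EuclideanSpace ℝ (Fin n)}

theorem sum_pd_mul_pd_eq (φ : EuclideanSpace ℝ (Fin n) → ℝ) (x : EuclideanSpace ℝ (Fin n)) :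
    ∑ i, pd i φ x * pd i φ x = ‖fderiv ℝ φ x‖ ^ 2 := by
  have hgrad : ‖gradient φ x‖ = ‖fderiv ℝ φ x‖ := LinearIsometryEquiv.norm_map _ _
  rw [← hgrad, EuclideanSpace.real_norm_sq_eq]
  exact Finset.sum_congr rfl fun i _ => by rw [gradient_apply, sq]

theorem laplacian_comp_real {h h' : ℝ → ℝ} {h'' : ℝ} {x : EuclideanSpace ℝ (Fin n)}
    (hh : ContDiff ℝ 2 h) (hh' : ∀ s, HasDerivAt h (h' s) s)
    (hh'' : HasDerivAt h' h'' (φ x)) (hφ : ContDiffAt ℝ 2 φ x) :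
    Laplacian.laplacian (fun y => h (φ y)) x =
      h'' * ‖fderiv ℝ φ x‖ ^ 2 + h' (φ x) * Laplacian.laplacian φ x := by
  have hd : ∀ᶠ y in 𝓝 x, DifferentiableAt ℝ φ y :=
    (hφ.eventually (by simp)).mono fun y hy => hy.differentiableAt (by norm_num)
  have hdx : DifferentiableAt ℝ φ x := hd.self_of_nhds
  have hc : ContDiffAt ℝ 2 (fun y => h (φ y)) x := hh.contDiffAt.comp x hφ
  rw [laplacian_eq_sum_pd hc, laplacian_eq_sum_pd hφ, ← sum_pd_mul_pd_eq,
    Finset.mul_sum, Finset.mul_sum, ← Finset.sum_add_distrib]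
  refine Finset.sum_congr rfl fun i _ => ?_
  have h1 : pd i (fun y => h (φ y)) =ᶠ[𝓝 x] fun y => h' (φ y) * pd i φ y := by
    filter_upwards [hd] with y hy
    simp only [pd]
    rw [fderiv_comp_real (hh' _) hy]
    rfl
  have h2 : DifferentiableAt ℝ (pd i φ) x :=
    (differentiableAt_fderiv hφ).clm_apply (differentiableAt_const _)
  have h3 : DifferentiableAt ℝ (fun y => h' (φ y)) x := hh''.differentiableAt.comp x hdx
  have h4 : pd i (pd i fun y => h (φ y)) x = pd i (fun y => h' (φ y) * pd i φ y) x := by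
    rw [pd, h1.fderiv_eq]
    rfl
  have h5 : pd i (fun y => h' (φ y)) x = h'' * pd i φ x := by
    rw [pd, fderiv_comp_real hh'' hdx]
    rfl
  rw [h4, pd_mul h3 h2, h5]
  ring

/-- For convex `h` the extra term `-h''|∇φ|²` has the unfavourable sign: it cannot be discarded from
the left side of Kato's inequality and must be shown to vanish in the limit. -/
theorem Lstar_comp_real {h h' : ℝ → ℝ} {h'' : ℝ} {x : EuclideanSpace ℝ (Fin n)}
    (hh : ContDiff ℝ 2 h) (hh' : ∀ s, HasDerivAt h (h' s) s)
    (hh'' : HasDerivAt h' h'' (φ x)) (hφ : ContDiffAt ℝ 2 φ x) :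
    Lstar U (fun y => h (φ y)) x = h' (φ x) * Lstar U φ x - h'' * ‖fderiv ℝ φ x‖ ^ 2 := by
  rw [Lstar, laplacian_comp_real hh hh' hh'' hφ, Lstar,
    fderiv_comp_real (hh' _) (hφ.differentiableAt (by norm_num)), smul_apply,
    smul_eq_mul]
  ring

theorem Lstar_congr {φ ψ : EuclideanSpace ℝ (Fin n) → ℝ} {x : EuclideanSpace ℝ (Fin n)}
    (h : φ =ᶠ[𝓝 x] ψ) : Lstar U φ x = Lstar U ψ x := by
  rw [Lstar, Lstar, h.fderiv_eq, (InnerProductSpace.laplacian_congr_nhds h).self_of_nhds]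

end Composition

/-! ### Truncated test functions -/

section Cutoff

variable {n : ℕ} {Ω : Set (EuclideanSpace ℝ (Fin n))} {φ : EuclideanSpace ℝ (Fin n) → ℝ}

/-- The truncation vanishes off `{φ ≥ 1/(k+1)}`, which is closed in `closure Ω` and misses the
boundary because `φ = 0` there; it is thus a compact subset of `Ω`, and extension by zero stays
`C²`. -/
theorem cutoff_regular (hΩ : IsOpen Ω) (hΩb : Bornology.IsBounded Ω) (hφ : MemW2 Ω φ) (k : ℕ) :
    ContDiff ℝ 2 (Ω.indicator fun x => cut k (φ x)) ∧
      HasCompactSupport (Ω.indicator fun x => cut k (φ x)) ∧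
      tsupport (Ω.indicator fun x => cut k (φ x)) ⊆ Ω := by
  set ζ := Ω.indicator fun x => cut k (φ x) with hζ
  set F : Set (EuclideanSpace ℝ (Fin n)) := closure Ω ∩ φ ⁻¹' Ici (1 / ((k : ℝ) + 1)) with hF
  have hFc : IsClosed F := hφ.continuousOn.preimage_isClosed_of_isClosed isClosed_closure
    isClosed_Ici
  have hFΩ : F ⊆ Ω := by
    intro x hx
    by_contra hxΩ
    have h1 := hφ.boundary x (by rw [hΩ.frontier_eq]; exact ⟨hx.1, hxΩ⟩)
    have h2 : 1 / ((k : ℝ) + 1) ≤ φ x := hx.2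
    rw [h1] at h2
    exact absurd h2 (not_le.2 (by positivity))
  have hzero : ∀ x, x ∉ F → ζ x = 0 := by
    intro x hx
    by_cases hxΩ : x ∈ Ω
    · rw [hζ, indicator_of_mem hxΩ]
      refine cut_eq_zero (le_of_not_ge fun h => hx ⟨subset_closure hxΩ, h⟩)
    · exact indicator_of_notMem hxΩ _
  have hts : tsupport ζ ⊆ F := closure_minimal
    (fun x hx => by_contra fun h => hx (hzero x h)) hFc
  refine ⟨contDiff_iff_contDiffAt.2 fun x => ?_, ?_, hts.trans hFΩ⟩
  · by_cases hx : x ∈ Ω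
    · have h1 : ContDiffAt ℝ 2 (fun y => cut k (φ y)) x :=
        (contDiff_cut k).contDiffAt.comp x (hφ.contDiffAt hΩ hx)
      exact h1.congr_of_eventuallyEq (eventually_of_mem (hΩ.mem_nhds hx)
        fun y hy => indicator_of_mem hy _)
    · have h1 : ContDiffAt ℝ 2 (fun _ : EuclideanSpace ℝ (Fin n) => (0 : ℝ)) x := contDiffAt_const
      exact h1.congr_of_eventuallyEq (eventually_of_mem
        (hFc.isOpen_compl.mem_nhds fun h => hx (hFΩ h)) fun y hy => hzero y hy)
  · exact (Metric.isCompact_of_isClosed_isBounded isClosed_closure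
      (hΩb.subset (hts.trans hFΩ)))

end Cutoff

/-! ### Kato's inequality up to the boundary -/

section Boundary

variable {n : ℕ} {Ω : Set (EuclideanSpace ℝ (Fin n))} {φ : EuclideanSpace ℝ (Fin n) → ℝ}
  {u f : EuclideanSpace ℝ (Fin n) → ℝ} {U : EuclideanSpace ℝ (Fin n) → EuclideanSpace ℝ (Fin n)}

theorem aestronglyMeasurable_of_mul_bdist (hn : 2 ≤ n) (hΩ : IsOpen Ω)
    (hΩb : Bornology.IsBounded Ω)
    (hf : AEStronglyMeasurable (fun x => f x * bdist Ω x) (volume.restrict Ω)) :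
    AEStronglyMeasurable f (volume.restrict Ω) := by
  have h1 : AEStronglyMeasurable (fun x => f x * bdist Ω x * (bdist Ω x)⁻¹) (volume.restrict Ω) :=
    hf.mul (continuous_bdist.measurable.inv.aestronglyMeasurable)
  refine h1.congr (ae_restrict_of_forall_mem hΩ.measurableSet fun x hx => ?_)
  exact mul_inv_cancel_right₀ (bdist_pos hn hΩ hΩb hx).ne' _

theorem locallyIntegrableOn_of_mul_bdist (hn : 2 ≤ n) (hΩ : IsOpen Ω)
    (hΩb : Bornology.IsBounded Ω) (hf : IntegrableOn (fun x => f x * bdist Ω x) Ω) :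
    LocallyIntegrableOn f Ω := by
  rw [locallyIntegrableOn_iff hΩ.isLocallyClosed]
  intro K hKΩ hK
  have h1 : ContinuousOn (fun x => (bdist Ω x)⁻¹) K := continuous_bdist.continuousOn.inv₀
    fun x hx => (bdist_pos hn hΩ hΩb (hKΩ hx)).ne'
  refine ((hf.mono_set hKΩ).mul_continuousOn h1 hK).congr_fun (fun x hx => ?_) hK.measurableSet
  exact mul_inv_cancel_right₀ (bdist_pos hn hΩ hΩb (hKΩ hx)).ne' _

/-- From `|φ| ≤ Cδ`. The factor `a` is left free so that the bound serves both `φ` and its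
truncations. -/
theorem norm_mul_signPos_mul_le (hn : 2 ≤ n) (hΩ : IsOpen Ω) (hΩb : Bornology.IsBounded Ω)
    (hφ : MemW2 Ω φ) {C : ℝ} (hC : ∀ x ∈ Ω, ‖fderiv ℝ φ x‖ ≤ C) {x : EuclideanSpace ℝ (Fin n)}
    (hx : x ∈ Ω) {a : ℝ} (ha : |a| ≤ |φ x|) :
    ‖a * signPos (u x) * f x‖ ≤ C * ‖f x * bdist Ω x‖ := by
  have h1 := ha.trans (hφ.abs_le_mul_bdist hn hΩ hΩb hC hx)
  rw [norm_mul, norm_mul, norm_mul, Real.norm_of_nonneg (bdist_pos hn hΩ hΩb hx).le]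
  calc ‖a‖ * ‖signPos (u x)‖ * ‖f x‖ ≤ (C * bdist Ω x) * ‖f x‖ :=
        mul_le_mul_of_nonneg_right ((mul_le_of_le_one_right (norm_nonneg _)
          (abs_signPos_le_one _)).trans h1) (norm_nonneg _)
    _ = _ := by ring

/-- The Kato inequality for the positive part, up to the boundary. -/
theorem kato_posPart_boundary (hn : 2 ≤ n) (hΩ : IsOpen Ω) (hΩb : Bornology.IsBounded Ω)
    (hu : Integrable u (volume.restrict Ω)) (hU : Integrable U (volume.restrict Ω))
    (huU : Integrable (fun x => u x • U x) (volume.restrict Ω))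
    (huw : IntegrableOn (fun x => u x / bdist Ω x) Ω)
    (hf : IntegrableOn (fun x => f x * bdist Ω x) Ω)
    (hint : ∀ ζ : EuclideanSpace ℝ (Fin n) → ℝ, ContDiff ℝ 2 ζ → HasCompactSupport ζ →
      tsupport ζ ⊆ Ω → (∀ x, 0 ≤ ζ x) →
      ∫ x in Ω, max (u x) 0 * Lstar U ζ x ≤ ∫ x in Ω, ζ x * signPos (u x) * f x)
    (hφ : MemW2 Ω φ) (hφ0 : ∀ x ∈ Ω, 0 ≤ φ x) :
    IntegrableOn (fun x => max (u x) 0 * Lstar U φ x) Ω ∧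
      IntegrableOn (fun x => φ x * signPos (u x) * f x) Ω ∧
      ∫ x in Ω, max (u x) 0 * Lstar U φ x ≤ ∫ x in Ω, φ x * signPos (u x) * f x := by
  have hΩm := hΩ.measurableSet
  have hfm := aestronglyMeasurable_of_mul_bdist hn hΩ hΩb hf.1
  have hsm : AEStronglyMeasurable (fun x => signPos (u x)) (volume.restrict Ω) :=
    (measurable_signPos.comp_aemeasurable hu.1.aemeasurable).aestronglyMeasurable
  have hφm : AEStronglyMeasurable φ (volume.restrict Ω) :=
    (hφ.continuousOn.mono subset_closure).aestronglyMeasurable hΩm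
  obtain ⟨C, hC0, hC⟩ := hφ.exists_bound hΩb
  have hC1 : ∀ x ∈ Ω, ‖fderiv ℝ φ x‖ ≤ C := fun x hx => (hC x hx).2.1
  obtain ⟨A, hA0, hA⟩ := sq_norm_fderiv_le hn hΩ hΩb hφ hφ0
  obtain ⟨B, hB0, hB⟩ := exists_cutTwo_mul_le
  have hLint : Integrable (fun x => max (u x) 0 * Lstar U φ x) (volume.restrict Ω) :=
    integrable_posPart_mul_Lstar hu hU huU (hφ.aestronglyMeasurable_laplacian hΩ)
      (hφ.aestronglyMeasurable_fderiv hΩ)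
      (ae_restrict_of_forall_mem hΩm fun x hx => abs_laplacian_le (hC x hx).2.2)
      (ae_restrict_of_forall_mem hΩm hC1)
  have hRint : Integrable (fun x => φ x * signPos (u x) * f x) (volume.restrict Ω) :=
    (hf.norm.const_mul C).mono' ((hφm.mul hsm).mul hfm) (ae_restrict_of_forall_mem hΩm fun x hx =>
      norm_mul_signPos_mul_le hn hΩ hΩb hφ hC1 hx le_rfl)
  refine ⟨hLint, hRint, ?_⟩
  have hreg := cutoff_regular hΩ hΩb hφ
  set ζ : ℕ → EuclideanSpace ℝ (Fin n) → ℝ := fun k => Ω.indicator fun x => cut k (φ x) with hζ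
  have hζx : ∀ k, ∀ x ∈ Ω, ζ k x = cut k (φ x) := fun k x hx => indicator_of_mem hx _
  have hLζ : ∀ k, ∀ x ∈ Ω, Lstar U (ζ k) x =
      trans 1 (((k : ℝ) + 1) * φ x - 1) * Lstar U φ x - cutTwo k (φ x) * ‖fderiv ℝ φ x‖ ^ 2 := by
    intro k x hx
    rw [← Lstar_comp_real (contDiff_cut k) (hasDerivAt_cut k) (hasDerivAt_deriv_cut k (φ x))
      (hφ.contDiffAt hΩ hx)]
    exact Lstar_congr (eventually_of_mem (hΩ.mem_nhds hx) (hζx k))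
  have hlimL : Tendsto (fun k => ∫ x in Ω, max (u x) 0 * Lstar U (ζ k) x) atTop
      (𝓝 (∫ x in Ω, signPos (φ x) * (max (u x) 0 * Lstar U φ x))) := by
    refine tendsto_integral_of_dominated_convergence
      (fun x => ‖max (u x) 0 * Lstar U φ x‖ + B * A * ‖u x / bdist Ω x‖) (fun k =>
        (hu.1.sup aestronglyMeasurable_const).mul (aestronglyMeasurable_Lstar hU.1
          (continuous_laplacian (hreg k).1).aestronglyMeasurable
          ((hreg k).1.continuous_fderiv (by norm_num)).aestronglyMeasurable))
      (hLint.norm.add (huw.norm.const_mul (B * A)))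
      (fun k => ae_restrict_of_forall_mem hΩm fun x hx => ?_)
      (ae_restrict_of_forall_mem hΩm fun x hx => ?_)
    · have hδ := bdist_pos hn hΩ hΩb hx
      -- The singular term is bounded by a multiple of `1/δ`, uniformly in `k`; multiplied by `|u|`
      -- it is dominated by the integrable function `BA|u|/δ`.
      have h1 : cutTwo k (φ x) * ‖fderiv ℝ φ x‖ ^ 2 ≤ B * A / bdist Ω x := by
        rw [le_div_iff₀ hδ]
        calc cutTwo k (φ x) * ‖fderiv ℝ φ x‖ ^ 2 * bdist Ω x
            = cutTwo k (φ x) * (‖fderiv ℝ φ x‖ ^ 2 * bdist Ω x) := by ring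
          _ ≤ cutTwo k (φ x) * (A * φ x) :=
              mul_le_mul_of_nonneg_left (hA x hx) (cutTwo_nonneg _ _)
          _ = cutTwo k (φ x) * φ x * A := by ring
          _ ≤ B * A := mul_le_mul_of_nonneg_right (hB _ _) hA0
      rw [hLζ k x hx, mul_sub]
      refine (norm_sub_le _ _).trans (add_le_add ?_ ?_)
      · rw [mul_left_comm, norm_mul]
        exact mul_le_of_le_one_left (norm_nonneg _) (abs_trans_le_one _)
      · rw [norm_mul, Real.norm_of_nonneg (mul_nonneg (cutTwo_nonneg k (φ x)) (sq_nonneg _)),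
          norm_div, Real.norm_of_nonneg hδ.le]
        calc ‖max (u x) 0‖ * (cutTwo k (φ x) * ‖fderiv ℝ φ x‖ ^ 2)
            ≤ ‖u x‖ * (B * A / bdist Ω x) := mul_le_mul (abs_max_zero_le _) h1
              (mul_nonneg (cutTwo_nonneg k (φ x)) (sq_nonneg _)) (norm_nonneg _)
          _ = _ := by ring
    · have h1 := ((tendsto_deriv_cut (hφ0 x hx)).mul_const (Lstar U φ x)).sub
        ((tendsto_cutTwo (hφ0 x hx)).mul_const (‖fderiv ℝ φ x‖ ^ 2))
      have h2 := h1.const_mul (max (u x) 0)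
      simp only [zero_mul, sub_zero] at h2
      rw [mul_left_comm]
      refine h2.congr fun k => ?_
      rw [hLζ k x hx]
  have hlimR : Tendsto (fun k => ∫ x in Ω, ζ k x * signPos (u x) * f x) atTop
      (𝓝 (∫ x in Ω, φ x * signPos (u x) * f x)) := by
    refine tendsto_integral_of_dominated_convergence (fun x => C * ‖f x * bdist Ω x‖) (fun k =>
        ((hreg k).1.continuous.aestronglyMeasurable.mul hsm).mul hfm) (hf.norm.const_mul C)
      (fun k => ae_restrict_of_forall_mem hΩm fun x hx => ?_)
      (ae_restrict_of_forall_mem hΩm fun x hx => ?_)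
    · refine norm_mul_signPos_mul_le hn hΩ hΩb hφ hC1 hx ?_
      rw [hζx k x hx, abs_of_nonneg (cut_nonneg _ _), abs_of_nonneg (hφ0 x hx)]
      exact cut_le k (hφ0 x hx)
    · refine Tendsto.mul_const _ (Tendsto.mul_const _ ?_)
      simp_rw [fun k => hζx k x hx]
      exact tendsto_cut (hφ0 x hx)
  have hlim := le_of_tendsto_of_tendsto' hlimL hlimR fun k =>
    hint (ζ k) (hreg k).1 (hreg k).2.1 (hreg k).2.2
      fun x => indicator_nonneg (fun x _ => cut_nonneg k (φ x)) x
  -- The limit carries the factor `sign₊(φ)` on the left; it may be removed because the integrand is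
  -- nonpositive on `{φ = 0}`.
  refine le_trans (integral_mono_ae hLint (hLint.bdd_mul (c := 1)
    (measurable_signPos.comp_aemeasurable hφm.aemeasurable).aestronglyMeasurable
    (ae_of_all _ fun x => abs_signPos_le_one _))
    (ae_restrict_of_forall_mem hΩm fun x hx => ?_)) hlim
  change max (u x) 0 * Lstar U φ x ≤ signPos (φ x) * (max (u x) 0 * Lstar U φ x)
  rcases (hφ0 x hx).eq_or_lt with h0 | hpos
  -- At an interior zero of `φ ≥ 0` one has `∇φ = 0` and `Δφ ≥ 0`, so `L*φ ≤ 0`.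
  · have hmin : IsLocalMin φ x := by
      filter_upwards [hΩ.mem_nhds hx] with y hy
      rw [← h0]
      exact hφ0 y hy
    have h1 := laplacian_nonneg_of_isLocalMin (hφ.contDiffAt hΩ hx) hmin
    have h2 : signPos (φ x) = 0 := by rw [← h0, signPos, if_neg (lt_irrefl _)]
    rw [h2, zero_mul, Lstar, hmin.fderiv_eq_zero, zero_apply, sub_zero]
    exact mul_nonpos_of_nonneg_of_nonpos (le_max_right _ _) (by linarith)
  · rw [signPos, if_pos hpos, one_mul]

end Boundary

/-! ### Assembly and reflection `u ↦ -u` -/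

section PosPart

variable {n : ℕ} {Ω : Set (EuclideanSpace ℝ (Fin n))} {φ : EuclideanSpace ℝ (Fin n) → ℝ}
  {u f : EuclideanSpace ℝ (Fin n) → ℝ} {U : EuclideanSpace ℝ (Fin n) → EuclideanSpace ℝ (Fin n)}

theorem integrable_of_memLorentz_top {μ : Measure (EuclideanSpace ℝ (Fin n))} [IsFiniteMeasure μ]
    (hn : 2 ≤ n) (hu : MemLorentz u (ENNReal.ofReal ((n : ℝ) / ((n : ℝ) - 1))) ⊤ μ) :
    Integrable u μ := by
  obtain ⟨c, hc, hcA⟩ := exists_setLIntegral_le_of_memLorentz_top hn hu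
  refine ⟨hu.1, ?_⟩
  have := hcA univ MeasurableSet.univ
  rw [Measure.restrict_univ] at this
  refine this.trans_lt (ENNReal.mul_lt_top hc.lt_top (ENNReal.rpow_lt_top_of_nonneg (by positivity)
    (measure_ne_top _ _)))

/-- The Kato inequality for the positive part. -/
theorem kato_posPart (hn : 2 ≤ n) (hΩ : IsOpen Ω) (hΩb : Bornology.IsBounded Ω)
    (hu_sob : MemW11Loc Ω u)
    (hu_lor : MemLorentz u (ENNReal.ofReal ((n : ℝ) / ((n : ℝ) - 1))) ⊤ (volume.restrict Ω))
    (hu_wt : IntegrableOn (fun x => u x / bdist Ω x) Ω)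
    (hU_lor : ∀ i : Fin n, MemLorentz (fun x => U x i) (n : ℝ≥0∞) 1 (volume.restrict Ω))
    (hU_div : DivFree Ω U) (hLu : DistribL Ω U u f)
    (hf : IntegrableOn (fun x => f x * bdist Ω x) Ω)
    (hφ : MemW2 Ω φ) (hφ_nonneg : ∀ x ∈ Ω, 0 ≤ φ x) :
    IntegrableOn (fun x => max (u x) 0 * Lstar U φ x) Ω ∧
      IntegrableOn (fun x => φ x * signPos (u x) * f x) Ω ∧
      ∫ x in Ω, max (u x) 0 * Lstar U φ x ≤ ∫ x in Ω, φ x * signPos (u x) * f x := by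
  have : IsFiniteMeasure (volume.restrict Ω) := ⟨by simpa using hΩb.measure_lt_top⟩
  have hu := integrable_of_memLorentz_top hn hu_lor
  have hU := integrable_drift hn hU_lor
  have huU := integrable_smul_drift hn hU_lor hu_lor
  have hfm := aestronglyMeasurable_of_mul_bdist hn hΩ hΩb hf.1
  have hfl := locallyIntegrableOn_of_mul_bdist hn hΩ hΩb hf
  refine kato_posPart_boundary hn hΩ hΩb hu hU huU hu_wt hf (fun ζ hζ hζc hζΩ hζ0 => ?_) hφ
    hφ_nonneg
  refine kato_contDiff_two hΩ hu hU huU hfl hfm (fun η hη hη0 => ?_) hζ hζc hζΩ hζ0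
  exact kato_of_forall_ball hu hU huU hfl hfm (fun x₀ hx₀ =>
    exists_ball_kato hn hΩ hΩb hu_sob hu_lor hU_lor hU_div hLu hfl hx₀) hη hη0

theorem MemW11Loc.neg (hu : MemW11Loc Ω u) : MemW11Loc Ω fun x => - u x := by
  obtain ⟨h1, G, hG, hGu⟩ := hu
  refine ⟨h1.neg, fun x => - G x, hG.neg, fun η hη i => ?_⟩
  simp only [neg_mul, PiLp.neg_apply, integral_neg, hGu η hη i]

theorem MemLorentz.neg {α : Type*} [MeasurableSpace α] {μ : Measure α} {u : α → ℝ} {p q : ℝ≥0∞}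
    (hu : MemLorentz u p q μ) : MemLorentz (fun x => - u x) p q μ := by
  have h1 : decRearr (fun x => - u x) μ = decRearr u μ := by
    funext s
    simp only [decRearr, enorm_neg]
  have h2 : avgRearr (fun x => - u x) μ = avgRearr u μ := by
    funext t
    simp only [avgRearr, h1]
  refine ⟨hu.1.neg, ?_⟩
  have h3 : lorentzNorm (fun x => - u x) p q μ = lorentzNorm u p q μ := by
    simp only [lorentzNorm, h2]
  rw [h3]
  exact hu.2

theorem DistribL.neg (h : DistribL Ω U u f) : DistribL Ω U (fun x => - u x) fun x => - f x := by
  intro η hη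
  simp only [neg_mul, integral_neg, h η hη]

theorem sign_eq_signPos_sub (s : ℝ) : Real.sign s = signPos s - signPos (-s) := by
  rcases lt_trichotomy s 0 with h | rfl | h
  · rw [Real.sign_of_neg h, signPos, signPos, if_neg h.not_gt, if_pos (by linarith)]
    norm_num
  · simp [signPos]
  · rw [Real.sign_of_pos h, signPos, signPos, if_pos h, if_neg (by linarith)]
    norm_num

theorem abs_eq_posPart_add (s : ℝ) : |s| = max s 0 + max (-s) 0 := by
  rcases le_total 0 s with h | h
  · rw [abs_of_nonneg h, max_eq_left h, max_eq_right (by linarith), add_zero]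
  · rw [abs_of_nonpos h, max_eq_right h, max_eq_left (by linarith), zero_add]

end PosPart

end VWKato

end

theorem mainTheorem7 (n : ℕ) (hn : 2 ≤ n) (Ω : Set (EuclideanSpace ℝ (Fin n)))
    (hΩ : IsOpen Ω) (hΩb : Bornology.IsBounded Ω)
    (u : EuclideanSpace ℝ (Fin n) → ℝ)
    (U : EuclideanSpace ℝ (Fin n) → EuclideanSpace ℝ (Fin n))
    (f : EuclideanSpace ℝ (Fin n) → ℝ)
    (hu_sob : VWKato.MemW11Loc Ω u)
    (hu_lor : VWKato.MemLorentz u (ENNReal.ofReal ((n : ℝ) / ((n : ℝ) - 1))) ⊤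
      (volume.restrict Ω))
    (hu_wt : IntegrableOn (fun x => u x / VWKato.bdist Ω x) Ω)
    (hU_lor : ∀ i : Fin n, VWKato.MemLorentz (fun x => U x i) (n : ℝ≥0∞) 1
      (volume.restrict Ω))
    (hU_div : VWKato.DivFree Ω U)
    (hU_tan : VWKato.WeakTangential Ω U)
    (hLu : VWKato.DistribL Ω U u f)
    (hf : IntegrableOn (fun x => f x * VWKato.bdist Ω x) Ω)
    (φ : EuclideanSpace ℝ (Fin n) → ℝ) (hφ : VWKato.MemW2 Ω φ)
    (hφ_nonneg : ∀ x ∈ Ω, 0 ≤ φ x) :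
    (IntegrableOn (fun x => max (u x) 0 * VWKato.Lstar U φ x) Ω ∧
      IntegrableOn (fun x => φ x * VWKato.signPos (u x) * f x) Ω ∧
      ∫ x in Ω, max (u x) 0 * VWKato.Lstar U φ x
        ≤ ∫ x in Ω, φ x * VWKato.signPos (u x) * f x) ∧
    (IntegrableOn (fun x => |u x| * VWKato.Lstar U φ x) Ω ∧
      IntegrableOn (fun x => φ x * Real.sign (u x) * f x) Ω ∧
      ∫ x in Ω, |u x| * VWKato.Lstar U φ x
        ≤ ∫ x in Ω, φ x * Real.sign (u x) * f x) := by
  have hp := VWKato.kato_posPart hn hΩ hΩb hu_sob hu_lor hu_wt hU_lor hU_div hLu hf hφ hφ_nonneg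
  -- By linearity `-u` solves the equation with data `-f`, which yields the inequality for the
  -- negative part. Adding the two uses `|u| = u₊ + (-u)₊` and `sign(u) f = sign₊(u) f +
  -- sign₊(-u)(-f)`.
  have hm := VWKato.kato_posPart hn hΩ hΩb hu_sob.neg hu_lor.neg
    (by simp only [neg_div]; exact hu_wt.neg) hU_lor hU_div hLu.neg
    (by simp only [neg_mul]; exact hf.neg) hφ hφ_nonneg
  refine ⟨hp, ?_⟩
  have e1 : ∀ x, |u x| * VWKato.Lstar U φ x =
      max (u x) 0 * VWKato.Lstar U φ x + max (-u x) 0 * VWKato.Lstar U φ x := fun x => by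
    rw [VWKato.abs_eq_posPart_add, add_mul]
  have e2 : ∀ x, φ x * Real.sign (u x) * f x =
      φ x * VWKato.signPos (u x) * f x + φ x * VWKato.signPos (-u x) * -f x := fun x => by
    rw [VWKato.sign_eq_signPos_sub]
    ring
  simp only [e1, e2]
  refine ⟨hp.1.add hm.1, hp.2.1.add hm.2.1, ?_⟩
  rw [integral_add hp.1 hm.1, integral_add hp.2.1 hm.2.1]
  exact add_le_add hp.2.2 hm.2.2
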